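/- **Terminology.** For a locally profinite group $G$, a *level system* $\Upsilon$ on $G$ is a non-empty collection of compact open subgroups which is stable under (T1) conjugation and (T3) intersection, and such that (T2) for $K,L\in\Upsilon$ there is $K'\in\Upsilon$ with $K'\trianglelefteq K$ and $K'\subset L$. An *RIC functor* $M$ on $(G,\Upsilon)$ over a commutative ring $R$ consists of $R$-modules $M(K)$ ($K\in\Upsilon$) and, for $g\in G$ and $L,K\in\Upsilon$ with $g^{-1}Lg\subset K$, of $R$-linear maps $[g]^*_{L,K}:M(K)\to M(L)$ and $[g]_{L,K,*}:M(L)\to M(K)$, contravariantly resp. covariantly functorial for the composition $(L\xrightarrow{g}K)\circ(L'\xrightarrow{h}L)=(L'\xrightarrow{hg}K)$, such that $[g]^*_{L,K}=[g^{-1}]_{K,L,*}$ if $g^{-1}Lg=K$, and $[\gamma]_{K,K,*}=\mathrm{id}$ for $\gamma\in K$. Write $\mathrm{pr}^*=[1]^*$, $\mathrm{pr}_*=[1]_*$. *Morphisms* of RIC functors are families of $R$-linear maps commuting with all $[g]^*$ and $[g]_*$. $M$ is *CoMack* if $\mathrm{pr}_{L,K,*}\circ\mathrm{pr}_{L,K}^*=[K:L]$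 for all $L\subset K$ and if $\mathrm{pr}_{L,K}^*\circ\mathrm{pr}_{L',K,*}=\sum_{\gamma\in L\backslash K/L'}\mathrm{pr}_*\circ[\gamma]^*$ (through the levels $L\cap\gamma L'\gamma^{-1}$) for all $L,L'\subset K$. For $K\in\Upsilon$ and $\sigma\in G$ let $[K\sigma K]_*:M(K)\to M(K)$ be $\mathrm{pr}_*\circ[\sigma^{-1}]^*$ through the level $K\cap\sigma^{-1}K\sigma$; a compactly supported $K$-bi-invariant function $\mathfrak h=\sum_\sigma \mathfrak h(\sigma)\,\mathrm{ch}(K\sigma K)$ with values in $R$ acts on $M(K)$ by $\mathfrak h_*=\sum_\sigma \mathfrak h(\sigma)[K\sigma K]_*$. Let $\iota:H\to G$ be a closed embedding of locally profinite groups, and $\Upsilon_H,\Upsilon_G$ level systems with $\iota^{-1}(\Upsilon_G)\subset\Upsilon_H$. A *pushforward* $\iota_*:M_H\to M_G$ of RIC functors is a family of $R$-linear maps $\iota_{U,K,*}:M_H(U)\to M_G(K)$, for $U\in\Upsilon_H$, $K\in\Upsilon_G$ with $U\subset\iota^{-1}(K)$, commuting with $[h]_*$ for all $h\in H$. It is *Mackey*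 if for $U\subset\iota^{-1}(K)$, $L\subset K$ one has $\mathrm{pr}^*_{L,K}\circ\iota_{U,K,*}=\sum_{\gamma\in U\backslash K/L}[\gamma]_*\circ\iota_*\circ\mathrm{pr}^*$, through $U\cap\gamma L\gamma^{-1}$ and $\gamma L\gamma^{-1}$. Let $R$ be an integral domain contained in a field $\Phi$ of characteristic $0$, $M$ an RIC functor on $(H,\Upsilon_H)$ over $R$, and $\widehat M_\Phi=\varinjlim_{V\in\Upsilon_H}\Phi\otimes_R M(V)$ (limit along restrictions), with its natural $H$-action and natural maps $j_V:M(V)\to\widehat M_\Phi$. For $K\subset G$ compact open, let $\mathcal C(G/K,\widehat M_\Phi)$ be the space of compactly supported functions $\xi:G\to\widehat M_\Phi$ invariant under right translation by $K$, on which $h\in H$ acts by $(h\xi)(g)=h\cdot\xi(h^{-1}g)$. Given $U\in\Upsilon_H$, $x\in M(U)$, a compactly supported $K$-bi-invariant $\mathfrak h:G\to R$ and $L\subset K$, a *zeta element* for $(x,\mathfrak h,L)$ is a $\zeta\in\mathcal C(G/K,\widehat M_\Phi)$ with the same class in $H$-coinvariants as $g\mapsto\mathfrak h(g)j_U(x)$,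 such that for each $g\in G$ the value $\zeta(g)$ is a finite sum $\sum_i[U:V_i]\,j_{V_i}(x_i)$ with $V_i\in\Upsilon_H$, $V_i\subset gLg^{-1}$, $x_i\in M(V_i)$. Here $[U:V]=\mu(U)/\mu(V)$ for a Haar measure $\mu$ on $H$. **Setting.** Let $\iota_v:H_v\to G_v$ $(v\in I)$ be closed embeddings of unimodular locally profinite groups, $K_v\subset G_v$ compact open, $U_v=\iota_v^{-1}(K_v)$, and $G$, $H$ the restricted products of the $G_v$, $H_v$ with respect to the $K_v$, $U_v$, with $\iota:H\to G$ the induced embedding; put $K=\prod K_v$, $U=\prod U_v$. Let $I'\subset I$ have finite complement, and for $v\in I'$ let $L_v$ be a compact open normal subgroup of $K_v$. For a finite subset $\nu\subset I'$ put $K[\nu]=\prod_{v\in\nu}L_v\times\prod_{v\notin\nu}K_v$. Let $\Upsilon_G$ be a level system on $G$ containing $K$ and $K[\{v\}]$ for all $v\in I'$ (hence all $K[\nu]$), and $\Upsilon_H$ a level system on $H$ containing $\iota^{-1}(\Upsilon_G)$. Let $\mathcal O$ be an integral domain whose fraction field $\Phi$ has characteristic $0$, let $M_H$, $M_G$ be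 CoMack functors over $\mathcal O$ on $(H,\Upsilon_H)$, $(G,\Upsilon_G)$, let $\iota_*:M_H\to M_G$ be a Mackey pushforward and $x_U\in M_H(U)$. For $v\in I'$ let $\mathfrak H_v:G_v\to\mathcal O$ be compactly supported and $K_v$-bi-invariant. For disjoint finite $\nu,\lambda\subset I'$ let $\mathfrak H_{\lambda,*}$ be the endomorphism of $M_G(K[\nu])$ given by the $K[\nu]$-bi-invariant function $\mathrm{ch}(K'')\otimes\bigotimes_{v\in\lambda}\mathfrak H_v$, where $K''=\prod_{v\in\nu}L_v\times\prod_{v\notin\nu\cup\lambda}K_v$. Let $\Upsilon_{G_v}$ be the collection of finite intersections of conjugates of $K_v$ and (if $v\in I'$) $L_v$, let $\Upsilon_{H_v}=\iota_v^{-1}(\Upsilon_{G_v})$, and let $\Upsilon_{H,I}\subset\Upsilon_H$ be the level system of all $\prod_v W_v$ with $W_v\in\Upsilon_{H_v}$ for all $v$ and $W_v=U_v$ for almost all $v$. **Theorem.** For each $v\in I$ let $N_v$ be an $\mathcal O$-torsion-free CoMack functor over $\mathcal O$ on $(H_v,\Upsilon_{H_v})$ and $\phi_{U_v}\in N_v(U_v)$.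 Let $N=\bigotimes'_vN_v$ be the restricted tensor product with respect to $(\phi_{U_v})_v$, i.e. the RIC functor $\prod_vW_v\mapsto\bigotimes'_vN_v(W_v)$ on $(H,\Upsilon_{H,I})$, and let $\varphi:N\to M_H|_{\Upsilon_{H,I}}$ be a morphism with $\varphi(\otimes_v\phi_{U_v})=x_U$. Suppose that for every $v\in I'$ there is a zeta element for $(\phi_{U_v},\mathfrak H_v,L_v)$ with coefficients in $\Phi$ (a function $G_v\to\widehat N_{v,\Phi}$). Then there are classes $y_\nu\in M_G(K[\nu])$, one for each finite subset $\nu\subset I'$, such that $y_\varnothing=\iota_{U,K,*}(x_U)$ and $$\mathfrak H_{\mu\setminus\nu,*}(y_\nu)=\mathrm{pr}_{\mu,\nu,*}(y_\mu)\qquad\text{for all finite }\nu\subset\mu\subset I',$$ where $\mathrm{pr}_{\mu,\nu,*}:M_G(K[\mu])\to M_G(K[\nu])$ is the pushforward along $K[\mu]\subset K[\nu]$. -/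

import Mathlib

open Filter Topology
open scoped RestrictedProduct TensorProduct

namespace ZetaGluing

noncomputable section

/-! ### Locally profinite groups and collections of compact open subgroups -/

/-- Locally profinite groups: locally compact, Hausdorff, totally disconnected topological groups. -/
class LocallyProfinite (G : Type*) [Group G] [TopologicalSpace G] : Prop extends
  IsTopologicalGroup G, LocallyCompactSpace G, T2Space G, TotallyDisconnectedSpace G

/-- Unimodularity: left Haar measures are right invariant, i.e. the modular character is trivial. -/
def IsUnimodular (G : Type*) [Group G] [TopologicalSpace G] [LocallyProfinite G] : Prop :=
  ∀ g : G, MeasureTheory.Measure.modularCharacterFun g = 1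

/-- The conjugate `g K g⁻¹`. -/
def conj {G : Type*} [Group G] (g : G) (K : Subgroup G) : Subgroup G where
  carrier := {x | g⁻¹ * x * g ∈ K}
  one_mem' := by simp
  mul_mem' := by
    intro a b ha hb
    have := K.mul_mem ha hb
    simpa [mul_assoc] using this
  inv_mem' := by
    intro a ha
    have := K.inv_mem ha
    simpa [mul_assoc] using this

section conj

variable {G : Type*} [Group G]

theorem mem_conj {g x : G} {K : Subgroup G} : x ∈ conj g K ↔ g⁻¹ * x * g ∈ K := Iff.rfl

theorem conj_mono (g : G) {K L : Subgroup G} (h : K ≤ L) : conj g K ≤ conj g L :=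
  fun _ hx => h hx

theorem conj_mul (g h : G) (K : Subgroup G) : conj (g * h) K = conj g (conj h K) := by
  ext x; simp [mem_conj, mul_assoc]

theorem conj_one (K : Subgroup G) : conj 1 K = K := by
  ext x; simp [mem_conj]

theorem conj_inf (g : G) (K L : Subgroup G) : conj g (K ⊓ L) = conj g K ⊓ conj g L := rfl

theorem conj_of_mem {g : G} {K : Subgroup G} (hg : g ∈ K) : conj g K = K := by
  ext x
  rw [mem_conj, K.mul_mem_cancel_right hg, K.mul_mem_cancel_left (K.inv_mem hg)]

theorem le_conj_one {L K : Subgroup G} (h : L ≤ K) : L ≤ conj 1 K := by rwa [conj_one]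

theorem le_conj_mul {g h : G} {K L L' : Subgroup G} (h₁ : L' ≤ conj h L) (h₂ : L ≤ conj g K) :
    L' ≤ conj (h * g) K := by
  rw [conj_mul]; exact h₁.trans (conj_mono h h₂)

theorem conj_inv_le {g : G} {L K : Subgroup G} (h : L = conj g K) : K ≤ conj g⁻¹ L := by
  rw [h, ← conj_mul, inv_mul_cancel, conj_one]

end conj

/-- A non-empty collection of compact open subgroups of `G` satisfying the axioms
(T1) stability under conjugation, (T2) any `K` contains a normal subgroup `K'` in the collection
that is also contained in a given `L`, (T3) stability under intersection. -/
structure LevelSystem (G : Type*) [Group G] [TopologicalSpace G] where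
  carrier : Set (Subgroup G)
  nonempty : carrier.Nonempty
  isOpen : ∀ K ∈ carrier, IsOpen (K : Set G)
  isCompact : ∀ K ∈ carrier, IsCompact (K : Set G)
  conj_mem : ∀ (g : G), ∀ K ∈ carrier, conj g K ∈ carrier
  exists_normal : ∀ K ∈ carrier, ∀ L ∈ carrier,
    ∃ K' ∈ carrier, K' ≤ K ∧ K' ≤ L ∧ ∀ k ∈ K, ∀ x ∈ K', k * x * k⁻¹ ∈ K'
  inf_mem : ∀ K ∈ carrier, ∀ L ∈ carrier, K ⊓ L ∈ carrier

instance {G : Type*} [Group G] [TopologicalSpace G] :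
    SetLike (LevelSystem G) (Subgroup G) where
  coe Υ := Υ.carrier
  coe_injective := by
    rintro ⟨⟩ ⟨⟩ h
    simpa using h

namespace LevelSystem

variable {G : Type*} [Group G] [TopologicalSpace G]

theorem finite_conjugates [IsTopologicalGroup G] {K L : Subgroup G}
    (hK : IsCompact (K : Set G)) (hL : IsOpen (L : Set G)) :
    {A : Subgroup G | ∃ k ∈ K, A = conj k L}.Finite := by
  obtain ⟨t, -, ht⟩ := hK.elim_nhds_subcover (fun k : G => {x | k⁻¹ * x ∈ L}) (by
    intro k _
    have : IsOpen {x : G | k⁻¹ * x ∈ L} := hL.preimage (continuous_const_mul k⁻¹)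
    exact this.mem_nhds (by simp))
  refine (t.finite_toSet.image (fun k => conj k L)).subset ?_
  rintro A ⟨k, hk, rfl⟩
  obtain ⟨γ, hγ, hkγ⟩ := Set.mem_iUnion₂.1 (ht hk)
  refine ⟨γ, hγ, ?_⟩
  have : conj (γ⁻¹ * k) L = L := conj_of_mem hkγ
  calc conj γ L = conj γ (conj (γ⁻¹ * k) L) := by rw [this]
    _ = conj k L := by rw [← conj_mul, mul_inv_cancel_left]

/-- For a collection of compact open subgroups, (T2) follows from (T1) and (T3). -/
theorem exists_normal_of [IsTopologicalGroup G] {S : Set (Subgroup G)}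
    (ho : ∀ K ∈ S, IsOpen (K : Set G)) (hc : ∀ K ∈ S, IsCompact (K : Set G))
    (h1 : ∀ (g : G), ∀ K ∈ S, conj g K ∈ S) (h3 : ∀ K ∈ S, ∀ L ∈ S, K ⊓ L ∈ S) :
    ∀ K ∈ S, ∀ L ∈ S, ∃ K' ∈ S, K' ≤ K ∧ K' ≤ L ∧ ∀ k ∈ K, ∀ x ∈ K', k * x * k⁻¹ ∈ K' := by
  classical
  intro K hK L hL
  set F := (finite_conjugates (hc K hK) (ho L hL)).toFinset with hF
  have key : ∀ T : Finset (Subgroup G), (∀ A ∈ T, A ∈ S) → K ⊓ T.inf id ∈ S := by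
    intro T
    induction T using Finset.induction_on with
    | empty => intro _; simpa using hK
    | insert A T _ ih =>
      intro h
      rw [Finset.inf_insert, id, inf_left_comm]
      exact h3 _ (h A (by simp)) _ (ih fun B hB => h B (by simp [hB]))
  have hFm : ∀ A, A ∈ F ↔ ∃ k ∈ K, A = conj k L := by intro A; simp [hF]
  refine ⟨K ⊓ F.inf id, key F ?_, inf_le_left, ?_, ?_⟩
  · intro A hA
    obtain ⟨k, _, rfl⟩ := (hFm A).1 hA
    exact h1 k L hL
  · refine inf_le_right.trans (Finset.inf_le (f := id) ((hFm L).2 ⟨1, K.one_mem, ?_⟩))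
    rw [conj_one]
  · rintro k hk x ⟨hxK, hx⟩
    refine ⟨K.mul_mem (K.mul_mem hk hxK) (K.inv_mem hk), ?_⟩
    have : ∀ A ∈ F, k * x * k⁻¹ ∈ A := by
      intro A hA
      obtain ⟨k', hk', rfl⟩ := (hFm A).1 hA
      have h2 : F.inf id ≤ conj (k⁻¹ * k') L :=
        Finset.inf_le (f := id) ((hFm _).2 ⟨k⁻¹ * k', K.mul_mem (K.inv_mem hk) hk', rfl⟩)
      have := h2 hx
      simpa [mem_conj, mul_assoc] using this
    have h4 : Subgroup.zpowers (k * x * k⁻¹) ≤ F.inf id :=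
      Finset.le_inf fun A hA => (Subgroup.zpowers_le).2 (this A hA)
    exact h4 (Subgroup.mem_zpowers _)

/-- Finite (non-empty) intersections of conjugates of members of `F`. -/
inductive Gen (F : Set (Subgroup G)) : Subgroup G → Prop
  | conj (g : G) {A : Subgroup G} (hA : A ∈ F) : Gen F (conj g A)
  | inf {A B : Subgroup G} (hA : Gen F A) (hB : Gen F B) : Gen F (A ⊓ B)

/-- The collection generated by a non-empty set `F` of compact open subgroups: all finite
intersections of conjugates of members of `F`. -/
def generate [IsTopologicalGroup G] (F : Set (Subgroup G)) (hne : F.Nonempty)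
    (ho : ∀ A ∈ F, IsOpen (A : Set G)) (hc : ∀ A ∈ F, IsCompact (A : Set G)) :
    LevelSystem G :=
  have hconj : ∀ (g : G) (A : Subgroup G), (conj g A : Set G) = (fun x => g⁻¹ * x * g) ⁻¹' A :=
    fun _ _ => rfl
  have hcont : ∀ g : G, Continuous fun x : G => g⁻¹ * x * g := fun g =>
    (continuous_const_mul g⁻¹).mul continuous_const
  have ho' : ∀ K ∈ {A | Gen F A}, IsOpen (K : Set G) := by
    intro K hK
    induction hK with
    | conj g hA => rw [hconj]; exact (ho _ hA).preimage (hcont g)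
    | inf _ _ iA iB => exact iA.inter iB
  have hclosed : ∀ K ∈ {A | Gen F A}, IsClosed (K : Set G) := fun K hK =>
    Subgroup.isClosed_of_isOpen K (ho' K hK)
  have hc' : ∀ K ∈ {A | Gen F A}, IsCompact (K : Set G) := by
    intro K hK
    induction hK with
    | @conj g A hA =>
      have : (conj g A : Set G) = (fun x => g * x * g⁻¹) '' A := by
        ext x
        constructor
        · intro hx
          exact ⟨g⁻¹ * x * g, hx, by simp [mul_assoc]⟩
        · rintro ⟨y, hy, rfl⟩
          change g⁻¹ * (g * y * g⁻¹) * g ∈ A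
          simpa [mul_assoc] using hy
      rw [this]
      exact (hc _ hA).image ((continuous_const_mul g).mul continuous_const)
    | inf _ hB iA iB => exact iA.inter_right (hclosed _ hB)
  have h1 : ∀ (g : G), ∀ K ∈ {A | Gen F A}, conj g K ∈ {A | Gen F A} := by
    intro g K hK
    induction hK with
    | conj h hA => rw [← conj_mul]; exact Gen.conj _ hA
    | inf _ _ iA iB => exact Gen.inf iA iB
  { carrier := {A | Gen F A}
    nonempty := hne.elim fun A hA => ⟨conj 1 A, Gen.conj 1 hA⟩
    isOpen := ho'
    isCompact := hc'
    conj_mem := h1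
    exists_normal := exists_normal_of ho' hc' h1 fun _ hK _ hL => Gen.inf hK hL
    inf_mem := fun _ hK _ hL => Gen.inf hK hL }

/-- The pullback `ι⁻¹(Υ) = {ι⁻¹(K) | K ∈ Υ}` along a closed embedding. -/
def comap {H : Type*} [Group H] [TopologicalSpace H] (ι : H →* G) (hι : IsClosedEmbedding ι)
    (Υ : LevelSystem G) : LevelSystem H where
  carrier := {V | ∃ K ∈ Υ, V = K.comap ι}
  nonempty := Υ.nonempty.elim fun K hK => ⟨_, K, hK, rfl⟩
  isOpen := by
    rintro _ ⟨K, hK, rfl⟩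
    exact (Υ.isOpen K hK).preimage hι.continuous
  isCompact := by
    rintro _ ⟨K, hK, rfl⟩
    exact hι.isCompact_preimage (Υ.isCompact K hK)
  conj_mem := by
    rintro h _ ⟨K, hK, rfl⟩
    refine ⟨conj (ι h) K, Υ.conj_mem _ K hK, ?_⟩
    ext x
    simp [mem_conj]
  exists_normal := by
    rintro _ ⟨K, hK, rfl⟩ _ ⟨L, hL, rfl⟩
    obtain ⟨K', hK', h1, h2, h3⟩ := Υ.exists_normal K hK L hL
    refine ⟨_, ⟨K', hK', rfl⟩, fun x hx => h1 hx, fun x hx => h2 hx, ?_⟩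
    intro k hk x hx
    simpa using h3 _ hk _ hx
  inf_mem := by
    rintro _ ⟨K, hK, rfl⟩ _ ⟨L, hL, rfl⟩
    exact ⟨K ⊓ L, Υ.inf_mem K hK L hL, rfl⟩

end LevelSystem

/-! ### Restricted products -/

section RestrictedProducts

variable {I : Type*} {G : I → Type*} [∀ v, Group (G v)]

/-- The restricted direct product of the groups `G v` with respect to the subgroups `K v`
(with its group structure and restricted product topology). -/
abbrev RProd (G : I → Type*) [∀ v, Group (G v)] (K : ∀ v, Subgroup (G v)) : Type _ :=
  Πʳ v, [G v, K v]

/-- The subgroup `∏ v, W v` of the restricted product (of all elements with components in `W v`). -/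
def prodSubgroup (K W : ∀ v, Subgroup (G v)) : Subgroup (RProd G K) where
  carrier := {g | ∀ v, g v ∈ W v}
  one_mem' := fun v => (W v).one_mem
  mul_mem' := fun ha hb v => (W v).mul_mem (ha v) (hb v)
  inv_mem' := fun ha v => (W v).inv_mem (ha v)

theorem mem_prodSubgroup {K W : ∀ v, Subgroup (G v)} {g : RProd G K} :
    g ∈ prodSubgroup K W ↔ ∀ v, g v ∈ W v := Iff.rfl

/-- The component group at `v` of a subgroup of the restricted product. -/
def comp {K : ∀ v, Subgroup (G v)} (W : Subgroup (RProd G K)) (v : I) : Subgroup (G v) :=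
  W.map (RestrictedProduct.evalMonoidHom G v)

theorem comp_prodSubgroup (K W : ∀ v, Subgroup (G v)) (v : I) :
    comp (prodSubgroup K W) v = W v := by
  classical
  ext x
  constructor
  · rintro ⟨g, hg, rfl⟩
    exact hg v
  · intro hx
    refine ⟨RestrictedProduct.mulSingle K v x, ?_, ?_⟩
    · intro w
      rcases eq_or_ne w v with rfl | hw
      · rw [RestrictedProduct.mulSingle_eq_same]; exact hx
      · rw [RestrictedProduct.mulSingle_eq_of_ne _ _ hw]; exact (W w).one_mem
    · exact RestrictedProduct.mulSingle_eq_same K v x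

theorem comp_le_conj {K : ∀ v, Subgroup (G v)} {L L' : Subgroup (RProd G K)} {g : RProd G K}
    (h : L ≤ conj g L') (v : I) : comp L v ≤ conj (g v) (comp L' v) := by
  rintro _ ⟨x, hx, rfl⟩
  exact ⟨g⁻¹ * x * g, h hx, rfl⟩

variable [∀ v, TopologicalSpace (G v)]

theorem isOpen_prodSubgroup {K W : ∀ v, Subgroup (G v)} (hK : ∀ v, IsOpen (K v : Set (G v)))
    (hW : ∀ v, IsOpen (W v : Set (G v))) (hWK : ∀ᶠ v in cofinite, W v = K v) :
    IsOpen (prodSubgroup K W : Set (RProd G K)) := by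
  have hfin : {v | ¬ W v = K v}.Finite := hWK
  have : (prodSubgroup K W : Set (RProd G K)) =
      {g | ∀ v, W v = K v → g.1 v ∈ (K v : Set (G v))} ∩
        ⋂ v ∈ {v | ¬ W v = K v}, (fun g : RProd G K => g v) ⁻¹' (W v : Set (G v)) := by
    ext g
    simp only [Set.mem_inter_iff, Set.mem_iInter, Set.mem_ofPred_eq, Set.mem_preimage]
    constructor
    · intro hg
      exact ⟨fun v hv => by rw [← hv]; exact hg v, fun v _ => hg v⟩
    · rintro ⟨h1, h2⟩ v
      by_cases hv : W v = K v
      · rw [hv]; exact h1 v hv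
      · exact h2 v hv
  rw [this]
  refine (RestrictedProduct.isOpen_forall_imp_mem hK).inter ?_
  exact hfin.isOpen_biInter fun v _ => (hW v).preimage (RestrictedProduct.continuous_eval v)

theorem isCompact_prodSubgroup {K W : ∀ v, Subgroup (G v)}
    (hW : ∀ v, IsCompact (W v : Set (G v))) (hWK : ∀ᶠ v in cofinite, W v = K v) :
    IsCompact (prodSubgroup K W : Set (RProd G K)) := by
  have hS : (cofinite : Filter I) ≤ 𝓟 {v | W v = K v} := le_principal_iff.2 hWK
  have : ∀ v, CompactSpace (W v) := fun v => isCompact_iff_compactSpace.1 (hW v)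
  let f : (∀ v, W v) → Πʳ v, [G v, K v]_[𝓟 {v | W v = K v}] := fun x =>
    ⟨fun v => x v, eventually_principal.2 fun v (hv : W v = K v) => by
      have := (x v).2
      change (x v : G v) ∈ K v
      rwa [← hv]⟩
  have hf : Continuous f := by
    rw [RestrictedProduct.continuous_rng_of_principal]
    exact continuous_pi fun v => continuous_subtype_val.comp (continuous_apply v)
  have hr : (prodSubgroup K W : Set (RProd G K)) =
      Set.range (fun x => RestrictedProduct.inclusion G (fun v => (K v : Set (G v))) hS (f x)) := by
    ext g
    constructor
    · intro hg
      exact ⟨fun v => ⟨g v, hg v⟩, rfl⟩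
    · rintro ⟨x, rfl⟩ v
      exact (x v).2
  rw [hr]
  exact isCompact_range ((RestrictedProduct.continuous_inclusion hS).comp hf)

/-- The collection of the subgroups `∏ v, W v` of the restricted product with `W v ∈ Υ v` for all
`v` and `W v = K v` for all but finitely many `v`. -/
def LevelSystem.restrictedProduct (Υ : ∀ v, LevelSystem (G v)) (K : ∀ v, Subgroup (G v))
    (hK : ∀ v, K v ∈ Υ v) : LevelSystem (RProd G K) where
  carrier := {A | ∃ W : ∀ v, Subgroup (G v),
    (∀ v, W v ∈ Υ v) ∧ (∀ᶠ v in cofinite, W v = K v) ∧ A = prodSubgroup K W}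
  nonempty := ⟨_, K, hK, Eventually.of_forall fun _ => rfl, rfl⟩
  isOpen := by
    rintro _ ⟨W, hW, hWK, rfl⟩
    exact isOpen_prodSubgroup (fun v => (Υ v).isOpen _ (hK v)) (fun v => (Υ v).isOpen _ (hW v)) hWK
  isCompact := by
    rintro _ ⟨W, hW, hWK, rfl⟩
    exact isCompact_prodSubgroup (fun v => (Υ v).isCompact _ (hW v)) hWK
  conj_mem := by
    rintro g _ ⟨W, hW, hWK, rfl⟩
    refine ⟨fun v => conj (g v) (W v), fun v => (Υ v).conj_mem _ _ (hW v), ?_, rfl⟩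
    filter_upwards [hWK, g.2] with v h1 h2
    rw [h1]
    exact conj_of_mem h2
  exists_normal := by
    classical
    rintro _ ⟨W, hW, hWK, rfl⟩ _ ⟨V, hV, hVK, rfl⟩
    choose X hX h1 h2 h3 using fun v => (Υ v).exists_normal _ (hW v) _ (hV v)
    refine ⟨_, ⟨fun v => if W v = K v ∧ V v = K v then K v else X v, ?_, ?_, rfl⟩, ?_, ?_, ?_⟩
    · intro v
      dsimp only
      split_ifs
      exacts [hK v, hX v]
    · filter_upwards [hWK, hVK] with v a b
      rw [if_pos ⟨a, b⟩]
    · intro g hg v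
      have := hg v
      dsimp only at this
      split_ifs at this with h
      · rw [h.1]; exact this
      · exact h1 v this
    · intro g hg v
      have := hg v
      dsimp only at this
      split_ifs at this with h
      · rw [h.2]; exact this
      · exact h2 v this
    · intro k hk x hx v
      have := hx v
      have hkv := hk v
      change k v * x v * (k v)⁻¹ ∈ _
      dsimp only at this ⊢
      split_ifs at this ⊢ with h
      · rw [h.1] at hkv
        exact (K v).mul_mem ((K v).mul_mem hkv this) ((K v).inv_mem hkv)
      · exact h3 v _ hkv _ this
  inf_mem := by
    rintro _ ⟨W, hW, hWK, rfl⟩ _ ⟨V, hV, hVK, rfl⟩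
    refine ⟨fun v => W v ⊓ V v, fun v => (Υ v).inf_mem _ (hW v) _ (hV v), ?_, ?_⟩
    · filter_upwards [hWK, hVK] with v a b
      rw [a, b, inf_idem]
    · ext g
      exact forall_and.symm

theorem LevelSystem.comp_mem {Υ : ∀ v, LevelSystem (G v)} {K : ∀ v, Subgroup (G v)}
    {hK : ∀ v, K v ∈ Υ v} {W : Subgroup (RProd G K)} (hW : W ∈ restrictedProduct Υ K hK) (v : I) :
    comp W v ∈ Υ v := by
  obtain ⟨W, hW, -, rfl⟩ := hW
  rw [comp_prodSubgroup]
  exact hW v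

theorem LevelSystem.comp_eventually {Υ : ∀ v, LevelSystem (G v)} {K : ∀ v, Subgroup (G v)}
    {hK : ∀ v, K v ∈ Υ v} {W : Subgroup (RProd G K)} (hW : W ∈ restrictedProduct Υ K hK) :
    ∀ᶠ v in cofinite, comp W v = K v := by
  obtain ⟨W, -, hW, rfl⟩ := hW
  filter_upwards [hW] with v hv
  rw [comp_prodSubgroup, hv]

end RestrictedProducts

/-! ### RIC functors -/

namespace LevelSystem

variable {G : Type*} [Group G] [TopologicalSpace G] (Υ : LevelSystem G)

/-- The member `g K g⁻¹` of the collection. -/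
abbrev conjLevel (g : G) (K : Υ) : Υ := ⟨conj g K, Υ.conj_mem g K K.2⟩

/-- The member `K ∩ L` of the collection. -/
abbrev infLevel (K L : Υ) : Υ := ⟨(K : Subgroup G) ⊓ L, Υ.inf_mem K K.2 L L.2⟩

end LevelSystem

/-- RIC functors (restriction, induction, conjugation) on `(G, Υ)` with values in `R`-modules.
The condition `L ≤ conj g K`, i.e. `g⁻¹ L g ⊆ K`, says that `g` is a morphism `L ⟶ K` of the
category of compact opens, in which the composite of `h : L' ⟶ L` and `g : L ⟶ K` is
`h * g : L' ⟶ K`; `pull g` and `push g` are the maps `[g]^*` and `[g]_*`. -/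
structure RIC.{w, u, v} (R : Type u) [CommRing R] {G : Type v} [Group G] [TopologicalSpace G]
    (Υ : LevelSystem G) where
  obj : Υ → Type w
  [addCommGroup : ∀ K, AddCommGroup (obj K)]
  [module : ∀ K, Module R (obj K)]
  pull : ∀ (g : G) {L K : Υ}, (L : Subgroup G) ≤ conj g K → (obj K →ₗ[R] obj L)
  push : ∀ (g : G) {L K : Υ}, (L : Subgroup G) ≤ conj g K → (obj L →ₗ[R] obj K)
  pull_one : ∀ {K : Υ} (h : (K : Subgroup G) ≤ conj 1 K) (x : obj K), pull 1 h x = x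
  push_one : ∀ {K : Υ} (h : (K : Subgroup G) ≤ conj 1 K) (x : obj K), push 1 h x = x
  pull_mul : ∀ (g h : G) {L' L K : Υ} (h₁ : (L' : Subgroup G) ≤ conj h L)
    (h₂ : (L : Subgroup G) ≤ conj g K) (x : obj K),
    pull (h * g) (le_conj_mul h₁ h₂) x = pull h h₁ (pull g h₂ x)
  push_mul : ∀ (g h : G) {L' L K : Υ} (h₁ : (L' : Subgroup G) ≤ conj h L)
    (h₂ : (L : Subgroup G) ≤ conj g K) (x : obj L'),
    push (h * g) (le_conj_mul h₁ h₂) x = push g h₂ (push h h₁ x)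
  pull_eq_push : ∀ (g : G) {L K : Υ} (h : (L : Subgroup G) = conj g K) (x : obj K),
    pull g h.le x = push g⁻¹ (conj_inv_le h) x
  push_of_mem : ∀ {K : Υ} (γ : G), γ ∈ (K : Subgroup G) →
    ∀ (h : (K : Subgroup G) ≤ conj γ K) (x : obj K), push γ h x = x

attribute [instance] RIC.addCommGroup RIC.module

/-- `T` is a set of representatives, contained in `K`, of the double cosets `A \ K / B`. -/
def IsDoubleCosetReps {G : Type*} [Group G] (A K B : Subgroup G) (T : Finset G) : Prop :=
  (∀ γ ∈ T, γ ∈ K) ∧ ∀ k ∈ K, ∃! γ, γ ∈ T ∧ ∃ a ∈ A, ∃ b ∈ B, k = a * γ * b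

namespace RIC

variable {R : Type*} [CommRing R] {G : Type*} [Group G] [TopologicalSpace G] {Υ : LevelSystem G}

/-- The axiom (Co): `pr_* ∘ pr^*` is multiplication by the index. -/
def IsCohomological (M : RIC R Υ) : Prop :=
  ∀ (L K : Υ) (h : (L : Subgroup G) ≤ K) (x : M.obj K),
    M.push 1 (le_conj_one h) (M.pull 1 (le_conj_one h) x) =
      ((L : Subgroup G).relIndex K) • x

/-- The axiom (M): for `L, L' ⊆ K`, `pr^* ∘ pr_* = ∑ pr_* ∘ [γ]^*` over representatives `γ` of
`L \ K / L'`, through the levels `L ∩ γ L' γ⁻¹`. -/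
def IsMackey (M : RIC R Υ) : Prop :=
  ∀ (K L L' : Υ) (hL : (L : Subgroup G) ≤ K) (hL' : (L' : Subgroup G) ≤ K) (T : Finset G),
    IsDoubleCosetReps (L : Subgroup G) K L' T → ∀ x : M.obj L',
    M.pull 1 (le_conj_one hL) (M.push 1 (le_conj_one hL') x) =
      ∑ γ ∈ T, M.push 1 (L := Υ.infLevel L (Υ.conjLevel γ L')) (K := L) (le_conj_one inf_le_left)
        (M.pull γ (K := L') inf_le_right x)

/-- Cohomological Mackey functors. -/
def IsCoMack (M : RIC R Υ) : Prop := M.IsCohomological ∧ M.IsMackey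

/-- All the modules `M(K)` are torsion free over the domain `R`. -/
def IsTorsionFree (M : RIC R Υ) : Prop :=
  ∀ (K : Υ) (r : R) (x : M.obj K), r • x = 0 → r = 0 ∨ x = 0

/-- Morphisms of RIC functors; here the source may be defined on a smaller collection `Υ` than the
target, which is then restricted to `Υ`. -/
structure Hom {Υ Υ' : LevelSystem G} (hΥ : ∀ K ∈ Υ, K ∈ Υ') (N : RIC R Υ) (M : RIC R Υ') where
  app : ∀ K : Υ, N.obj K →ₗ[R] M.obj ⟨K, hΥ K K.2⟩
  app_pull : ∀ (g : G) {L K : Υ} (h : (L : Subgroup G) ≤ conj g K) (x : N.obj K),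
    app L (N.pull g h x) = M.pull g h (app K x)
  app_push : ∀ (g : G) {L K : Υ} (h : (L : Subgroup G) ≤ conj g K) (x : N.obj L),
    app K (N.push g h x) = M.push g h (app L x)

/-! ### Hecke correspondences -/

/-- The Hecke correspondence `[K' σ K] : M(K) → M(K')`, i.e. `pr_* ∘ [σ]^*` through the level
`K' ∩ σ K σ⁻¹`. -/
def hecke (M : RIC R Υ) (K' : Υ) (σ : G) (K : Υ) : M.obj K →ₗ[R] M.obj K' :=
  M.push 1 (L := Υ.infLevel K' (Υ.conjLevel σ K)) (K := K') (le_conj_one inf_le_left) ∘ₗ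
    M.pull σ (K := K) inf_le_right

/-- The covariant action on `M(K)` of a `K`-bi-invariant compactly supported function `f` on `G`:
the (finite) sum of `f(σ) • [K σ K]_*` over the double cosets `K σ K`, where `[K σ K]_*` is the
transpose `[K σ⁻¹ K]`. -/
def heckeCov (M : RIC R Υ) (K : Υ) (f : G → R) : M.obj K →ₗ[R] M.obj K :=
  ∑ᶠ q : DoubleCoset.Quotient ((K : Subgroup G) : Set G) ((K : Subgroup G) : Set G),
    f (Quotient.out q) • M.hecke K (Quotient.out q)⁻¹ K

/-! ### Inductive completions -/

/-- The functor `K ↦ S ⊗ M(K)`. -/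
def baseChange (M : RIC R Υ) (S : Type*) [CommRing S] [Algebra R S] : RIC S Υ where
  obj K := S ⊗[R] M.obj K
  pull g _ _ h := (M.pull g h).baseChange S
  push g _ _ h := (M.push g h).baseChange S
  pull_one h x := by
    rw [show M.pull 1 h = .id from LinearMap.ext fun x => M.pull_one h x, LinearMap.baseChange_id]
    rfl
  push_one h x := by
    rw [show M.push 1 h = .id from LinearMap.ext fun x => M.push_one h x, LinearMap.baseChange_id]
    rfl
  pull_mul g h _ _ _ h₁ h₂ x := by
    rw [show M.pull (h * g) (le_conj_mul h₁ h₂) = M.pull h h₁ ∘ₗ M.pull g h₂ from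
      LinearMap.ext fun x => M.pull_mul g h h₁ h₂ x, LinearMap.baseChange_comp]
    rfl
  push_mul g h _ _ _ h₁ h₂ x := by
    rw [show M.push (h * g) (le_conj_mul h₁ h₂) = M.push g h₂ ∘ₗ M.push h h₁ from
      LinearMap.ext fun x => M.push_mul g h h₁ h₂ x, LinearMap.baseChange_comp]
    rfl
  pull_eq_push g _ _ h x := by
    rw [show M.pull g h.le = M.push g⁻¹ (conj_inv_le h) from
      LinearMap.ext fun x => M.pull_eq_push g h x]
  push_of_mem γ hγ h x := by
    rw [show M.push γ h = .id from LinearMap.ext fun x => M.push_of_mem γ hγ h x,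
      LinearMap.baseChange_id]
    rfl

open Classical in
/-- The inductive completion `lim_K M(K)` along all restriction maps. -/
abbrev Completion (M : RIC R Υ) : Type _ :=
  Module.DirectLimit (ι := (Υ)ᵒᵈ) (fun K => M.obj (OrderDual.ofDual K))
    (fun K L (h : K ≤ L) => M.pull 1 (L := OrderDual.ofDual L) (K := OrderDual.ofDual K)
      (le_conj_one h))

open Classical in
/-- The canonical map `M(K) → lim_K M(K)`. -/
def toCompletion (M : RIC R Υ) (K : Υ) : M.obj K →ₗ[R] M.Completion :=
  Module.DirectLimit.of R (Υ)ᵒᵈ (fun K => M.obj (OrderDual.ofDual K)) _ (OrderDual.toDual K)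

theorem toCompletion_pull (M : RIC R Υ) {L K : Υ} (h : (L : Subgroup G) ≤ K) (x : M.obj K) :
    M.toCompletion L (M.pull 1 (le_conj_one h) x) = M.toCompletion K x := by
  classical
  exact Module.DirectLimit.of_f (R := R) (ι := (Υ)ᵒᵈ) (i := OrderDual.toDual K)
    (j := OrderDual.toDual L) (hij := h)

theorem toCompletion_pull_conj (M : RIC R Υ) (g : G) {L K : Υ} (h : (L : Subgroup G) ≤ K)
    (x : M.obj K) :
    M.toCompletion (Υ.conjLevel g L)
        (M.pull g (L := Υ.conjLevel g L) (K := L) le_rfl (M.pull 1 (le_conj_one h) x)) =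
      M.toCompletion (Υ.conjLevel g K) (M.pull g (L := Υ.conjLevel g K) (K := K) le_rfl x) := by
  have h' : (Υ.conjLevel g L : Subgroup G) ≤ Υ.conjLevel g K := conj_mono g h
  rw [← M.toCompletion_pull h', ← M.pull_mul, ← M.pull_mul]
  simp only [one_mul, mul_one]

open Classical in
/-- The action of `g ∈ G` on the completion, induced by `[g]^* : M(K) → M(g K g⁻¹)`. -/
def act (M : RIC R Υ) (g : G) : M.Completion →ₗ[R] M.Completion :=
  Module.DirectLimit.lift R (Υ)ᵒᵈ (fun K => M.obj (OrderDual.ofDual K)) _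
    (fun K => M.toCompletion (Υ.conjLevel g (OrderDual.ofDual K)) ∘ₗ
      M.pull g (L := Υ.conjLevel g (OrderDual.ofDual K)) (K := OrderDual.ofDual K) le_rfl)
    fun _ _ h x => M.toCompletion_pull_conj g h x

theorem act_toCompletion (M : RIC R Υ) (g : G) (K : Υ) (x : M.obj K) :
    M.act g (M.toCompletion K x) =
      M.toCompletion (Υ.conjLevel g K) (M.pull g (L := Υ.conjLevel g K) (K := K) le_rfl x) := by
  classical
  exact Module.DirectLimit.lift_of _ _ _

/-- The natural map `j_K` from `M(K)` to the completion of `S ⊗ M`. -/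
def toComplBaseChange (M : RIC R Υ) (S : Type*) [CommRing S] [Algebra R S] (K : Υ) (x : M.obj K) :
    (M.baseChange S).Completion :=
  (M.baseChange S).toCompletion K ((1 : S) ⊗ₜ[R] x)

end RIC

/-! ### Pushforwards -/

section Pushforward

variable {R : Type*} [CommRing R] {H G : Type*} [Group H] [TopologicalSpace H] [Group G]
  [TopologicalSpace G]

/-- A pushforward between RIC functors on `H` and on `G` along `ι : H → G`: maps
`ι_{U,K,*} : M_H(U) → M_G(K)` for all compatible pairs, commuting with the pushforwards `[h]_*`
of all morphisms of compatible pairs. -/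
structure Pushforward (ι : H →* G) {ΥH : LevelSystem H} {ΥG : LevelSystem G} (MH : RIC R ΥH)
    (MG : RIC R ΥG) where
  map : ∀ {U : ΥH} {K : ΥG}, (U : Subgroup H) ≤ (K : Subgroup G).comap ι →
    (MH.obj U →ₗ[R] MG.obj K)
  map_push : ∀ (h : H) {V U : ΥH} {L K : ΥG} (hVL : (V : Subgroup H) ≤ (L : Subgroup G).comap ι)
    (hUK : (U : Subgroup H) ≤ (K : Subgroup G).comap ι) (hVU : (V : Subgroup H) ≤ conj h U)
    (hLK : (L : Subgroup G) ≤ conj (ι h) K) (x : MH.obj V),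
    map hUK (MH.push h hVU x) = MG.push (ι h) hLK (map hVL x)

/-- The level `U ∩ ι⁻¹(γ L γ⁻¹)`. -/
abbrev pullLevel (ι : H →* G) {ΥH : LevelSystem H} {ΥG : LevelSystem G}
    (hΥ : ∀ K ∈ ΥG, K.comap ι ∈ ΥH) (U : ΥH) (γ : G) (L : ΥG) : ΥH :=
  ΥH.infLevel U ⟨(ΥG.conjLevel γ L : Subgroup G).comap ι, hΥ _ (ΥG.conjLevel γ L).2⟩

/-- Mackey pushforwards: for `U, L ⊆ K`, `pr^* ∘ ι_* = ∑ [γ]_* ∘ ι_* ∘ pr^*` over representatives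
`γ` of `U \ K / L`, through the pairs `(U ∩ γ L γ⁻¹, γ L γ⁻¹)`. -/
def Pushforward.IsMackey {ι : H →* G} {ΥH : LevelSystem H} {ΥG : LevelSystem G} {MH : RIC R ΥH}
    {MG : RIC R ΥG} (i : Pushforward ι MH MG) (hΥ : ∀ K ∈ ΥG, K.comap ι ∈ ΥH) : Prop :=
  ∀ (U : ΥH) (K L : ΥG) (hU : (U : Subgroup H) ≤ (K : Subgroup G).comap ι)
    (hL : (L : Subgroup G) ≤ K) (T : Finset G),
    IsDoubleCosetReps ((U : Subgroup H).map ι) K L T → ∀ x : MH.obj U,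
    MG.pull 1 (le_conj_one hL) (i.map hU x) =
      ∑ γ ∈ T, MG.push γ (L := ΥG.conjLevel γ L) (K := L) le_rfl
        (i.map (U := pullLevel ι hΥ U γ L) (K := ΥG.conjLevel γ L) inf_le_right
          (MH.pull 1 (L := pullLevel ι hΥ U γ L) (K := U) (le_conj_one inf_le_left) x))

end Pushforward

/-! ### Hecke algebras and zeta elements -/

/-- Elements of the Hecke algebra of level `K` over `R`: compactly supported `K`-bi-invariant
functions on `G`. -/
structure HeckeElement (R : Type*) [CommRing R] {G : Type*} [Group G] [TopologicalSpace G]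
    (K : Subgroup G) where
  toFun : G → R
  left_inv : ∀ k ∈ K, ∀ g, toFun (k * g) = toFun g
  right_inv : ∀ k ∈ K, ∀ g, toFun (g * k) = toFun g
  hasCompactSupport : HasCompactSupport toFun

/-- The index `[V₁ : V₂] = μ(V₁) / μ(V₂)` of two commensurable subgroups, where `μ` is any left
Haar measure: this is `[V₁ : V₁ ∩ V₂] / [V₂ : V₁ ∩ V₂]`. -/
def genIndex {H : Type*} [Group H] (V₁ V₂ : Subgroup H) : ℚ :=
  (V₂.relIndex V₁ : ℚ) / (V₁.relIndex V₂ : ℚ)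

section Zeta

variable {R : Type*} [CommRing R] {H G : Type*} [Group H] [TopologicalSpace H] [Group G]
  [TopologicalSpace G]

/-- `C(G/K, τ)`: compactly supported functions `G → τ` invariant under right translation by `K`. -/
def CcRight (K : Subgroup G) (τ : Type*) [Zero τ] : Set (G → τ) :=
  {ξ | (∀ g, ∀ k ∈ K, ξ (g * k) = ξ g) ∧ HasCompactSupport ξ}

variable (ι : H →* G) {ΥH : LevelSystem H} (M : RIC R ΥH) (Φ : Type*) [Field Φ] [Algebra R Φ]

/-- The translate `h ξ = h · ξ(h⁻¹ (-))` of a function `ξ` on `G` with values in the completion of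
`Φ ⊗ M`, which is a representation of `H`. -/
def translate (h : H) (ξ : G → (M.baseChange Φ).Completion) : G → (M.baseChange Φ).Completion :=
  fun g => (M.baseChange Φ).act h (ξ ((ι h)⁻¹ * g))

/-- `ξ₁ ≃ ξ₂`: the two functions have the same class in the space of `H`-coinvariants of
`C(G/K, τ)`, where `τ` is the completion of `Φ ⊗ M`. -/
def SameCoinvariants (K : Subgroup G) (ξ₁ ξ₂ : G → (M.baseChange Φ).Completion) : Prop :=
  ξ₁ - ξ₂ ∈ Submodule.span Φ
    {η | ∃ (h : H), ∃ ξ ∈ CcRight K (M.baseChange Φ).Completion, η = translate ι M Φ h ξ - ξ}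

/-- `ξ` is integral at level `L` (relative to the bottom level `U`): each value `ξ(g)` is a finite
sum `∑ [U : V_i] j_{V_i}(x_i)` with `V_i ⊆ g L g⁻¹` in the collection and `x_i ∈ M(V_i)`. -/
def IsIntegralAt (U : Subgroup H) (L : Subgroup G) (ξ : G → (M.baseChange Φ).Completion) : Prop :=
  ∀ g : G, ∃ (n : ℕ) (V : Fin n → ΥH) (x : ∀ i, M.obj (V i)),
    (∀ i, (V i : Subgroup H) ≤ (conj g L).comap ι) ∧
    ξ g = ∑ i, ((genIndex U (V i) : ℚ) : Φ) • M.toComplBaseChange Φ (V i) (x i)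

/-- `ζ` is a zeta element for `(x_U, 𝔥, L)` with coefficients in `Φ`: it lies in
`C(G/K, τ)`, it is integral at level `L`, and it has the same `H`-coinvariants as the function
`j_U(x_U) ⊗ 𝔥 : g ↦ 𝔥(g) j_U(x_U)`. -/
def IsZetaElement {K : Subgroup G} (U : ΥH) (x : M.obj U) (𝔥 : HeckeElement R K) (L : Subgroup G)
    (ζ : G → (M.baseChange Φ).Completion) : Prop :=
  ζ ∈ CcRight K (M.baseChange Φ).Completion ∧ IsIntegralAt ι M Φ (U : Subgroup H) L ζ ∧
    SameCoinvariants ι M Φ K ζ fun g => algebraMap R Φ (𝔥.toFun g) • M.toComplBaseChange Φ U x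

end Zeta

/-! ### Restricted tensor products of modules -/

section RestrictedTensor

variable {I : Type*} {M : I → Type*} {base : ∀ v, Set (M v)}

open Classical in
/-- Change the `v`-th component of a restricted family. -/
def updateFamily (x : Πʳ v, [M v, base v]) (v : I) (a : M v) : Πʳ v, [M v, base v] :=
  ⟨Function.update x v a, by
    have h : ({v}ᶜ : Set I) ∈ (cofinite : Filter I) := (Set.finite_singleton v).compl_mem_cofinite
    filter_upwards [x.2, h] with w hw hwv
    rw [Function.update_of_ne hwv]
    exact hw⟩

variable (R : Type*) [CommRing R] [∀ v, AddCommGroup (M v)] [∀ v, Module R (M v)]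

variable (base) in
/-- The multilinearity relations between restricted families. -/
def tensorRelations : Set ((Πʳ v, [M v, base v]) →₀ R) :=
  {z | ∃ x v a b, z = Finsupp.single (updateFamily x v (a + b)) 1 -
      Finsupp.single (updateFamily x v a) 1 - Finsupp.single (updateFamily x v b) 1} ∪
  {z | ∃ x v, ∃ r : R, ∃ a, z = Finsupp.single (updateFamily x v (r • a)) 1 -
      r • Finsupp.single (updateFamily x v a) 1}

variable (base) in
/-- The restricted tensor product `⊗'_v M_v` with respect to base points: it is generated by the
pure tensors `⊗ x_v`, for families `(x_v)` with `x_v` equal to the base point for all but finitely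
many `v` (where `base v` consists of the base point, for all but finitely many `v`), subject to
multilinearity in each component. This is the direct limit, over the finite sets `μ ⊆ I`, of the
tensor products `⊗_{v ∈ μ} M_v`, with transition maps given by tensoring with the base points. -/
abbrev RestrictedTensor : Type _ :=
  ((Πʳ v, [M v, base v]) →₀ R) ⧸ Submodule.span R (tensorRelations base R)

/-- The pure tensor `⊗ x_v`. -/
def pureTensor (x : Πʳ v, [M v, base v]) : RestrictedTensor base R :=
  Submodule.Quotient.mk (Finsupp.single x 1)

namespace RestrictedTensor

theorem hom_ext {P : Type*} [AddCommGroup P] [Module R P] {f g : RestrictedTensor base R →ₗ[R] P}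
    (h : ∀ x, f (pureTensor R x) = g (pureTensor R x)) : f = g := by
  apply Submodule.linearMap_qext
  ext x
  exact h x

/-- The linear map on the restricted tensor product given by a multilinear function of restricted
families. -/
def lift {P : Type*} [AddCommGroup P] [Module R P] (f : (Πʳ v, [M v, base v]) → P)
    (hadd : ∀ x v a b, f (updateFamily x v (a + b)) =
      f (updateFamily x v a) + f (updateFamily x v b))
    (hsmul : ∀ x v (r : R) a, f (updateFamily x v (r • a)) = r • f (updateFamily x v a)) :
    RestrictedTensor base R →ₗ[R] P :=
  Submodule.liftQ _ (Finsupp.linearCombination R f) (Submodule.span_le.2 (by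
    rintro _ (⟨x, v, a, b, rfl⟩ | ⟨x, v, r, a, rfl⟩)
    · simp [hadd]
    · simp [hsmul]))

theorem lift_pureTensor {P : Type*} [AddCommGroup P] [Module R P] (f : (Πʳ v, [M v, base v]) → P)
    (hadd hsmul) (x : Πʳ v, [M v, base v]) :
    lift R f hadd hsmul (pureTensor R x) = f x := by
  simp [lift, pureTensor]

theorem pureTensor_add (x : Πʳ v, [M v, base v]) (v : I) (a b : M v) :
    pureTensor R (updateFamily x v (a + b)) =
      pureTensor R (updateFamily x v a) + pureTensor R (updateFamily x v b) := by
  rw [← sub_eq_zero, ← sub_sub]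
  exact (Submodule.Quotient.mk_eq_zero _).2
    (Submodule.subset_span (Or.inl ⟨x, v, a, b, rfl⟩))

theorem pureTensor_smul (x : Πʳ v, [M v, base v]) (v : I) (r : R) (a : M v) :
    pureTensor R (updateFamily x v (r • a)) = r • pureTensor R (updateFamily x v a) := by
  rw [← sub_eq_zero]
  exact (Submodule.Quotient.mk_eq_zero _).2
    (Submodule.subset_span (Or.inr ⟨x, v, r, a, rfl⟩))

variable {M' : I → Type*} {base' : ∀ v, Set (M' v)}
  [∀ v, AddCommGroup (M' v)] [∀ v, Module R (M' v)]

/-- Apply linear maps componentwise to a restricted family. -/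
def mapFamily (g : ∀ v, M v →ₗ[R] M' v)
    (hg : ∀ᶠ v in cofinite, ∀ a ∈ base v, g v a ∈ base' v) (x : Πʳ v, [M v, base v]) :
    Πʳ v, [M' v, base' v] :=
  ⟨fun v => g v (x v), by filter_upwards [hg, x.2] with v h1 h2 using h1 _ h2⟩

theorem mapFamily_update (g : ∀ v, M v →ₗ[R] M' v)
    (hg : ∀ᶠ v in cofinite, ∀ a ∈ base v, g v a ∈ base' v) (x : Πʳ v, [M v, base v]) (v : I)
    (a : M v) :
    mapFamily R g hg (updateFamily x v a) = updateFamily (mapFamily R g hg x) v (g v a) := by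
  classical
  ext w
  rcases eq_or_ne w v with rfl | h
  · exact (congrArg (g w) (Function.update_self ..)).trans (Function.update_self ..).symm
  · exact (congrArg (g w) (Function.update_of_ne h ..)).trans
      (Function.update_of_ne h (g v a) fun w => g w (x w)).symm

/-- The map `⊗ g_v` of restricted tensor products; almost all `g_v` preserve base points. -/
def map (g : ∀ v, M v →ₗ[R] M' v)
    (hg : ∀ᶠ v in cofinite, ∀ a ∈ base v, g v a ∈ base' v) :
    RestrictedTensor base R →ₗ[R] RestrictedTensor base' R :=
  lift R (fun x => pureTensor R (mapFamily R g hg x))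
    (fun x v a b => by simp only [mapFamily_update, map_add, pureTensor_add])
    (fun x v r a => by simp only [mapFamily_update, map_smul, pureTensor_smul])

theorem map_pureTensor (g : ∀ v, M v →ₗ[R] M' v)
    (hg : ∀ᶠ v in cofinite, ∀ a ∈ base v, g v a ∈ base' v) (x : Πʳ v, [M v, base v]) :
    map R g hg (pureTensor R x) = pureTensor R (mapFamily R g hg x) :=
  lift_pureTensor R _ _ _ x

end RestrictedTensor

end RestrictedTensor

/-! ### Restricted tensor products of RIC functors -/

namespace RIC

theorem pull_base {R : Type*} [CommRing R] {G : Type*} [Group G] [TopologicalSpace G]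
    {Υ : LevelSystem G} (M : RIC R Υ) {L K U : Υ} (hL : (L : Subgroup G) = U)
    (hK : (K : Subgroup G) = U) {g : G} (hg : g ∈ (U : Subgroup G))
    (h : (L : Subgroup G) ≤ conj g K) (φ : M.obj U) :
    M.pull g h (M.pull 1 (le_conj_one hK.le) φ) = M.pull 1 (le_conj_one hL.le) φ := by
  obtain rfl := Subtype.ext hL
  obtain rfl := Subtype.ext hK
  rw [M.pull_one, M.pull_eq_push g (conj_of_mem hg).symm]
  exact M.push_of_mem _ (inv_mem hg) _ _

theorem push_base {R : Type*} [CommRing R] {G : Type*} [Group G] [TopologicalSpace G]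
    {Υ : LevelSystem G} (M : RIC R Υ) {L K U : Υ} (hL : (L : Subgroup G) = U)
    (hK : (K : Subgroup G) = U) {g : G} (hg : g ∈ (U : Subgroup G))
    (h : (L : Subgroup G) ≤ conj g K) (φ : M.obj U) :
    M.push g h (M.pull 1 (le_conj_one hL.le) φ) = M.pull 1 (le_conj_one hK.le) φ := by
  obtain rfl := Subtype.ext hL
  obtain rfl := Subtype.ext hK
  rw [M.pull_one]
  exact M.push_of_mem _ hg _ _

variable {R : Type*} [CommRing R] {I : Type*} {H : I → Type*} [∀ v, Group (H v)]
  [∀ v, TopologicalSpace (H v)] {Υ : ∀ v, LevelSystem (H v)} {U : ∀ v, Subgroup (H v)}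
  {hU : ∀ v, U v ∈ Υ v} (N : ∀ v, RIC R (Υ v)) (φ : ∀ v, (N v).obj ⟨U v, hU v⟩)

/-- The base points at level `W`: at the places `v` where `W_v = U_v`, the element `φ_v`, seen in
`N_v(W_v) = N_v(U_v)`. -/
def basePoints (W : LevelSystem.restrictedProduct Υ U hU) (v : I) :
    Set ((N v).obj ⟨comp (W : Subgroup (RProd H U)) v, LevelSystem.comp_mem W.2 v⟩) :=
  {a | ∃ h : comp (W : Subgroup (RProd H U)) v = U v,
    a = (N v).pull 1 (K := ⟨U v, hU v⟩) (le_conj_one h.le) (φ v)}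

theorem pull_basePoints {L K : LevelSystem.restrictedProduct Υ U hU} {g : RProd H U}
    (h : (L : Subgroup (RProd H U)) ≤ conj g K) : ∀ᶠ v in cofinite, ∀ a ∈ basePoints N φ K v,
      (N v).pull (g v) (comp_le_conj h v) a ∈ basePoints N φ L v := by
  filter_upwards [LevelSystem.comp_eventually L.2, LevelSystem.comp_eventually K.2, g.2]
    with v hL hK hg
  rintro _ ⟨_, rfl⟩
  exact ⟨hL, (N v).pull_base (U := ⟨U v, hU v⟩) hL hK hg _ _⟩

theorem push_basePoints {L K : LevelSystem.restrictedProduct Υ U hU} {g : RProd H U}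
    (h : (L : Subgroup (RProd H U)) ≤ conj g K) : ∀ᶠ v in cofinite, ∀ a ∈ basePoints N φ L v,
      (N v).push (g v) (comp_le_conj h v) a ∈ basePoints N φ K v := by
  filter_upwards [LevelSystem.comp_eventually L.2, LevelSystem.comp_eventually K.2, g.2]
    with v hL hK hg
  rintro _ ⟨_, rfl⟩
  exact ⟨hK, (N v).push_base (U := ⟨U v, hU v⟩) hL hK hg _ _⟩

/-- The restricted tensor product `N = ⊗'_v N_v` of RIC functors with respect to `(φ_v)`, whose
value at `W = ∏ W_v` is the restricted tensor product of the modules `N_v(W_v)`; its maps are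
the tensor products of the local ones. -/
def restrictedTensor : RIC R (LevelSystem.restrictedProduct Υ U hU) where
  obj W := RestrictedTensor (basePoints N φ W) R
  pull g L K h := RestrictedTensor.map R (fun v => (N v).pull (g v) (comp_le_conj h v))
    (pull_basePoints N φ h)
  push g L K h := RestrictedTensor.map R (fun v => (N v).push (g v) (comp_le_conj h v))
    (push_basePoints N φ h)
  pull_one h x := by
    refine LinearMap.congr_fun (g := LinearMap.id) (RestrictedTensor.hom_ext R fun x => ?_) x
    rw [RestrictedTensor.map_pureTensor]
    exact congrArg _ (RestrictedProduct.ext _ _ fun v => (N v).pull_one _ _)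
  push_one h x := by
    refine LinearMap.congr_fun (g := LinearMap.id) (RestrictedTensor.hom_ext R fun x => ?_) x
    rw [RestrictedTensor.map_pureTensor]
    exact congrArg _ (RestrictedProduct.ext _ _ fun v => (N v).push_one _ _)
  pull_mul g h _ _ _ h₁ h₂ x := by
    rw [← LinearMap.comp_apply]
    refine LinearMap.congr_fun (RestrictedTensor.hom_ext R fun x => ?_) x
    rw [LinearMap.comp_apply, RestrictedTensor.map_pureTensor, RestrictedTensor.map_pureTensor,
      RestrictedTensor.map_pureTensor]
    exact congrArg _ (RestrictedProduct.ext _ _ fun v => (N v).pull_mul _ _ _ _ _)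
  push_mul g h _ _ _ h₁ h₂ x := by
    rw [← LinearMap.comp_apply]
    refine LinearMap.congr_fun (RestrictedTensor.hom_ext R fun x => ?_) x
    rw [LinearMap.comp_apply, RestrictedTensor.map_pureTensor, RestrictedTensor.map_pureTensor,
      RestrictedTensor.map_pureTensor]
    exact congrArg _ (RestrictedProduct.ext _ _ fun v => (N v).push_mul _ _ _ _ _)
  pull_eq_push g L K h x := by
    refine LinearMap.congr_fun (RestrictedTensor.hom_ext R fun x => ?_) x
    rw [RestrictedTensor.map_pureTensor, RestrictedTensor.map_pureTensor]
    refine congrArg _ (RestrictedProduct.ext _ _ fun v => ?_)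
    refine (N v).pull_eq_push (g v) (le_antisymm (comp_le_conj h.le v) ?_) _
    intro y hy
    have := comp_le_conj (conj_inv_le h) v hy
    simpa [mem_conj, mul_assoc] using this
  push_of_mem γ hγ h x := by
    refine LinearMap.congr_fun (g := LinearMap.id) (RestrictedTensor.hom_ext R fun x => ?_) x
    rw [RestrictedTensor.map_pureTensor]
    exact congrArg _ (RestrictedProduct.ext _ _ fun v => (N v).push_of_mem (γ v)
      (Subgroup.mem_map_of_mem (RestrictedProduct.evalMonoidHom H v) hγ) _ _)

/-- The element `⊗_v φ_v` of `N(U)`. -/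
def baseTensor : (restrictedTensor N φ).obj ⟨prodSubgroup U U,
    U, hU, Eventually.of_forall fun _ => rfl, rfl⟩ :=
  pureTensor R ⟨fun v => (N v).pull 1 (K := ⟨U v, hU v⟩)
      (le_conj_one (comp_prodSubgroup U U v).le) (φ v),
    Eventually.of_forall fun v => ⟨comp_prodSubgroup U U v, rfl⟩⟩

end RIC

/-! ### The gluing setup -/

/-- Closed embeddings `ι_v : H_v → G_v`, compact open subgroups `K_v` of `G_v` and, for `v` in a
cofinite subset `I'` of the index set, compact open normal subgroups `L_v` of `K_v`.
The subgroups `L v` for `v ∉ I'` are irrelevant. -/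
structure GluingData {I : Type*} (G H : I → Type*) [∀ v, Group (G v)] [∀ v, TopologicalSpace (G v)]
    [∀ v, Group (H v)] [∀ v, TopologicalSpace (H v)] where
  ι : ∀ v, H v →* G v
  isClosedEmbedding : ∀ v, IsClosedEmbedding (ι v)
  K : ∀ v, Subgroup (G v)
  K_isOpen : ∀ v, IsOpen (K v : Set (G v))
  K_isCompact : ∀ v, IsCompact (K v : Set (G v))
  I' : Set I
  finite_compl : I'ᶜ.Finite
  L : ∀ v, Subgroup (G v)
  L_isOpen : ∀ v ∈ I', IsOpen (L v : Set (G v))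
  L_isCompact : ∀ v ∈ I', IsCompact (L v : Set (G v))
  L_le : ∀ v ∈ I', L v ≤ K v
  L_normal : ∀ v ∈ I', ∀ k ∈ K v, ∀ x ∈ L v, k * x * k⁻¹ ∈ L v

namespace GluingData

section Defs

variable {I : Type*} {G H : I → Type*} [∀ v, Group (G v)] [∀ v, TopologicalSpace (G v)]
  [∀ v, Group (H v)] [∀ v, TopologicalSpace (H v)] (D : GluingData G H)

/-- `U_v = H_v ∩ K_v`. -/
abbrev U (v : I) : Subgroup (H v) := (D.K v).comap (D.ι v)

/-- The restricted product `G` of the `G_v` with respect to the `K_v`. -/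
abbrev GG : Type _ := RProd G D.K

/-- The restricted product `H` of the `H_v` with respect to the `U_v`. -/
abbrev HH : Type _ := RProd H D.U

/-- The embedding `H → G` with components `ι_v`. -/
def ιGlob : D.HH →* D.GG where
  toFun h := ⟨fun v => D.ι v (h v), h.2⟩
  map_one' := RestrictedProduct.ext _ _ fun v => map_one (D.ι v)
  map_mul' _ _ := RestrictedProduct.ext _ _ fun v => map_mul (D.ι v) _ _

theorem ιGlob_apply (h : D.HH) (v : I) : D.ιGlob h v = D.ι v (h v) := rfl

/-- The subgroups `K_v` of `G_v`, for all `v`, and `L_v`, for `v ∈ I'`. -/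
def localLevels (v : I) : Set (Subgroup (G v)) := {A | A = D.K v ∨ (v ∈ D.I' ∧ A = D.L v)}

open Classical in
/-- The components of `K[ν]`: equal to `L_v` for `v ∈ ν` and to `K_v` for `v ∉ ν`. -/
def level (ν : Finset I) (v : I) : Subgroup (G v) := if v ∈ ν then D.L v else D.K v

/-- The subgroup `K[ν]` of the restricted product `G`. -/
def Kν (ν : Finset I) : Subgroup D.GG := prodSubgroup D.K (D.level ν)

open Classical in
/-- The tensor product `ch(K'') ⊗ ⨂_{v ∈ lam} 𝔥_v` on `G`, where `K''` is the away-from-`lam` part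
of `K[ν]`. -/
def tensorHecke {R : Type*} [CommRing R] (𝔥 : ∀ v, HeckeElement R (D.K v)) (ν lam : Finset I)
    (g : D.GG) : R :=
  if ∀ v ∉ lam, g v ∈ D.level ν v then ∏ v ∈ lam, (𝔥 v).toFun (g v) else 0

variable [∀ v, IsTopologicalGroup (G v)]

/-- The collection of finite intersections of conjugates of `K_v` and `L_v`. -/
def levelsG (v : I) : LevelSystem (G v) :=
  LevelSystem.generate (D.localLevels v) ⟨_, Or.inl rfl⟩
    (by rintro _ (rfl | ⟨h, rfl⟩); exacts [D.K_isOpen v, D.L_isOpen v h])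
    (by rintro _ (rfl | ⟨h, rfl⟩); exacts [D.K_isCompact v, D.L_isCompact v h])

/-- The collection `ι_v⁻¹` of the previous collection. -/
def levelsH (v : I) : LevelSystem (H v) :=
  LevelSystem.comap (D.ι v) (D.isClosedEmbedding v) (D.levelsG v)

theorem mem_levelsG {v : I} {A : Subgroup (G v)} :
    A ∈ D.levelsG v ↔ LevelSystem.Gen (D.localLevels v) A := Iff.rfl

theorem K_mem (v : I) : D.K v ∈ D.levelsG v := by
  have := LevelSystem.Gen.conj (F := D.localLevels v) 1 (A := D.K v) (Or.inl rfl)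
  rwa [conj_one] at this

theorem U_mem (v : I) : D.U v ∈ D.levelsH v := ⟨_, D.K_mem v, rfl⟩

/-- The collection of the subgroups `∏ W_v` of `H`, with `W_v ∈ ι_v⁻¹(Υ_{G_v})` for all `v` and
`W_v = U_v` for all but finitely many `v`. -/
def levelsHI : LevelSystem D.HH :=
  LevelSystem.restrictedProduct D.levelsH D.U D.U_mem

end Defs

section Lemmas

variable {I : Type*} {G H : I → Type*} [∀ v, Group (G v)] [∀ v, TopologicalSpace (G v)]
  [∀ v, Group (H v)] [∀ v, TopologicalSpace (H v)] (D : GluingData G H)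

theorem Kν_mono {ν μ : Finset I} (h : ν ⊆ μ) (hμ : (μ : Set I) ⊆ D.I') : D.Kν μ ≤ D.Kν ν := by
  intro g hg v
  have := hg v
  unfold level at this ⊢
  split_ifs with h1
  · rwa [if_pos (h h1)] at this
  · split_ifs at this with h2
    · exact D.L_le v (hμ h2) this
    · exact this

theorem Kν_empty : D.Kν ∅ = prodSubgroup D.K D.K := by
  ext g
  simp [Kν, level, mem_prodSubgroup]

theorem U_le : prodSubgroup D.U D.U ≤ (D.Kν ∅).comap D.ιGlob := by
  intro h hh
  rw [Subgroup.mem_comap, Kν_empty]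
  exact fun v => hh v

theorem Kν_mem (ΥG : LevelSystem D.GG) (hK : prodSubgroup D.K D.K ∈ ΥG)
    (hL : ∀ v ∈ D.I', D.Kν {v} ∈ ΥG)
    (ν : Finset I) (hν : (ν : Set I) ⊆ D.I') : D.Kν ν ∈ ΥG := by
  classical
  induction ν using Finset.induction_on with
  | empty => rwa [Kν_empty]
  | insert a s ha ih =>
    have h2 : D.Kν (insert a s) = D.Kν {a} ⊓ D.Kν s := by
      ext g
      simp only [Subgroup.mem_inf, Kν, mem_prodSubgroup, ← forall_and]
      refine forall_congr' fun v => ?_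
      simp only [level, Finset.mem_insert, Finset.mem_singleton]
      by_cases hv : v = a
      · subst hv
        simp only [true_or, if_true, if_neg ha]
        exact ⟨fun h => ⟨h, D.L_le v (hν (by simp)) h⟩, fun h => h.1⟩
      · simp only [hv, false_or, if_false]
        refine ⟨fun h => ⟨?_, h⟩, fun h => h.2⟩
        split_ifs at h with h3
        · exact D.L_le v (hν (by simp [h3])) h
        · exact h
    rw [h2]
    exact ΥG.inf_mem _ (hL a (hν (by simp))) _ (ih fun v hv => hν (by simp [Finset.mem_coe.1 hv]))

/-- Products of conjugates of `K_v` and `L_v`, almost all equal to `K_v`, belong to `Υ_G`. -/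
theorem conj_mem_aux (ΥG : LevelSystem D.GG) (hK : prodSubgroup D.K D.K ∈ ΥG)
    (hL : ∀ v ∈ D.I', D.Kν {v} ∈ ΥG)
    (W : ∀ v, Subgroup (G v)) (hW : ∀ᶠ v in cofinite, W v = D.K v)
    (hg : ∀ v, ∃ g, ∃ A ∈ D.localLevels v, W v = conj g A) : prodSubgroup D.K W ∈ ΥG := by
  classical
  choose g A hA hgA using hg
  have hfin : {v | ¬ W v = D.K v}.Finite := hW
  let S : Finset I := hfin.toFinset
  let γ : D.GG := ⟨fun v => if W v = D.K v then 1 else g v, by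
    filter_upwards [hW] with v hv
    rw [if_pos hv]
    exact (D.K v).one_mem⟩
  let T : Finset I := S.filter fun v => v ∈ D.I' ∧ A v = D.L v
  have hT : (T : Set I) ⊆ D.I' := fun v hv => (Finset.mem_filter.1 hv).2.1
  have : prodSubgroup D.K W = conj γ (D.Kν T) := by
    ext x
    refine forall_congr' fun v => ?_
    change x v ∈ W v ↔ x v ∈ conj (if W v = D.K v then 1 else g v) (D.level T v)
    by_cases h : W v = D.K v
    · rw [if_pos h, conj_one, level, if_neg, h]
      simp [T, S, h]
    · rw [if_neg h, hgA v, level]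
      by_cases h2 : v ∈ D.I' ∧ A v = D.L v
      · rw [if_pos, h2.2]
        simp only [T, S, Finset.mem_filter, Set.Finite.mem_toFinset]
        exact ⟨h, h2⟩
      · rw [if_neg]
        · rcases hA v with h3 | h3
          · rw [h3]
          · exact absurd h3 h2
        · simp only [T, Finset.mem_filter]
          exact fun h => h2 h.2
  rw [this]
  exact ΥG.conj_mem _ _ (D.Kν_mem ΥG hK hL T hT)

/-- Products of members of the local collections, almost all equal to `K_v`, belong to `Υ_G`. -/
theorem prod_mem [∀ v, IsTopologicalGroup (G v)] (ΥG : LevelSystem D.GG) (hK : prodSubgroup D.K D.K ∈ ΥG)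
    (hL : ∀ v ∈ D.I', D.Kν {v} ∈ ΥG)
    (W : ∀ v, Subgroup (G v)) (hW : ∀ᶠ v in cofinite, W v = D.K v)
    (hWm : ∀ v, W v ∈ D.levelsG v) : prodSubgroup D.K W ∈ ΥG := by
  classical
  have key : ∀ T : Finset I, ∀ W : ∀ v, Subgroup (G v), (∀ᶠ v in cofinite, W v = D.K v) →
      (∀ v, W v ∈ D.levelsG v) →
      (∀ v ∉ T, ∃ g, ∃ A ∈ D.localLevels v, W v = conj g A) → prodSubgroup D.K W ∈ ΥG := by
    intro T
    induction T using Finset.induction_on with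
    | empty =>
      intro W hW _ h
      exact D.conj_mem_aux ΥG hK hL W hW fun v => h v (by simp)
    | insert a s ha ih =>
      intro W hW hWm h
      have hup : ∀ X : Subgroup (G a), ∀ᶠ v in cofinite, Function.update W a X v = D.K v := by
        intro X
        have h2 : ({a}ᶜ : Set I) ∈ (cofinite : Filter I) := (Set.finite_singleton a).compl_mem_cofinite
        filter_upwards [hW, h2] with v h1 h2
        rwa [Function.update_of_ne h2]
      have main : ∀ X : Subgroup (G a), LevelSystem.Gen (D.localLevels a) X →
          prodSubgroup D.K (Function.update W a X) ∈ ΥG := by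
        intro X hX
        induction hX with
        | @conj g A hA =>
          refine ih _ (hup _) (fun v => ?_) fun v hv => ?_
          · rcases eq_or_ne v a with rfl | hva
            · rw [Function.update_self]
              exact LevelSystem.Gen.conj g hA
            · rw [Function.update_of_ne hva]
              exact hWm v
          · rcases eq_or_ne v a with rfl | hva
            · rw [Function.update_self]
              exact ⟨g, A, hA, rfl⟩
            · rw [Function.update_of_ne hva]
              exact h v (by simp [hva, hv])
        | @inf A B _ _ iA iB =>
          have : prodSubgroup D.K (Function.update W a (A ⊓ B)) =
              prodSubgroup D.K (Function.update W a A) ⊓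
                prodSubgroup D.K (Function.update W a B) := by
            ext x
            simp only [Subgroup.mem_inf, mem_prodSubgroup, ← forall_and]
            refine forall_congr' fun v => ?_
            rcases eq_or_ne v a with rfl | hva
            · simp only [Function.update_self, Subgroup.mem_inf]
            · simp only [Function.update_of_ne hva, and_self]
          rw [this]
          exact ΥG.inf_mem _ iA _ iB
      have := main (W a) (hWm a)
      rwa [Function.update_eq_self] at this
  have hfin : {v | ¬ W v = D.K v}.Finite := hW
  refine key hfin.toFinset W hW hWm fun v hv => ⟨1, D.K v, Or.inl rfl, ?_⟩
  rw [conj_one]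
  by_contra h
  exact hv (by simpa using h)

theorem levelsHI_subset [∀ v, IsTopologicalGroup (G v)] (ΥG : LevelSystem D.GG) (hK : prodSubgroup D.K D.K ∈ ΥG)
    (hL : ∀ v ∈ D.I', D.Kν {v} ∈ ΥG)
    (ΥH : LevelSystem D.HH) (hΥ : ∀ A ∈ ΥG, A.comap D.ιGlob ∈ ΥH) :
    ∀ A ∈ D.levelsHI, A ∈ ΥH := by
  classical
  rintro _ ⟨W, hW, hWU, rfl⟩
  choose X hX hWX using hW
  let Y : ∀ v, Subgroup (G v) := fun v => if W v = D.U v then D.K v else X v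
  have hY : ∀ v, W v = (Y v).comap (D.ι v) := by
    intro v
    simp only [Y]
    split_ifs with h
    · exact h
    · exact hWX v
  have h1 : prodSubgroup D.K Y ∈ ΥG := by
    refine D.prod_mem ΥG hK hL Y ?_ fun v => ?_
    · filter_upwards [hWU] with v hv
      simp only [Y, if_pos hv]
    · simp only [Y]
      split_ifs
      exacts [D.K_mem v, hX v]
  have h2 : prodSubgroup D.U W = (prodSubgroup D.K Y).comap D.ιGlob := by
    ext x
    refine forall_congr' fun v => ?_
    rw [hY v]
    rfl
  rw [h2]
  exact hΥ _ h1

theorem prodU_mem (ΥG : LevelSystem D.GG) (hK : prodSubgroup D.K D.K ∈ ΥG)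
    (ΥH : LevelSystem D.HH) (hΥ : ∀ A ∈ ΥG, A.comap D.ιGlob ∈ ΥH) :
    prodSubgroup D.U D.U ∈ ΥH := by
  have : prodSubgroup D.U D.U = (prodSubgroup D.K D.K).comap D.ιGlob := rfl
  rw [this]
  exact hΥ _ hK

end Lemmas

end GluingData

end

end ZetaGluing

open ZetaGluing

/-!
The local hypothesis is an identity of coinvariants over the fraction field `Φ`, while the classes
`y_ν` have to be found over `𝒪`. The proof replaces functions on `G_v` by *cells* `(V, g, x)` of
level `L` (`Cell`), with `V` a level contained in the stabiliser of `g L` and `x ∈ N(V)`. A cell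
stands for the function `ch(g L) ⊗ [U : V] j_V(x)`, and the functionals (`IsInvariant`) to be
applied to cells are those which are linear in `x` and compatible with pushforwards in `V` and with
translations. Such a functional factors through the components `Cell.retract` of cells in the
modules `N(Stab(α K))`, one for each orbit `H α K` (`IsInvariant.sum_eq_sum`). The same components
can be read off, after tensoring with `Φ`, from a function on `G` with values in the completion of
`Φ ⊗ N`, by summing the normalised traces of its values over the cosets in an orbit (`orbitSum`).
This is invariant under `H`, hence factors through coinvariants; unimodularity of `H` turns the
volume factors `[U : V]` of the integrality condition into a single factor for each orbit. As the
`N_v` are torsion free, the equality over `Φ` descends to `𝒪`: no invariant functional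
distinguishes the finite family of cells of level `L_v` underlying a zeta element from the family
of cells, of level `K_v`, underlying `𝔥_v ⊗ φ_v` (`IsZetaElement.exists_cells`).

Globally, a family of cells, almost all equal to the base cell `(U_v, 1, φ_v)`, has a class in
`M_G(K[ν])` (`famClass`): apply `Ψ` to the pure tensor of its classes, then the twisted pushforward
`[g]_* ∘ ι_*`. It is an invariant functional of each member (`isInvariant_famClass`). Let `y_ν` be
the sum of the classes of the families which have, at each `v ∈ ν`, one of the cells of the zeta
element, and the base cell elsewhere (`gluedClass`). The Mackey formula for `ι_*` shows that the
Hecke operator at the places of `μ \ ν` replaces the base cells there by the cells of `𝔥_v ⊗ φ_v`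
(`IsAdmissible.heckeCov_famClass`); by the local result these can be exchanged, one place after the
other, for the cells of the zeta elements, which gives the image of `y_μ` at level `K[ν]`.
-/

namespace ZetaGluing

noncomputable section

/-! ### Indices and Haar measure -/

section Index

open MeasureTheory Measure

theorem isOpen_conj {G : Type*} [Group G] [TopologicalSpace G] [IsTopologicalGroup G] (g : G)
    {K : Subgroup G} (hK : IsOpen (K : Set G)) : IsOpen (conj g K : Set G) :=
  hK.preimage (f := fun x => g⁻¹ * x * g) ((continuous_const_mul g⁻¹).mul continuous_const)

theorem relIndex_ne_zero {G : Type*} [Group G] [TopologicalSpace G] [IsTopologicalGroup G]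
    {V W : Subgroup G} (hV : IsOpen (V : Set G)) (hW : IsCompact (W : Set G)) :
    V.relIndex W ≠ 0 := by
  have : CompactSpace W := isCompact_iff_compactSpace.1 hW
  have h : IsOpen (V.subgroupOf W : Set W) := hV.preimage continuous_subtype_val
  have := Subgroup.quotient_finite_of_isOpen _ h
  exact Subgroup.index_ne_zero_of_finite

theorem measure_eq_relIndex_mul {G : Type*} [Group G] [TopologicalSpace G] [IsTopologicalGroup G]
    [MeasurableSpace G] [BorelSpace G] (μ : Measure G) [μ.IsMulLeftInvariant]
    {V W : Subgroup G} (hVo : IsOpen (V : Set G)) (hWo : IsOpen (W : Set G))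
    (hW : IsCompact (W : Set G)) (h : V ≤ W) :
    μ (W : Set G) = V.relIndex W * μ (V : Set G) := by
  have hWm : MeasurableSet (W : Set G) := hWo.measurableSet
  let ν : Measure W := μ.comap ((↑) : W → G)
  have he : MeasurableEmbedding ((↑) : W → G) := MeasurableEmbedding.subtype_coe hWm
  have : ν.IsMulLeftInvariant := by
    refine ⟨fun g => ?_⟩
    ext s hs
    rw [Measure.map_apply (measurable_const_mul g) hs, he.comap_apply, he.comap_apply,
      ← measure_preimage_mul μ (g : G) (((↑) : W → G) '' s)]
    congr 1
    ext y
    constructor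
    · rintro ⟨w, hw, rfl⟩
      exact ⟨g * w, hw, rfl⟩
    · rintro ⟨w, hw, hwy⟩
      have hy : y = (g⁻¹ * w : W) := by
        rw [Subgroup.coe_mul, hwy, Subgroup.coe_inv, inv_mul_cancel_left]
      exact ⟨g⁻¹ * w, by simpa using hw, hy.symm⟩
  have hfi : (V.subgroupOf W).FiniteIndex := ⟨relIndex_ne_zero hVo hW⟩
  have hm : MeasurableSet (V.subgroupOf W : Set W) :=
    (hVo.preimage continuous_subtype_val).measurableSet
  have key := Subgroup.index_mul_measure (V.subgroupOf W) hm ν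
  rw [he.comap_apply, he.comap_apply, Set.image_univ, Subtype.range_coe] at key
  have hV : ((↑) : W → G) '' (V.subgroupOf W : Set W) = V := by
    ext y
    exact ⟨by rintro ⟨w, hw, rfl⟩; exact hw, fun hy => ⟨⟨y, h hy⟩, hy, rfl⟩⟩
  rw [hV] at key
  exact key.symm

/-- In a unimodular group, conjugation preserves the volume of compact open subgroups. -/
theorem measure_conj {G : Type*} [Group G] [TopologicalSpace G] [LocallyProfinite G]
    [MeasurableSpace G] [BorelSpace G] (hG : IsUnimodular G) (μ : Measure G) [μ.IsHaarMeasure]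
    {V : Subgroup G} (hVo : IsOpen (V : Set G)) (hV : IsCompact (V : Set G)) (g : G) :
    μ (conj g V : Set G) = μ (V : Set G) := by
  have h1 : (conj g V : Set G) = (fun x => g⁻¹ * x) ⁻¹' ((fun x => x * g) ⁻¹' (V : Set G)) := rfl
  rw [h1, measure_preimage_mul, ← Measure.map_apply (measurable_mul_const g) hVo.measurableSet,
    measure_isMulInvariant_eq_smul_of_isCompact_closure _ μ
      (by rwa [(Subgroup.isClosed_of_isOpen V hVo).closure_eq]),
    ← modularCharacterFun_eq_haarScalarFactor, hG g, one_smul]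

/-- In a unimodular group the index `[U : V]` is a ratio of volumes; hence `[U : V] / [W : h⁻¹ V h]`
does not depend on `V`. -/
theorem genIndex_mul_inv_relIndex {G : Type*} [Group G] [TopologicalSpace G] [LocallyProfinite G]
    (hG : IsUnimodular G) {U V W : Subgroup G} (hUo : IsOpen (U : Set G))
    (hU : IsCompact (U : Set G)) (hVo : IsOpen (V : Set G)) (hV : IsCompact (V : Set G))
    (hWo : IsOpen (W : Set G)) (hW : IsCompact (W : Set G)) {h : G} (hVW : V ≤ conj h W) :
    genIndex U V * ((conj h⁻¹ V).relIndex W : ℚ)⁻¹ = genIndex U W := by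
  let _ : MeasurableSpace G := borel G
  have _ : BorelSpace G := ⟨rfl⟩
  let μ : Measure G := haar
  let m : Subgroup G → ℝ := fun A => (μ (A : Set G)).toReal
  have hpos : ∀ {A : Subgroup G}, IsOpen (A : Set G) → IsCompact (A : Set G) → m A ≠ 0 :=
    fun {A} ho hc => ENNReal.toReal_ne_zero.2
      ⟨(ho.measure_pos μ ⟨1, A.one_mem⟩).ne', hc.measure_lt_top.ne⟩
  have hrel : ∀ {A B : Subgroup G}, IsOpen (A : Set G) → IsOpen (B : Set G) →
      IsCompact (B : Set G) → A ≤ B → (A.relIndex B : ℝ) * m A = m B := by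
    intro A B hA hB hBc hAB
    simp only [m, measure_eq_relIndex_mul μ hA hB hBc hAB, ENNReal.toReal_mul,
      ENNReal.toReal_natCast]
  have hgen : ∀ {A B : Subgroup G}, IsOpen (A : Set G) → IsCompact (A : Set G) →
      IsOpen (B : Set G) → IsCompact (B : Set G) → ((genIndex A B : ℚ) : ℝ) = m A / m B := by
    intro A B hA hAc hB hBc
    have hIo : IsOpen ((A ⊓ B : Subgroup G) : Set G) := hA.inter hB
    have hIc : IsCompact ((A ⊓ B : Subgroup G) : Set G) :=
      hAc.inter_right (Subgroup.isClosed_of_isOpen B hB)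
    have h1 := hrel hIo hA hAc inf_le_left
    have h2 := hrel hIo hB hBc inf_le_right
    rw [Subgroup.inf_relIndex_left] at h1
    rw [Subgroup.inf_relIndex_right] at h2
    rw [genIndex, ← h1, ← h2, mul_div_mul_right _ _ (hpos hIo hIc)]
    push_cast
    rfl
  have hle : conj h⁻¹ V ≤ W := by
    have := conj_mono h⁻¹ hVW
    rwa [← conj_mul, inv_mul_cancel, conj_one] at this
  have h3 := hrel (isOpen_conj h⁻¹ hVo) hWo hW hle
  have h4 : m (conj h⁻¹ V) = m V := by simp only [m, measure_conj hG μ hVo hV]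
  rw [h4] at h3
  have hne : ((conj h⁻¹ V).relIndex W : ℝ) ≠ 0 :=
    Nat.cast_ne_zero.2 (relIndex_ne_zero (isOpen_conj h⁻¹ hVo) hW)
  have : (((genIndex U V * ((conj h⁻¹ V).relIndex W : ℚ)⁻¹ : ℚ)) : ℝ) = (genIndex U W : ℚ) := by
    push_cast
    rw [hgen hUo hU hVo hV, hgen hUo hU hWo hW, ← h3]
    have := hpos hVo hV
    field_simp
  exact_mod_cast this

theorem genIndex_ne_zero {G : Type*} [Group G] [TopologicalSpace G] [IsTopologicalGroup G]
    {U V : Subgroup G} (hUo : IsOpen (U : Set G)) (hU : IsCompact (U : Set G))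
    (hVo : IsOpen (V : Set G)) (hV : IsCompact (V : Set G)) : genIndex U V ≠ 0 :=
  div_ne_zero (Nat.cast_ne_zero.2 (relIndex_ne_zero hVo hU))
    (Nat.cast_ne_zero.2 (relIndex_ne_zero hUo hV))

theorem genIndex_of_le {G : Type*} [Group G] {U V : Subgroup G} (h : V ≤ U) :
    genIndex U V = V.relIndex U := by
  rw [genIndex, Subgroup.relIndex_eq_one.2 h, Nat.cast_one, div_one]

end Index

/-! ### Normalised traces on inductive completions -/

theorem conj_inv_conj {G : Type*} [Group G] (g : G) (K : Subgroup G) : conj g⁻¹ (conj g K) = K := by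
  rw [← conj_mul, inv_mul_cancel, conj_one]

theorem conj_inv_le_of_le {G : Type*} [Group G] {g : G} {V W : Subgroup G} (h : V ≤ conj g W) :
    conj g⁻¹ V ≤ W := by
  have := conj_mono g⁻¹ h
  rwa [conj_inv_conj] at this

theorem conj_eq_map {G : Type*} [Group G] (g : G) (K : Subgroup G) :
    conj g K = K.map (MulAut.conj g).toMonoidHom := by
  ext x
  constructor
  · intro hx
    exact ⟨g⁻¹ * x * g, hx, by simp [mul_assoc]⟩
  · rintro ⟨y, hy, rfl⟩
    simpa [mem_conj, mul_assoc] using hy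

theorem relIndex_conj_conj {G : Type*} [Group G] (g : G) (V W : Subgroup G) :
    (conj g V).relIndex (conj g W) = V.relIndex W := by
  rw [conj_eq_map, conj_eq_map]
  exact Subgroup.relIndex_map_map_of_injective V W (MulAut.conj g).injective

namespace RIC

section General

variable {R : Type*} [CommRing R] {G : Type*} [Group G] [TopologicalSpace G] {Υ : LevelSystem G}
  (M : RIC R Υ)

theorem push_congr {g g' : G} (hg : g = g') {L K : Υ} (h : (L : Subgroup G) ≤ conj g K)
    (h' : (L : Subgroup G) ≤ conj g' K) (x : M.obj L) : M.push g h x = M.push g' h' x := by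
  subst hg; rfl

/-- `push_mul` with a name for the composite, so that it can be used for rewriting without matching
products in types. -/
theorem push_push {g h : G} {L' L K : Υ} (h₁ : (L' : Subgroup G) ≤ conj h L)
    (h₂ : (L : Subgroup G) ≤ conj g K) {k : G} (hk : k = h * g)
    (h₃ : (L' : Subgroup G) ≤ conj k K) (x : M.obj L') :
    M.push g h₂ (M.push h h₁ x) = M.push k h₃ x := by
  subst hk; exact (M.push_mul g h h₁ h₂ x).symm

theorem pull_pull {g h : G} {L' L K : Υ} (h₁ : (L' : Subgroup G) ≤ conj h L)
    (h₂ : (L : Subgroup G) ≤ conj g K) {k : G} (hk : k = h * g)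
    (h₃ : (L' : Subgroup G) ≤ conj k K) (x : M.obj K) :
    M.pull h h₁ (M.pull g h₂ x) = M.pull k h₃ x := by
  subst hk; exact (M.pull_mul g h h₁ h₂ x).symm

theorem act_mul (g h : G) (ξ : M.Completion) : M.act (g * h) ξ = M.act g (M.act h ξ) := by
  classical
  have : M.act (g * h) = M.act g ∘ₗ M.act h := by
    refine Module.DirectLimit.hom_ext fun K => LinearMap.ext fun x => ?_
    change M.act (g * h) (M.toCompletion (OrderDual.ofDual K) x) =
      M.act g (M.act h (M.toCompletion (OrderDual.ofDual K) x))
    rw [act_toCompletion, act_toCompletion, act_toCompletion,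
      M.pull_pull (L' := Υ.conjLevel g (Υ.conjLevel h (OrderDual.ofDual K))) (h := g) (g := h)
        le_rfl le_rfl rfl (conj_mul g h _).ge]
    have e : ((Υ.conjLevel (g * h) (OrderDual.ofDual K) : Υ) : Subgroup G) ≤
      Υ.conjLevel g (Υ.conjLevel h (OrderDual.ofDual K)) := (conj_mul g h _).le
    rw [← M.toCompletion_pull e, M.pull_pull _ _ (one_mul _).symm le_rfl]
  rw [this]; rfl

/-- Every element of the completion comes from arbitrarily small levels. -/
theorem completion_induction {P : M.Completion → Prop} (W : Υ)
    (h : ∀ (V : Υ) (_ : (V : Subgroup G) ≤ W) (x : M.obj V), P (M.toCompletion V x))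
    (ξ : M.Completion) : P ξ := by
  classical
  have : Nonempty (Υ)ᵒᵈ := ⟨OrderDual.toDual W⟩
  have : IsDirectedOrder (Υ)ᵒᵈ := ⟨fun A B =>
    ⟨OrderDual.toDual (Υ.infLevel (OrderDual.ofDual A) (OrderDual.ofDual B)),
      (inf_le_left : (OrderDual.ofDual A : Υ).1 ⊓ (OrderDual.ofDual B : Υ).1 ≤ _),
      (inf_le_right : (OrderDual.ofDual A : Υ).1 ⊓ (OrderDual.ofDual B : Υ).1 ≤ _)⟩⟩
  refine Module.DirectLimit.induction_on ξ fun K x => ?_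
  change P (M.toCompletion (OrderDual.ofDual K) x)
  rw [← M.toCompletion_pull (L := Υ.infLevel (OrderDual.ofDual K) W) inf_le_left]
  exact h _ inf_le_right _

theorem IsCohomological.baseChange {M : RIC R Υ} (hM : M.IsCohomological) (S : Type*) [CommRing S]
    [Algebra R S] : (M.baseChange S).IsCohomological := by
  intro L K h x
  change ((M.push 1 _).baseChange S) ((M.pull 1 _).baseChange S x) = _
  have : (M.push 1 (le_conj_one h)).baseChange S ∘ₗ (M.pull 1 (le_conj_one h)).baseChange S =
      ((L : Subgroup G).relIndex K) • LinearMap.id := by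
    rw [← LinearMap.baseChange_comp,
      show M.push 1 (le_conj_one h) ∘ₗ M.pull 1 (le_conj_one h) =
        ((L : Subgroup G).relIndex K) • LinearMap.id from LinearMap.ext fun x => hM L K h x]
    ext y
    simp [TensorProduct.tmul_smul]
  exact LinearMap.congr_fun this x

end General

section Trace

variable {Φ : Type*} [Field Φ] {G : Type*} [Group G] [TopologicalSpace G]
  {Υ : LevelSystem G} (M : RIC Φ Υ)

theorem relIndex_level_ne_zero [IsTopologicalGroup G] (V W : Υ) : (V : Subgroup G).relIndex W ≠ 0 :=
  relIndex_ne_zero (Υ.isOpen _ V.2) (Υ.isCompact _ W.2)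

/-- The normalised trace `M(V) → M(W)`: restrict to `V ∩ W`, push forward to `W` and divide by
`[W : V ∩ W]`. -/
def traceAt (W V : Υ) : M.obj V →ₗ[Φ] M.obj W :=
  (((V ⊓ W : Subgroup G).relIndex W : Φ)⁻¹) •
    (M.push 1 (L := Υ.infLevel V W) (K := W) (le_conj_one inf_le_right) ∘ₗ
      M.pull 1 (L := Υ.infLevel V W) (K := V) (le_conj_one inf_le_left))

theorem traceAt_apply (W V : Υ) (x : M.obj V) : M.traceAt W V x =
    (((V ⊓ W : Subgroup G).relIndex W : Φ)⁻¹) •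
      M.push 1 (L := Υ.infLevel V W) (K := W) (le_conj_one inf_le_right)
        (M.pull 1 (L := Υ.infLevel V W) (K := V) (le_conj_one inf_le_left) x) := rfl

variable {M} in
theorem traceAt_of_le {W V : Υ} (h : (V : Subgroup G) ≤ W) (x : M.obj V) :
    M.traceAt W V x = (((V : Subgroup G).relIndex W : Φ)⁻¹) • M.push 1 (le_conj_one h) x := by
  have e : Υ.infLevel V W = V := Subtype.ext (inf_eq_left.2 h)
  have : ∀ (A : Υ) (hA : A = V) (hV : (A : Subgroup G) ≤ V) (hW : (A : Subgroup G) ≤ W),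
      (((A : Subgroup G).relIndex W : Φ)⁻¹) • M.push 1 (le_conj_one hW)
        (M.pull 1 (le_conj_one hV) x) =
      (((V : Subgroup G).relIndex W : Φ)⁻¹) • M.push 1 (le_conj_one h) x := by
    rintro A rfl hV hW
    rw [M.pull_one]
  exact this _ e inf_le_left inf_le_right

variable [CharZero Φ] [IsTopologicalGroup G]

variable {M} in
/-- Normalised traces are compatible with restriction; this is the cohomological axiom. -/
theorem IsCohomological.traceAt_pull (hM : M.IsCohomological) (W : Υ) {V V' : Υ}
    (h : (V' : Subgroup G) ≤ V) (x : M.obj V) :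
    M.traceAt W V' (M.pull 1 (le_conj_one h) x) = M.traceAt W V x := by
  have hle : (Υ.infLevel V' W : Subgroup G) ≤ Υ.infLevel V W := inf_le_inf_right _ h
  have h1 : M.pull 1 (L := Υ.infLevel V' W) (K := V') (le_conj_one inf_le_left)
      (M.pull 1 (le_conj_one h) x) = M.pull 1 (le_conj_one hle)
      (M.pull 1 (L := Υ.infLevel V W) (K := V) (le_conj_one inf_le_left) x) := by
    rw [M.pull_pull _ _ rfl (by rw [one_mul]; exact le_conj_one (inf_le_left.trans h)),
      M.pull_pull _ _ rfl (by rw [one_mul]; exact le_conj_one (inf_le_left.trans h))]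
  have h2 : ∀ z, M.push 1 (L := Υ.infLevel V' W) (K := W) (le_conj_one inf_le_right) z =
      M.push 1 (L := Υ.infLevel V W) (K := W) (le_conj_one inf_le_right)
        (M.push 1 (le_conj_one hle) z) := fun z =>
    (M.push_push _ _ (one_mul 1).symm (le_conj_one inf_le_right) z).symm
  rw [traceAt_apply, traceAt_apply, h1, h2, hM _ _ hle, map_nsmul, ← Nat.cast_smul_eq_nsmul Φ,
    smul_smul]
  congr 1
  have e := Subgroup.relIndex_mul_relIndex _ _ _ hle (inf_le_right : (V ⊓ W : Subgroup G) ≤ W)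
  have e1 : ((Υ.infLevel V' W : Subgroup G).relIndex (Υ.infLevel V W) : Φ) ≠ 0 :=
    Nat.cast_ne_zero.2 (relIndex_level_ne_zero _ _)
  have e2 : ((Υ.infLevel V W : Subgroup G).relIndex W : Φ) ≠ 0 :=
    Nat.cast_ne_zero.2 (relIndex_level_ne_zero _ _)
  rw [← e]
  push_cast
  field_simp

variable {M} in
open Classical in
/-- The normalised trace `M^ → M(W)`, which sends the image of `x ∈ M(V)`, for `V ⊆ W`, to
`[W : V]⁻¹ pr_*(x)`. -/
def IsCohomological.trace (hM : M.IsCohomological) (W : Υ) : M.Completion →ₗ[Φ] M.obj W :=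
  Module.DirectLimit.lift Φ (Υ)ᵒᵈ (fun K => M.obj (OrderDual.ofDual K)) _
    (fun V => M.traceAt W (OrderDual.ofDual V)) fun _ _ h x => hM.traceAt_pull W h x

variable {M}

theorem IsCohomological.trace_toCompletion (hM : M.IsCohomological) (W V : Υ) (x : M.obj V) :
    hM.trace W (M.toCompletion V x) = M.traceAt W V x := by
  classical
  exact Module.DirectLimit.lift_of _ _ _

/-- The trace of a translate by `h⁻¹`, for a level contained in `h W h⁻¹`. -/
theorem IsCohomological.trace_act_inv (hM : M.IsCohomological) {W V : Υ} {h : G}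
    (hVW : (V : Subgroup G) ≤ conj h W) (x : M.obj V) :
    hM.trace W (M.act h⁻¹ (M.toCompletion V x)) =
      (((conj h⁻¹ V).relIndex (W : Subgroup G) : Φ)⁻¹) • M.push h hVW x := by
  have hle : (Υ.conjLevel h⁻¹ V : Subgroup G) ≤ W := conj_inv_le_of_le hVW
  rw [act_toCompletion, hM.trace_toCompletion, traceAt_of_le hle,
    M.pull_eq_push h⁻¹ (L := Υ.conjLevel h⁻¹ V) rfl,
    M.push_push _ _ (by simp : h = h⁻¹⁻¹ * 1) hVW]

/-- The trace at `W` is invariant under the action of `W`. -/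
theorem IsCohomological.trace_act_of_mem (hM : M.IsCohomological) {W : Υ} {h : G}
    (hh : h ∈ (W : Subgroup G)) (ξ : M.Completion) : hM.trace W (M.act h ξ) = hM.trace W ξ := by
  refine M.completion_induction (P := fun ξ => hM.trace W (M.act h ξ) = hM.trace W ξ) W
    (fun V hV x => ?_) ξ
  have hh' : h⁻¹ ∈ (W : Subgroup G) := inv_mem hh
  have h1 : (V : Subgroup G) ≤ conj h⁻¹ W := by rwa [conj_of_mem hh']
  have h2 := hM.trace_act_inv h1 x
  rw [inv_inv] at h2
  rw [h2, hM.trace_toCompletion, traceAt_of_le hV]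
  congr 1
  · have : ((conj h V).relIndex (W : Subgroup G)) = (V : Subgroup G).relIndex W := by
      conv_lhs => rw [← conj_of_mem hh]
      exact relIndex_conj_conj h _ _
    rw [this]
  · rw [← M.push_push (g := h⁻¹) (le_conj_one hV) (conj_of_mem hh').ge (one_mul _).symm]
    exact M.push_of_mem _ hh' _ _

end Trace

end RIC

/-! ### Cells and invariant functionals -/

section Orbits

variable {H G : Type*} [Group H] [Group G] {K : Subgroup G}

theorem comap_conj_mul (ι : H →* G) (h : H) (α : G) {k : G} (hk : k ∈ K) :
    (conj (ι h * α * k) K).comap ι = conj h ((conj α K).comap ι) := by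
  rw [conj_mul, conj_of_mem hk, conj_mul]
  ext x
  simp [mem_conj, mul_assoc]

/-- A chosen representative of `ι(H) g K`. -/
def orbitRep (ι : H →* G) (K : Subgroup G) (g : G) : G := (DoubleCoset.mk ι.range K g).out

theorem exists_orbitRep (ι : H →* G) (K : Subgroup G) (g : G) :
    ∃ h : H, ∃ k ∈ K, g = ι h * orbitRep ι K g * k := by
  obtain ⟨_, ⟨h, rfl⟩, k, hk, e⟩ := (DoubleCoset.eq ι.range K _ g).1 (DoubleCoset.out_eq' _ _ _)
  exact ⟨h, k, hk, e⟩

/-- An element `h` of `H` with `g ∈ ι(h) α K`, where `α` represents `ι(H) g K`. -/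
def orbitShift (ι : H →* G) (K : Subgroup G) (g : G) : H := (exists_orbitRep ι K g).choose

theorem orbitShift_spec (ι : H →* G) (K : Subgroup G) (g : G) :
    ∃ k ∈ K, g = ι (orbitShift ι K g) * orbitRep ι K g * k := (exists_orbitRep ι K g).choose_spec

theorem orbitRep_mul (ι : H →* G) (h : H) (g : G) {k : G} (hk : k ∈ K) :
    orbitRep ι K (ι h * g * k) = orbitRep ι K g := by
  unfold orbitRep
  rw [(DoubleCoset.eq ι.range K g (ι h * g * k)).2 ⟨ι h, ⟨h, rfl⟩, k, hk, rfl⟩]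

theorem comap_conj_orbit (ι : H →* G) (K : Subgroup G) (g : G) :
    (conj g K).comap ι = conj (orbitShift ι K g) ((conj (orbitRep ι K g) K).comap ι) := by
  obtain ⟨k, hk, e⟩ := orbitShift_spec ι K g
  conv_lhs => rw [e]
  exact comap_conj_mul ι _ _ hk

end Orbits

section Cells

variable {O : Type*} [CommRing O] {H G : Type*} [Group H] [TopologicalSpace H] [Group G]
  {ΥH : LevelSystem H}

/-- A class `x ∈ N(V)` sitting at the coset `g L`, where `V` stabilises `g L`. It stands for the
function `ch(g L) ⊗ [U : V] j_V(x)` on `G`, for a fixed level `U`. -/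
structure Cell (ι : H →* G) (N : RIC O ΥH) (L : Subgroup G) where
  V : ΥH
  g : G
  x : N.obj V
  le : (V : Subgroup H) ≤ (conj g L).comap ι

variable {ι : H →* G} {N : RIC O ΥH} {K L : Subgroup G}

/-- The image of a cell of level `L` at a larger level `K`. -/
def Cell.mono (h : L ≤ K) (c : Cell ι N L) : Cell ι N K where
  V := c.V
  g := c.g
  x := c.x
  le := c.le.trans fun _ hx => h hx

/-- The cell with the same support and another class. -/
def Cell.withX (c : Cell ι N L) (y : N.obj c.V) : Cell ι N L := { c with x := y }

/-- Functionals on cells of level `K` which are linear in the class, and are compatible with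
pushforwards and with translations by `H` on the left and by `K` on the right. They are the
linear functionals on an integral form of the `H`-coinvariants of `C(G/K, N^)`. -/
structure IsInvariant {M : Type*} [AddCommGroup M] [Module O M] (F : Cell ι N K → M) : Prop where
  add : ∀ (c : Cell ι N K) (x y : N.obj c.V),
    F (c.withX (x + y)) = F (c.withX x) + F (c.withX y)
  smul : ∀ (c : Cell ι N K) (r : O) (x : N.obj c.V), F (c.withX (r • x)) = r • F (c.withX x)
  push : ∀ (h : H) (k : G) (c c' : Cell ι N K) (hle : (c.V : Subgroup H) ≤ conj h c'.V), k ∈ K →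
    c.g = ι h * c'.g * k → c'.x = N.push h hle c.x → F c = F c'

variable (hW : ∀ g : G, (conj g K).comap ι ∈ ΥH)

/-- The stabiliser of `g K` in `H`. -/
abbrev stab (g : G) : ΥH := ⟨(conj g K).comap ι, hW g⟩

theorem Cell.le_conj_stab (c : Cell ι N K) {α : G} (h : orbitRep ι K c.g = α) :
    (c.V : Subgroup H) ≤ conj (orbitShift ι K c.g) (stab hW α) := by
  subst h
  exact c.le.trans (comap_conj_orbit ι K c.g).le

open Classical in
/-- The component at the orbit of `α` of a cell: if the cell lies in that orbit, translate it to
`α K` and push it forward to the stabiliser of `α K`. -/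
def Cell.retract (c : Cell ι N K) (α : G) : N.obj (stab hW α) :=
  if h : orbitRep ι K c.g = α then N.push (orbitShift ι K c.g) (c.le_conj_stab hW h) c.x else 0

theorem Cell.retract_of_ne (c : Cell ι N K) {α : G} (h : orbitRep ι K c.g ≠ α) :
    c.retract hW α = 0 := dif_neg h

variable {M : Type*} [AddCommGroup M] [Module O M] {F : Cell ι N K → M}

/-- An invariant functional on the cells supported at `α K`. -/
def IsInvariant.toLinear (hF : IsInvariant F) (α : G) : N.obj (stab hW α) →ₗ[O] M where
  toFun y := F ⟨stab hW α, α, y, le_rfl⟩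
  map_add' x y := hF.add ⟨stab hW α, α, 0, le_rfl⟩ x y
  map_smul' r x := hF.smul ⟨stab hW α, α, 0, le_rfl⟩ r x

theorem IsInvariant.eq_toLinear_retract (hF : IsInvariant F) (c : Cell ι N K) :
    F c = hF.toLinear hW (orbitRep ι K c.g) (c.retract hW (orbitRep ι K c.g)) := by
  obtain ⟨k, hk, e⟩ := orbitShift_spec ι K c.g
  rw [Cell.retract, dif_pos rfl]
  exact hF.push (orbitShift ι K c.g) k c _ (c.le_conj_stab hW rfl) hk e rfl

theorem IsInvariant.eq_sum (hF : IsInvariant F) (c : Cell ι N K) {A : Finset G}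
    (hA : orbitRep ι K c.g ∈ A) : F c = ∑ α ∈ A, hF.toLinear hW α (c.retract hW α) := by
  rw [Finset.sum_eq_single_of_mem _ hA, ← hF.eq_toLinear_retract hW]
  intro b _ hb
  rw [Cell.retract, dif_neg hb.symm, map_zero]

/-- Two finite families of cells with the same components in each orbit are not distinguished by
invariant functionals. -/
theorem IsInvariant.sum_eq_sum (hF : IsInvariant F) {A B : Type*} [Fintype A] [Fintype B]
    (a : A → Cell ι N K) (b : B → Cell ι N K)
    (hab : ∀ α, ∑ i, (a i).retract hW α = ∑ j, (b j).retract hW α) :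
    ∑ i, F (a i) = ∑ j, F (b j) := by
  classical
  let S : Finset G := Finset.univ.image (fun i => orbitRep ι K (a i).g) ∪
    Finset.univ.image (fun j => orbitRep ι K (b j).g)
  have h1 : ∑ i, F (a i) = ∑ α ∈ S, hF.toLinear hW α (∑ i, (a i).retract hW α) := by
    simp_rw [map_sum]
    rw [Finset.sum_comm]
    exact Finset.sum_congr rfl fun i _ => hF.eq_sum hW _
      (Finset.mem_union_left _ (Finset.mem_image_of_mem _ (Finset.mem_univ i)))
  have h2 : ∑ i, F (b i) = ∑ α ∈ S, hF.toLinear hW α (∑ i, (b i).retract hW α) := by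
    simp_rw [map_sum]
    rw [Finset.sum_comm]
    exact Finset.sum_congr rfl fun i _ => hF.eq_sum hW _
      (Finset.mem_union_right _ (Finset.mem_image_of_mem _ (Finset.mem_univ i)))
  rw [h1, h2]
  simp_rw [hab]

end Cells

section Cosets

variable {G : Type*} [Group G] [TopologicalSpace G] [IsTopologicalGroup G] {K : Subgroup G}

theorem finite_cosets (hK : IsOpen (K : Set G)) {C : Set G} (hC : IsCompact C) :
    {q : G ⧸ K | q.out ∈ C}.Finite := by
  have : DiscreteTopology (G ⧸ K) := QuotientGroup.discreteTopology hK
  have h := (hC.image (QuotientGroup.continuous_mk (N := K))).finite_of_discrete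
  exact h.subset fun q hq => ⟨q.out, hq, QuotientGroup.out_eq' q⟩

theorem finite_support_cosets {τ : Type*} [Zero τ] (hK : IsOpen (K : Set G)) {ξ : G → τ}
    (hξ : HasCompactSupport ξ) : {q : G ⧸ K | ξ q.out ≠ 0}.Finite :=
  (finite_cosets hK hξ).subset fun _ hq => subset_tsupport ξ hq

end Cosets

/-! ### Orbit sums of functions with values in the completion -/

namespace RIC

variable {O : Type*} [CommRing O] {H : Type*} [Group H] [TopologicalSpace H]
  {ΥH : LevelSystem H} (N : RIC O ΥH) (Φ : Type*) [CommRing Φ] [Algebra O Φ]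

/-- The natural map `N(V) → Φ ⊗ N(V)`. -/
def toBaseChange (V : ΥH) : N.obj V →+ (N.baseChange Φ).obj V :=
  (TensorProduct.mk O Φ (N.obj V) 1).toAddMonoidHom

theorem toComplBaseChange_eq (V : ΥH) (x : N.obj V) :
    N.toComplBaseChange Φ V x = (N.baseChange Φ).toCompletion V (N.toBaseChange Φ V x) := rfl

theorem toBaseChange_push {h : H} {V W : ΥH} (hVW : (V : Subgroup H) ≤ conj h W) (x : N.obj V) :
    (N.baseChange Φ).push h hVW (N.toBaseChange Φ V x) = N.toBaseChange Φ W (N.push h hVW x) :=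
  LinearMap.baseChange_tmul _ _ _

theorem toBaseChange_pull {h : H} {V W : ΥH} (hVW : (V : Subgroup H) ≤ conj h W) (x : N.obj W) :
    (N.baseChange Φ).pull h hVW (N.toBaseChange Φ W x) = N.toBaseChange Φ V (N.pull h hVW x) :=
  LinearMap.baseChange_tmul _ _ _

theorem toBaseChange_smul (V : ΥH) (r : O) (x : N.obj V) :
    N.toBaseChange Φ V (r • x) = algebraMap O Φ r • N.toBaseChange Φ V x := by
  change (1 : Φ) ⊗ₜ[O] (r • x) = algebraMap O Φ r • ((1 : Φ) ⊗ₜ[O] x)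
  rw [TensorProduct.tmul_smul, algebraMap_smul]

theorem toComplBaseChange_pull {V W : ΥH} (h : (V : Subgroup H) ≤ W) (x : N.obj W) :
    N.toComplBaseChange Φ V (N.pull 1 (le_conj_one h) x) = N.toComplBaseChange Φ W x := by
  rw [toComplBaseChange_eq, toComplBaseChange_eq, ← toBaseChange_pull,
    toCompletion_pull _ h]

theorem act_toComplBaseChange {V : ΥH} {h : H} (hh : h ∈ (V : Subgroup H)) (x : N.obj V) :
    (N.baseChange Φ).act h (N.toComplBaseChange Φ V x) = N.toComplBaseChange Φ V x := by
  have e : (ΥH.conjLevel h V : Subgroup H) ≤ V := (conj_of_mem hh).le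
  rw [toComplBaseChange_eq, act_toCompletion, toBaseChange_pull, ← toComplBaseChange_eq,
    ← toComplBaseChange_eq, ← N.toComplBaseChange_pull Φ e]
  congr 1
  exact (N.pull_base (L := ΥH.conjLevel h V) (K := V) (U := V) (conj_of_mem hh) rfl hh le_rfl x
    |> fun q => by rwa [N.pull_one] at q)

/-- A torsion free module embeds into its base change to the fraction field. -/
theorem IsTorsionFree.toBaseChange_injective [IsDomain O] [IsFractionRing O Φ] {N : RIC O ΥH}
    (hN : N.IsTorsionFree) (V : ΥH) : Function.Injective (N.toBaseChange Φ V) := by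
  have : IsLocalizedModule (nonZeroDivisors O) (TensorProduct.mk O Φ (N.obj V) 1) :=
    (isLocalizedModule_iff_isBaseChange (nonZeroDivisors O) Φ _).2
      (TensorProduct.isBaseChange O (N.obj V) Φ)
  intro x y hxy
  obtain ⟨c, hc⟩ := (IsLocalizedModule.eq_iff_exists (nonZeroDivisors O)
    (TensorProduct.mk O Φ (N.obj V) 1)).1 hxy
  have h0 : (c : O) • (x - y) = 0 := by
    rw [smul_sub, sub_eq_zero]; exact hc
  rcases hN V c _ h0 with h | h
  · exact absurd h (nonZeroDivisors.ne_zero c.2)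
  · exact sub_eq_zero.1 h

end RIC

section Translate

variable {O : Type*} [CommRing O] {H G : Type*} [Group H] [TopologicalSpace H]
  [Group G] {ΥH : LevelSystem H} {ι : H →* G} {N : RIC O ΥH} {K : Subgroup G}
  {Φ : Type*} [Field Φ] [Algebra O Φ]

theorem exists_out_smul (g : G) (q : G ⧸ K) : ∃ k ∈ K, g * q.out = (g • q).out * k := by
  refine ⟨(g • q).out⁻¹ * (g * q.out), QuotientGroup.eq.1 ?_, by simp⟩
  rw [QuotientGroup.out_eq']
  conv_lhs => rw [← QuotientGroup.out_eq' q]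
  rfl

theorem finite_support_translate {ξ : G → (N.baseChange Φ).Completion}
    (hξ : ∀ g, ∀ k ∈ K, ξ (g * k) = ξ g) (hξ' : {q : G ⧸ K | ξ q.out ≠ 0}.Finite) (h : H) :
    {q : G ⧸ K | translate ι N Φ h ξ q.out ≠ 0}.Finite := by
  refine (hξ'.preimage ((MulAction.injective (β := G ⧸ K) (ι h)⁻¹).injOn)).subset fun q hq h0 => ?_
  obtain ⟨k, hk, e⟩ := exists_out_smul (ι h)⁻¹ q
  apply hq
  rw [translate, e, hξ _ _ hk, h0, map_zero]

end Translate

section OrbitSum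

variable {O : Type*} [CommRing O] {H G : Type*} [Group H] [TopologicalSpace H]
  [IsTopologicalGroup H] [Group G] {ΥH : LevelSystem H} {ι : H →* G} {N : RIC O ΥH} {K : Subgroup G}
  (hW : ∀ g : G, (conj g K).comap ι ∈ ΥH)
  {Φ : Type*} [Field Φ] [CharZero Φ] [Algebra O Φ] (hN : (N.baseChange Φ).IsCohomological)

open Classical in
/-- The normalised trace, at the stabiliser of `α K`, of the value of `ξ` at `g`, translated from
`g K` to `α K`; zero if `g` does not lie in the orbit of `α`. -/
def orbitCoeff (α : G) (ξ : G → (N.baseChange Φ).Completion) (g : G) :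
    (N.baseChange Φ).obj (stab hW α) :=
  if orbitRep ι K g = α then
    hN.trace (stab hW α) ((N.baseChange Φ).act (orbitShift ι K g)⁻¹ (ξ g)) else 0

/-- The translation from `g K` to `α K` may be done by any `h` with `g ∈ ι(h) α K`. -/
theorem orbitCoeff_eq {α : G} (ξ : G → (N.baseChange Φ).Completion) {g : G}
    (hg : orbitRep ι K g = α) {h : H} {k : G} (hk : k ∈ K) (e : g = ι h * α * k) :
    orbitCoeff hW hN α ξ g = hN.trace (stab hW α) ((N.baseChange Φ).act h⁻¹ (ξ g)) := by
  rw [orbitCoeff, if_pos hg]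
  obtain ⟨k', hk', e'⟩ := orbitShift_spec ι K g
  rw [hg] at e'
  set h' := orbitShift ι K g
  have hmem : h⁻¹ * h' ∈ (stab hW α : Subgroup H) := by
    change α⁻¹ * ι (h⁻¹ * h') * α ∈ K
    have : α⁻¹ * ι (h⁻¹ * h') * α = k * k'⁻¹ := by
      have e2 : ι h' = g * k'⁻¹ * α⁻¹ := by rw [e']; group
      rw [map_mul, e2, e, map_inv]
      group
    rw [this]
    exact mul_mem hk (inv_mem hk')
  rw [← hN.trace_act_of_mem hmem, ← RIC.act_mul, mul_inv_cancel_right]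

theorem orbitCoeff_mul {α : G} {ξ : G → (N.baseChange Φ).Completion}
    (hξ : ∀ g, ∀ k ∈ K, ξ (g * k) = ξ g) (g : G) {k : G} (hk : k ∈ K) :
    orbitCoeff hW hN α ξ (g * k) = orbitCoeff hW hN α ξ g := by
  have hr : orbitRep ι K (g * k) = orbitRep ι K g := by
    simpa using orbitRep_mul ι (1 : H) g hk
  by_cases h : orbitRep ι K g = α
  · obtain ⟨k', hk', e'⟩ := orbitShift_spec ι K g
    rw [h] at e'
    rw [orbitCoeff_eq hW hN ξ h hk' e', orbitCoeff_eq hW hN ξ (hr.trans h) (mul_mem hk' hk)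
      (by rw [← mul_assoc, ← e']), hξ g k hk]
  · rw [orbitCoeff, orbitCoeff, if_neg h, if_neg (hr ▸ h)]

theorem orbitCoeff_translate {α : G} (ξ : G → (N.baseChange Φ).Completion) (h₀ : H) (g : G) :
    orbitCoeff hW hN α (translate ι N Φ h₀ ξ) g = orbitCoeff hW hN α ξ ((ι h₀)⁻¹ * g) := by
  have hr : orbitRep ι K ((ι h₀)⁻¹ * g) = orbitRep ι K g := by
    simpa using orbitRep_mul ι h₀⁻¹ g (one_mem K)
  by_cases h : orbitRep ι K g = α
  · obtain ⟨k', hk', e'⟩ := orbitShift_spec ι K g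
    rw [h] at e'
    rw [orbitCoeff_eq hW hN _ h hk' e',
      orbitCoeff_eq hW hN ξ (hr.trans h) (h := h₀⁻¹ * orbitShift ι K g) hk'
      (by conv_lhs => rw [e']
          simp [mul_assoc]), translate, ← RIC.act_mul]
    simp
  · rw [orbitCoeff, orbitCoeff, if_neg h, if_neg (hr ▸ h)]

theorem orbitCoeff_of_eq_zero {α : G} {ξ : G → (N.baseChange Φ).Completion} {g : G}
    (h : ξ g = 0) : orbitCoeff hW hN α ξ g = 0 := by
  rw [orbitCoeff, h, map_zero, map_zero, ite_self]

theorem orbitCoeff_add (α : G) (ξ η : G → (N.baseChange Φ).Completion) (g : G) :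
    orbitCoeff hW hN α (ξ + η) g = orbitCoeff hW hN α ξ g + orbitCoeff hW hN α η g := by
  simp only [orbitCoeff, Pi.add_apply, map_add]
  split_ifs <;> simp

theorem orbitCoeff_smul (α : G) (c : Φ) (ξ : G → (N.baseChange Φ).Completion) (g : G) :
    orbitCoeff hW hN α (c • ξ) g = c • orbitCoeff hW hN α ξ g := by
  simp only [orbitCoeff, Pi.smul_apply, map_smul]
  split_ifs <;> simp

/-- The sum of the normalised traces of `ξ` over the cosets in the orbit of `α`. -/
def orbitSum (α : G) (ξ : G → (N.baseChange Φ).Completion) : (N.baseChange Φ).obj (stab hW α) :=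
  ∑ᶠ q : G ⧸ K, orbitCoeff hW hN α ξ q.out

theorem finite_support_orbitCoeff {α : G} {ξ : G → (N.baseChange Φ).Completion}
    (hξ : {q : G ⧸ K | ξ q.out ≠ 0}.Finite) :
    (Function.support fun q : G ⧸ K => orbitCoeff hW hN α ξ q.out).Finite :=
  hξ.subset fun _ hq h0 => hq (orbitCoeff_of_eq_zero hW hN h0)

theorem orbitSum_add {α : G} {ξ η : G → (N.baseChange Φ).Completion}
    (hξ : {q : G ⧸ K | ξ q.out ≠ 0}.Finite) (hη : {q : G ⧸ K | η q.out ≠ 0}.Finite) :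
    orbitSum hW hN α (ξ + η) = orbitSum hW hN α ξ + orbitSum hW hN α η := by
  unfold orbitSum
  rw [← finsum_add_distrib (finite_support_orbitCoeff hW hN hξ)
    (finite_support_orbitCoeff hW hN hη)]
  exact finsum_congr fun q => orbitCoeff_add hW hN α ξ η _

theorem orbitSum_smul (α : G) (c : Φ) {ξ : G → (N.baseChange Φ).Completion}
    (hξ : {q : G ⧸ K | ξ q.out ≠ 0}.Finite) :
    orbitSum hW hN α (c • ξ) = c • orbitSum hW hN α ξ := by
  unfold orbitSum
  rw [smul_finsum' c (finite_support_orbitCoeff hW hN hξ)]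
  exact finsum_congr fun q => orbitCoeff_smul hW hN α c ξ _

theorem orbitSum_translate {α : G} {ξ : G → (N.baseChange Φ).Completion}
    (hξ : ∀ g, ∀ k ∈ K, ξ (g * k) = ξ g) (h : H) :
    orbitSum hW hN α (translate ι N Φ h ξ) = orbitSum hW hN α ξ := by
  unfold orbitSum
  refine Eq.trans (finsum_congr fun q => ?_) (finsum_comp_equiv
    (f := fun q : G ⧸ K => orbitCoeff hW hN α ξ q.out) (MulAction.toPerm (ι h)⁻¹))
  obtain ⟨k, hk, e⟩ := exists_out_smul (ι h)⁻¹ q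
  rw [orbitCoeff_translate, e, orbitCoeff_mul hW hN hξ _ hk]
  rfl

/-- The sum of the normalised traces over an orbit factors through the `H`-coinvariants. -/
theorem SameCoinvariants.orbitSum_eq [TopologicalSpace G] [IsTopologicalGroup G]
    (hK : IsOpen (K : Set G)) {ξ₁ ξ₂ : G → (N.baseChange Φ).Completion}
    (h : SameCoinvariants ι N Φ K ξ₁ ξ₂) (h₂ : {q : G ⧸ K | ξ₂ q.out ≠ 0}.Finite) (α : G) :
    orbitSum hW hN α ξ₁ = orbitSum hW hN α ξ₂ := by
  have key : {q : G ⧸ K | (ξ₁ - ξ₂) q.out ≠ 0}.Finite ∧ orbitSum hW hN α (ξ₁ - ξ₂) = 0 := by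
    refine Submodule.span_induction (p := fun η _ => {q : G ⧸ K | η q.out ≠ 0}.Finite ∧
      orbitSum hW hN α η = 0) ?_ ?_ ?_ ?_ h
    · rintro _ ⟨h, ξ, ⟨hξ, hc⟩, rfl⟩
      have hf := finite_support_cosets hK hc
      have ht := finite_support_translate (ι := ι) hξ hf h
      have hn : {q : G ⧸ K | ((-1 : Φ) • ξ) q.out ≠ 0}.Finite :=
        hf.subset fun q hq h0 => hq (by rw [Pi.smul_apply, h0, smul_zero])
      have e : translate ι N Φ h ξ - ξ = translate ι N Φ h ξ + (-1 : Φ) • ξ := by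
        rw [neg_one_smul, sub_eq_add_neg]
      constructor
      · refine (ht.union hf).subset fun q hq => ?_
        by_contra hcon
        simp only [Set.mem_union, Set.mem_ofPred_eq, not_or, not_not] at hcon
        exact hq (by rw [Pi.sub_apply, hcon.1, hcon.2, sub_zero])
      · rw [e, orbitSum_add hW hN ht hn, orbitSum_smul hW hN _ _ hf, orbitSum_translate hW hN hξ,
          neg_one_smul, add_neg_cancel]
    · refine ⟨by simp, ?_⟩
      exact finsum_eq_zero_of_forall_eq_zero fun q => orbitCoeff_of_eq_zero hW hN rfl
    · rintro x y _ _ ⟨hx, hx'⟩ ⟨hy, hy'⟩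
      refine ⟨(hx.union hy).subset fun q hq => ?_,
        by rw [orbitSum_add hW hN hx hy, hx', hy', add_zero]⟩
      by_contra hcon
      simp only [Set.mem_union, Set.mem_ofPred_eq, not_or, not_not] at hcon
      exact hq (by rw [Pi.add_apply, hcon.1, hcon.2, add_zero])
    · rintro c x _ ⟨hx, hx'⟩
      exact ⟨hx.subset fun q hq h0 => hq (by rw [Pi.smul_apply, h0, smul_zero]),
        by rw [orbitSum_smul hW hN _ _ hx, hx', smul_zero]⟩
  have := orbitSum_add hW hN (α := α) key.1 h₂
  rwa [sub_add_cancel, key.2, zero_add] at this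

end OrbitSum

section CellCoeff

variable {O : Type*} [CommRing O] {H G : Type*} [Group H] [TopologicalSpace H]
  [LocallyProfinite H] [Group G] {ΥH : LevelSystem H} {ι : H →* G} {N : RIC O ΥH} {K : Subgroup G}
  (hW : ∀ g : G, (conj g K).comap ι ∈ ΥH)
  {Φ : Type*} [Field Φ] [CharZero Φ] [Algebra O Φ] (hN : (N.baseChange Φ).IsCohomological)

/-- The normalised trace of the value `[U : V] j_V(x)` is, up to a factor which only depends on
the orbit, the component of the cell `(V, g, x)`. Unimodularity makes the factor independent of
the position of `g` in its orbit. -/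
theorem genIndex_smul_trace_cell (hH : IsUnimodular H) (U : ΥH) (c : Cell ι N K) {α : G}
    (h : orbitRep ι K c.g = α) :
    ((genIndex (U : Subgroup H) c.V : ℚ) : Φ) •
      hN.trace (stab hW α) ((N.baseChange Φ).act (orbitShift ι K c.g)⁻¹
        (N.toComplBaseChange Φ c.V c.x)) =
      ((genIndex (U : Subgroup H) (stab hW α) : ℚ) : Φ) •
        N.toBaseChange Φ _ (c.retract hW α) := by
  rw [Cell.retract, dif_pos h, RIC.toComplBaseChange_eq,
    hN.trace_act_inv (c.le_conj_stab hW h), RIC.toBaseChange_push, smul_smul,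
    ← genIndex_mul_inv_relIndex hH (ΥH.isOpen _ U.2) (ΥH.isCompact _ U.2) (ΥH.isOpen _ c.V.2)
      (ΥH.isCompact _ c.V.2) (ΥH.isOpen _ (stab hW α).2) (ΥH.isCompact _ (stab hW α).2)
      (c.le_conj_stab hW h)]
  push_cast
  rfl

end CellCoeff

/-! ### Zeta elements as finite families of cells -/

section FiberCount

variable {H G : Type*} [Group H] [Group G] (ι : H →* G) (U : Subgroup H) (K : Subgroup G)

variable {ι U K} in
/-- A representative of a double coset in `ι(U) \ G / K`. -/
def _root_.DoubleCoset.Quotient.rep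
    (t : DoubleCoset.Quotient ((U.map ι : Subgroup G) : Set G) (K : Set G)) : G :=
  Quotient.out t

variable {ι U K} in
theorem mk_rep (t : DoubleCoset.Quotient ((U.map ι : Subgroup G) : Set G) (K : Set G)) :
    DoubleCoset.mk (U.map ι) K t.rep = t := DoubleCoset.out_eq' _ _ t

/-- The double coset in `ι(U) \ G / K` of a left coset of `K`. -/
def toDoubleCoset (q : G ⧸ K) :
    DoubleCoset.Quotient ((U.map ι : Subgroup G) : Set G) (K : Set G) :=
  DoubleCoset.mk (U.map ι) K q.out

theorem exists_out_mk (g : G) : ∃ k ∈ K, (g : G ⧸ K).out = g * k := by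
  obtain ⟨k, hk⟩ := QuotientGroup.mk_out_eq_mul K g
  exact ⟨k, k.2, hk⟩

theorem toDoubleCoset_mk (g : G) :
    toDoubleCoset ι U K (g : G ⧸ K) = DoubleCoset.mk (U.map ι) K g := by
  obtain ⟨k, hk, e⟩ := exists_out_mk K g
  exact ((DoubleCoset.eq _ _ _ _).2 ⟨1, one_mem _, k, hk, by rw [e, one_mul]⟩).symm

/-- The double coset `ι(U) γ K` consists of `[U : U ∩ γ K γ⁻¹]` left cosets of `K`. -/
theorem ncard_toDoubleCoset_fiber (γ : G) :
    {q : G ⧸ K | toDoubleCoset ι U K q = DoubleCoset.mk (U.map ι) K γ}.ncard =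
      (U ⊓ (conj γ K).comap ι).relIndex U := by
  let _ : MulAction U (G ⧸ K) := MulAction.compHom (G ⧸ K) (ι.comp U.subtype)
  have hsmul : ∀ (u : U) (g : G), u • (g : G ⧸ K) = ((ι u * g : G) : G ⧸ K) := fun _ _ => rfl
  have h1 : {q : G ⧸ K | toDoubleCoset ι U K q = DoubleCoset.mk (U.map ι) K γ} =
      MulAction.orbit U (γ : G ⧸ K) := by
    ext q
    constructor
    · intro hq
      obtain ⟨_, ⟨u, hu, rfl⟩, k, hk, e⟩ := (DoubleCoset.eq _ _ _ _).1 (Eq.symm hq)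
      refine ⟨⟨u, hu⟩, ?_⟩
      change (⟨u, hu⟩ : U) • (γ : G ⧸ K) = q
      rw [hsmul, ← QuotientGroup.out_eq' q, e]
      exact QuotientGroup.eq.2 (by simpa [mul_assoc] using hk)
    · rintro ⟨u, rfl⟩
      change toDoubleCoset ι U K (u • (γ : G ⧸ K)) = _
      rw [hsmul, toDoubleCoset_mk]
      exact ((DoubleCoset.eq _ _ _ _).2
        ⟨ι u, Subgroup.mem_map_of_mem ι u.2, 1, one_mem _, by rw [mul_one]⟩).symm
  have h2 : MulAction.stabilizer U (γ : G ⧸ K) = (U ⊓ (conj γ K).comap ι).subgroupOf U := by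
    ext u
    rw [MulAction.mem_stabilizer_iff, hsmul, Subgroup.mem_subgroupOf, Subgroup.mem_inf,
      and_iff_right u.2, Subgroup.mem_comap, mem_conj, eq_comm, QuotientGroup.eq, mul_assoc]
  rw [h1, ← MulAction.index_stabilizer, h2]
  rfl

end FiberCount

section HeckeOrbits

theorem exists_rep_toDoubleCoset {H G : Type*} [Group H] [Group G] (ι : H →* G) (U : Subgroup H)
    (K : Subgroup G) (g : G) :
    ∃ u ∈ U, ∃ k ∈ K, g = ι u * (DoubleCoset.mk (U.map ι) K g).rep * k := by
  obtain ⟨_, ⟨u, hu, rfl⟩, k, hk, e⟩ :=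
    (DoubleCoset.eq (U.map ι) K _ g).1 (mk_rep _)
  exact ⟨u, hu, k, hk, e⟩

variable {O : Type*} [CommRing O] {H G : Type*} [Group H] [Group G] {ι : H →* G} {K : Subgroup G}

/-- The double cosets in `ι(U) \ G / K` at which a function does not vanish. -/
abbrev HeckeOrbit (ι : H →* G) (U : Subgroup H) (K : Subgroup G) (f : G → O) : Type _ :=
  {t : DoubleCoset.Quotient ((U.map ι : Subgroup G) : Set G) (K : Set G) // f t.rep ≠ 0}

theorem HeckeElement.apply_rep [TopologicalSpace G] (𝔥 : HeckeElement O K) {U : Subgroup H}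
    (hU : U ≤ K.comap ι) (g : G) :
    𝔥.toFun (DoubleCoset.mk (U.map ι) K g).rep = 𝔥.toFun g := by
  obtain ⟨u, hu, k, hk, e⟩ := exists_rep_toDoubleCoset ι U K g
  conv_rhs => rw [e, 𝔥.right_inv k hk, 𝔥.left_inv _ (hU hu)]

theorem HeckeElement.finite_heckeOrbit [TopologicalSpace G] [IsTopologicalGroup G]
    (𝔥 : HeckeElement O K) (hK : IsOpen (K : Set G)) (U : Subgroup H) :
    Finite (HeckeOrbit ι U K 𝔥.toFun) := by
  have h := (finite_support_cosets hK 𝔥.hasCompactSupport).image (toDoubleCoset ι U K)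
  refine Set.Finite.to_subtype (h.subset fun t ht => ?_)
  have e : toDoubleCoset ι U K t.rep = t := by rw [toDoubleCoset_mk, mk_rep]
  refine ⟨t.rep, ?_, e⟩
  obtain ⟨k, hk, e'⟩ := exists_out_mk K t.rep
  change 𝔥.toFun _ ≠ 0
  rw [e', 𝔥.right_inv k hk]
  exact ht

end HeckeOrbits

section Local

variable {O : Type*} [CommRing O] {H G : Type*} [Group H] [TopologicalSpace H]
  [Group G] {ΥH : LevelSystem H} {ι : H →* G} {N : RIC O ΥH} {K : Subgroup G}
  (hW : ∀ g : G, (conj g K).comap ι ∈ ΥH)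

/-- The restriction of `φ ∈ N(U)` to the stabiliser in `U` of `γ K`, as a cell at `γ K`. -/
def restrictCell {U : ΥH} (φ : N.obj U) (γ : G) : Cell ι N K where
  V := ΥH.infLevel U (stab hW γ)
  g := γ
  x := N.pull 1 (L := ΥH.infLevel U (stab hW γ)) (le_conj_one inf_le_left) φ
  le := inf_le_right

variable [LocallyProfinite H] {Φ : Type*} [Field Φ] [CharZero Φ] [Algebra O Φ]
  (hN : (N.baseChange Φ).IsCohomological)

/-- The values of an integral function define a finite family of cells, which computes all its
orbit sums. -/
theorem orbitSum_integral (hH : IsUnimodular H) (U : ΥH) {L : Subgroup G} (hLK : L ≤ K)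
    {ζ : G → (N.baseChange Φ).Completion}
    (hζ : {q : G ⧸ K | ζ q.out ≠ 0}.Finite) (hL : IsIntegralAt ι N Φ (U : Subgroup H) L ζ) :
    ∃ (n : ℕ) (a : Fin n → Cell ι N L), ∀ α, orbitSum hW hN α ζ =
      ((genIndex (U : Subgroup H) (stab hW α) : ℚ) : Φ) •
        N.toBaseChange Φ _ (∑ i, ((a i).mono hLK).retract hW α) := by
  classical
  choose n V x hV hx using hL
  have := hζ.fintype
  let A := Σ q : {q : G ⧸ K | ζ q.out ≠ 0}, Fin (n (q : G ⧸ K).out)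
  let a : A → Cell ι N L := fun s => ⟨V _ s.2, (s.1 : G ⧸ K).out, x _ s.2, hV _ s.2⟩
  let e := (Fintype.equivFin A).symm
  refine ⟨Fintype.card A, fun i => a (e i), fun α => ?_⟩
  rw [e.sum_comp (fun s => ((a s).mono hLK).retract hW α), map_sum, Finset.smul_sum,
    Fintype.sum_sigma, orbitSum, finsum_eq_sum_of_support_subset (s := hζ.toFinset) _
      (fun q hq => hζ.mem_toFinset.2 fun h0 => hq (orbitCoeff_of_eq_zero hW hN h0)),
    ← Finset.sum_coe_sort]
  refine Fintype.sum_equiv (Equiv.subtypeEquivRight fun q => hζ.mem_toFinset) _ _ fun q => ?_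
  rw [orbitCoeff, hx]
  split_ifs with h
  · rw [map_sum, map_sum]
    refine Finset.sum_congr rfl fun i _ => ?_
    rw [map_smul, map_smul]
    exact genIndex_smul_trace_cell hW hN hH U
      ((a ⟨⟨q, hζ.mem_toFinset.1 q.2⟩, i⟩).mono hLK) h
  · refine (Finset.sum_eq_zero fun i _ => ?_).symm
    rw [Cell.retract_of_ne, map_zero, smul_zero]
    exact h

variable [TopologicalSpace G] [IsTopologicalGroup G]

/-- The orbit sums of `𝔥 ⊗ j_U(φ)`: the `[U : U ∩ γ K γ⁻¹]` cosets in a double coset `ι(U) γ K`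
contribute equally, and this number is the index in the normalisation of the cell at `γ`. -/
theorem orbitSum_hecke (hH : IsUnimodular H) (hK : IsOpen (K : Set G)) (𝔥 : HeckeElement O K)
    {U : ΥH} (hU : (U : Subgroup H) ≤ K.comap ι) (φ : N.obj U)
    [Fintype (HeckeOrbit ι U K 𝔥.toFun)] (α : G) :
    orbitSum hW hN α (fun g => algebraMap O Φ (𝔥.toFun g) • N.toComplBaseChange Φ U φ) =
      ((genIndex (U : Subgroup H) (stab hW α) : ℚ) : Φ) •
        N.toBaseChange Φ _ (∑ t : HeckeOrbit ι U K 𝔥.toFun, 𝔥.toFun t.1.rep •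
          (restrictCell hW φ t.1.rep).retract hW α) := by
  classical
  set ξ : G → (N.baseChange Φ).Completion :=
    fun g => algebraMap O Φ (𝔥.toFun g) • N.toComplBaseChange Φ U φ with hξdef
  have hξ : ∀ g, ∀ k ∈ K, ξ (g * k) = ξ g := fun g k hk => by
    simp only [hξdef, 𝔥.right_inv k hk]
  have hξU : ∀ u ∈ (U : Subgroup H), translate ι N Φ u ξ = ξ := by
    intro u hu
    funext g
    simp only [translate, hξdef, map_smul, N.act_toComplBaseChange Φ hu]
    rw [← map_inv, 𝔥.left_inv _ (hU (inv_mem hu))]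
  let f : G ⧸ K → (N.baseChange Φ).obj (stab hW α) := fun q => orbitCoeff hW hN α ξ q.out
  have hf : ∀ (t : DoubleCoset.Quotient (((U : Subgroup H).map ι : Subgroup G) : Set G) (K : Set G))
      (q : G ⧸ K), toDoubleCoset ι U K q = t → f q = orbitCoeff hW hN α ξ t.rep := by
    rintro t q rfl
    obtain ⟨u, hu, k, hk, e⟩ := exists_rep_toDoubleCoset ι U K q.out
    simp only [f]
    conv_lhs => rw [e, orbitCoeff_mul hW hN hξ _ hk]
    conv_rhs => rw [← hξU u⁻¹ (inv_mem hu), orbitCoeff_translate, map_inv, inv_inv]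
    rfl
  have hfin : {q : G ⧸ K | 𝔥.toFun q.out ≠ 0}.Finite :=
    finite_support_cosets hK 𝔥.hasCompactSupport
  have hsupp : Function.support f ⊆ hfin.toFinset := fun q hq => hfin.mem_toFinset.2 fun h0 =>
    hq (orbitCoeff_of_eq_zero hW hN (by simp only [hξdef, h0, map_zero, zero_smul]))
  have hmaps : ∀ q : G ⧸ K, 𝔥.toFun (toDoubleCoset ι U K q).rep = 𝔥.toFun q.out := fun q =>
    𝔥.apply_rep hU q.out
  have hsum : orbitSum hW hN α ξ = ∑ t : HeckeOrbit ι U K 𝔥.toFun,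
      (((U : Subgroup H) ⊓ (conj t.1.rep K).comap ι).relIndex U) •
        orbitCoeff hW hN α ξ t.1.rep := by
    rw [orbitSum, finsum_eq_sum_of_support_subset (s := hfin.toFinset) _ hsupp,
      ← Finset.sum_fiberwise_of_maps_to (t := (Finset.univ : Finset (HeckeOrbit ι U K 𝔥.toFun)).map
        (Function.Embedding.subtype _)) (g := toDoubleCoset ι U K) (fun q hq =>
          Finset.mem_map.2 ⟨⟨toDoubleCoset ι U K q, by
            rw [hmaps]; exact hfin.mem_toFinset.1 hq⟩, Finset.mem_univ _, rfl⟩), Finset.sum_map]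
    refine Finset.sum_congr rfl fun t _ => ?_
    change ∑ i ∈ hfin.toFinset with toDoubleCoset ι U K i = t.1, f i = _
    rw [Finset.sum_congr rfl (g := fun _ => orbitCoeff hW hN α ξ t.1.rep) fun q hq =>
      hf t.1 q (Finset.mem_filter.1 hq).2, Finset.sum_const]
    congr 1
    rw [← ncard_toDoubleCoset_fiber, ← Set.ncard_coe_finset]
    congr 1
    ext q
    rw [mk_rep]
    simp only [Finset.coe_filter, Set.mem_ofPred_eq, and_iff_right_iff_imp]
    intro h
    rw [hfin.mem_toFinset, Set.mem_ofPred_eq, ← hmaps, h]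
    exact t.2
  rw [hsum, map_sum, Finset.smul_sum]
  refine Finset.sum_congr rfl fun t _ => ?_
  rw [N.toBaseChange_smul, smul_comm, orbitCoeff, ← Nat.cast_smul_eq_nsmul Φ]
  split_ifs with h
  · rw [← genIndex_smul_trace_cell hW hN hH U (restrictCell hW φ t.1.rep) h]
    simp only [restrictCell]
    rw [N.toComplBaseChange_pull Φ (V := ΥH.infLevel U (stab hW t.1.rep)) inf_le_left,
      genIndex_of_le inf_le_left, map_smul, map_smul, smul_comm, Rat.cast_natCast]
  · rw [Cell.retract_of_ne, map_zero, smul_zero, smul_zero, smul_zero]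
    exact h

/-- The local input for gluing: a zeta element provides a finite family of cells of level `L`
which no invariant functional at level `K` distinguishes from the Hecke operator applied to `φ`.
Equality of the coinvariants over `Φ` becomes an integral equality in each of the modules attached
to the orbits, as these are torsion free. -/
theorem IsZetaElement.exists_cells [IsDomain O] [IsFractionRing O Φ] (hH : IsUnimodular H)
    (hNc : N.IsCohomological) (hNt : N.IsTorsionFree) (hK : IsOpen (K : Set G)) {L : Subgroup G}
    (hLK : L ≤ K) (𝔥 : HeckeElement O K) {U : ΥH} (hU : (U : Subgroup H) ≤ K.comap ι)
    (φ : N.obj U) [Fintype (HeckeOrbit ι U K 𝔥.toFun)] {ζ : G → (N.baseChange Φ).Completion}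
    (hζ : IsZetaElement ι N Φ U φ 𝔥 L ζ) :
    ∃ (n : ℕ) (a : Fin n → Cell ι N L), ∀ α, ∑ i, ((a i).mono hLK).retract hW α =
      ∑ t : HeckeOrbit ι U K 𝔥.toFun, 𝔥.toFun t.1.rep •
          (restrictCell hW φ t.1.rep).retract hW α := by
  obtain ⟨⟨-, hc⟩, hint, hco⟩ := hζ
  have hN := hNc.baseChange Φ
  obtain ⟨n, a, ha⟩ := orbitSum_integral hW hN hH U hLK (finite_support_cosets hK hc) hint
  refine ⟨n, a, fun α => hNt.toBaseChange_injective Φ _ ?_⟩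
  have hf : {q : G ⧸ K | algebraMap O Φ (𝔥.toFun q.out) • N.toComplBaseChange Φ U φ ≠ 0}.Finite :=
    (finite_support_cosets hK 𝔥.hasCompactSupport).subset fun q hq h0 =>
      hq (by rw [h0, map_zero, zero_smul])
  have h := hco.orbitSum_eq hW hN hK hf α
  rw [ha, orbitSum_hecke hW hN hH hK 𝔥 hU φ] at h
  have hne : ((genIndex (U : Subgroup H) (stab hW α) : ℚ) : Φ) ≠ 0 :=
    Rat.cast_ne_zero.2 (genIndex_ne_zero (ΥH.isOpen _ U.2) (ΥH.isCompact _ U.2)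
      (ΥH.isOpen _ (stab hW α).2) (ΥH.isCompact _ (stab hW α).2))
  exact smul_right_injective _ hne h

end Local

/-! ### Hecke operators on twisted pushforwards -/

theorem RIC.push_pull_of_eq {R : Type*} [CommRing R] {G : Type*} [Group G] [TopologicalSpace G]
    {Υ : LevelSystem G} (M : RIC R Υ) {A B V : Υ} (h : A = B) (hA : (A : Subgroup G) ≤ V)
    (hB : (B : Subgroup G) ≤ V) (hAB : (A : Subgroup G) ≤ conj 1 B) (x : M.obj V) :
    M.push 1 hAB (M.pull 1 (le_conj_one hA) x) = M.pull 1 (le_conj_one hB) x := by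
  subst h
  exact M.push_one _ _

namespace Pushforward

variable {R : Type*} [CommRing R] {H G : Type*} [Group H] [TopologicalSpace H] [Group G]
  [TopologicalSpace G] {ι : H →* G} {ΥH : LevelSystem H} {ΥG : LevelSystem G} {MH : RIC R ΥH}
  {MG : RIC R ΥG} (i : Pushforward ι MH MG)

/-- The twisted pushforward `[g]_* ∘ ι_* : M_H(V) → M_G(K)`, for `V ⊆ g K g⁻¹`. -/
def twist (V : ΥH) (g : G) (K : ΥG) (hV : (V : Subgroup H) ≤ (conj g (K : Subgroup G)).comap ι) :
    MH.obj V →ₗ[R] MG.obj K :=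
  MG.push g (L := ΥG.conjLevel g K) (K := K) le_rfl ∘ₗ i.map (K := ΥG.conjLevel g K) hV

/-- Any level `L` with `V ⊆ L ⊆ g K g⁻¹` computes the twisted pushforward. -/
theorem push_map {V : ΥH} {g : G} {K L : ΥG} (hL : (L : Subgroup G) ≤ conj g K)
    (hVL : (V : Subgroup H) ≤ (L : Subgroup G).comap ι) (x : MH.obj V) :
    MG.push g hL (i.map hVL x) = i.twist V g K (hVL.trans fun _ h => hL h) x := by
  have h1 := i.map_push 1 hVL (U := V) (K := ΥG.conjLevel g K) (hVL.trans fun _ h => hL h)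
    (le_conj_one le_rfl) (by rw [map_one, conj_one]; exact hL) x
  rw [MH.push_one] at h1
  rw [twist, LinearMap.comp_apply, h1, MG.push_push (k := g) _ _ (by rw [map_one, one_mul]) hL]

/-- The twisted pushforward at `ι(h) g' k` is the one at `g'` composed with `[h]_*`. -/
theorem twist_push {V V' : ΥH} {g g' : G} {K : ΥG}
    (hV : (V : Subgroup H) ≤ (conj g (K : Subgroup G)).comap ι)
    (hV' : (V' : Subgroup H) ≤ (conj g' (K : Subgroup G)).comap ι) {h : H}
    (hh : (V : Subgroup H) ≤ conj h V') {k : G} (hk : k ∈ (K : Subgroup G))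
    (hg : g = ι h * g' * k) (x : MH.obj V) :
    i.twist V g K hV x = i.twist V' g' K hV' (MH.push h hh x) := by
  have e : conj g (K : Subgroup G) = conj (ι h * g') K := by
    rw [hg, conj_mul, conj_of_mem hk]
  have e' : (ΥG.conjLevel g K : Subgroup G) ≤ conj (ι h) (ΥG.conjLevel g' K) :=
    (e.trans (conj_mul _ _ _)).le
  rw [twist, twist, LinearMap.comp_apply, LinearMap.comp_apply,
    i.map_push h (L := ΥG.conjLevel g K) hV _ hh e',
    MG.push_push _ _ rfl (L' := ΥG.conjLevel g K) (by rw [← e]),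
    ← MG.push_push (g := k) (K := K) (L := K) (h := ι h * g') (L' := ΥG.conjLevel g K)
      (by rw [← e]) (conj_of_mem hk).ge hg]
  exact MG.push_of_mem k hk _ _

theorem push_twist {V : ΥH} {g : G} {K K' : ΥG}
    (hV : (V : Subgroup H) ≤ (conj g (K : Subgroup G)).comap ι)
    (h : (K : Subgroup G) ≤ K') (x : MH.obj V) :
    MG.push 1 (le_conj_one h) (i.twist V g K hV x) =
      i.twist V g K' (hV.trans fun _ hx => h hx) x := by
  rw [twist, LinearMap.comp_apply, MG.push_push (L' := ΥG.conjLevel g K) _ _ (mul_one g).symm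
    (conj_mono g h), push_map]

/-- The twisted pushforward only depends on the subgroup at which a restriction is taken. -/
theorem twist_pull_congr {V A B : ΥH} (e : A = B) {g : G} {K : ΥG}
    (hA : (A : Subgroup H) ≤ (conj g (K : Subgroup G)).comap ι)
    (hB : (B : Subgroup H) ≤ (conj g (K : Subgroup G)).comap ι)
    (hAV : (A : Subgroup H) ≤ V) (hBV : (B : Subgroup H) ≤ V) (x : MH.obj V) :
    i.twist A g K hA (MH.pull 1 (le_conj_one hAV) x) =
      i.twist B g K hB (MH.pull 1 (le_conj_one hBV) x) := by
  subst e; rfl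

variable {i}

/-- A single Hecke correspondence applied to a twisted pushforward: the Mackey formula decomposes
it over the `V`-orbits of the cosets in `g K σ K / K`. -/
theorem IsMackey.hecke_twist {hΥ : ∀ K ∈ ΥG, K.comap ι ∈ ΥH} (hi : i.IsMackey hΥ)
    {V : ΥH} {g : G} {K : ΥG} (hV : (V : Subgroup H) ≤ (conj g (K : Subgroup G)).comap ι)
    (x : MH.obj V) (σ : G) {J : Type*} [Fintype J] (γ : J → G)
    (hmem : ∀ j, ∃ k ∈ (K : Subgroup G), ∃ k' ∈ (K : Subgroup G), γ j = g * k * σ * k')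
    (hγ : ∀ k ∈ (K : Subgroup G), ∀ k' ∈ (K : Subgroup G), ∃! j, ∃ u ∈ (V : Subgroup H),
      ∃ b ∈ (K : Subgroup G), g * k * σ * k' = ι u * γ j * b) :
    MG.hecke K σ⁻¹ K (i.twist V g K hV x) =
      ∑ j, i.twist (pullLevel ι hΥ V (γ j) K) (γ j) K inf_le_right
        (MH.pull 1 (L := pullLevel ι hΥ V (γ j) K) (K := V) (le_conj_one inf_le_left) x) := by
  classical
  choose κ hκ k' hk' hγκ using hmem
  -- The double cosets `V g K σ K / K` correspond to `V \ g K g⁻¹ / L` with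
  -- `L = g K g⁻¹ ∩ (g σ) K (g σ)⁻¹`, and `γ j` to `τ j = γ j k'⁻¹ (g σ)⁻¹`.
  let τ : J → G := fun j => g * κ j * g⁻¹
  have hτ : ∀ j, τ j ∈ conj g (K : Subgroup G) := fun j => by
    simpa [τ, mem_conj, mul_assoc] using hκ j
  have hγτ : ∀ j, γ j = τ j * (g * σ) * k' j := fun j => by
    rw [hγκ]; simp [τ, mul_assoc]
  let L : ΥG := ΥG.infLevel (ΥG.conjLevel g K) (ΥG.conjLevel (g * σ) K)
  have hL : (L : Subgroup G) ≤ ΥG.conjLevel g K := inf_le_left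
  have hinj : Function.Injective τ := by
    intro a b hab
    obtain ⟨j, -, hj⟩ := hγ (κ a) (hκ a) (k' a) (hk' a)
    refine (hj a ⟨1, one_mem _, 1, one_mem _, by rw [← hγκ]; simp⟩).trans
      (hj b ⟨1, one_mem _, (k' b)⁻¹ * k' a, mul_mem (inv_mem (hk' b)) (hk' a), ?_⟩).symm
    rw [← hγκ, hγτ a, hγτ b, hab]
    simp [mul_assoc]
  have hT : IsDoubleCosetReps ((V : Subgroup H).map ι) (ΥG.conjLevel g K : Subgroup G) L
      (Finset.univ.image τ) := by
    refine ⟨fun t ht => ?_, fun c hc => ?_⟩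
    · obtain ⟨j, -, rfl⟩ := Finset.mem_image.1 ht
      exact hτ j
    · have hc' : g⁻¹ * c * g ∈ (K : Subgroup G) := hc
      have ec : g * (g⁻¹ * c * g) * σ * 1 = c * (g * σ) := by simp [mul_assoc]
      obtain ⟨j, ⟨u, hu, b, hb, e⟩, huniq⟩ := hγ _ hc' 1 (one_mem _)
      rw [ec] at e
      refine ⟨τ j, ⟨Finset.mem_image_of_mem _ (Finset.mem_univ j), ι u, ⟨u, hu, rfl⟩,
        (g * σ) * (k' j * b) * (g * σ)⁻¹, ⟨?_, ?_⟩, ?_⟩, ?_⟩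
      · have e2 : (g * σ) * (k' j * b) * (g * σ)⁻¹ = (τ j)⁻¹ * (ι u)⁻¹ * c := by
          rw [hγτ] at e
          have : c = ι u * (τ j * (g * σ) * k' j) * b * (g * σ)⁻¹ := by rw [← e]; group
          rw [this]; group
        rw [e2]
        exact Subgroup.mul_mem _ (Subgroup.mul_mem _ (Subgroup.inv_mem _ (hτ j))
          (Subgroup.inv_mem _ (hV hu))) hc
      · have := mul_mem (hk' j) hb
        change (g * σ)⁻¹ * ((g * σ) * (k' j * b) * (g * σ)⁻¹) * (g * σ) ∈ (K : Subgroup G)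
        simpa [mul_assoc] using this
      · rw [hγτ] at e
        have : c = ι u * (τ j * (g * σ) * k' j) * b * (g * σ)⁻¹ := by rw [← e]; group
        conv_lhs => rw [this]
        group
      · rintro t ⟨ht, _, ⟨u', hu', rfl⟩, b', ⟨-, hb'⟩, e'⟩
        obtain ⟨j', -, rfl⟩ := Finset.mem_image.1 ht
        have hb'' : (g * σ)⁻¹ * b' * (g * σ) ∈ (K : Subgroup G) := hb'
        rw [huniq j' ⟨u', hu', (k' j')⁻¹ * ((g * σ)⁻¹ * b' * (g * σ)),
          mul_mem (inv_mem (hk' j')) hb'', ?_⟩]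
        rw [ec, hγτ, e']
        group
  have hmack := hi V (ΥG.conjLevel g K) L hV hL _ hT x
  rw [Finset.sum_image hinj.injOn] at hmack
  let L' : ΥG := ΥG.infLevel K (ΥG.conjLevel σ⁻¹ K)
  have eL : (L' : Subgroup G) = conj (σ⁻¹ * g⁻¹) L := by
    change (K : Subgroup G) ⊓ conj σ⁻¹ K = conj (σ⁻¹ * g⁻¹) (conj g K ⊓ conj (g * σ) K)
    rw [conj_inf, ← conj_mul, ← conj_mul, inf_comm]
    congr 1
    · simp
    · rw [← mul_inv_rev, inv_mul_cancel, conj_one]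
  have eg : (K : Subgroup G) = conj g⁻¹ (ΥG.conjLevel g K) := (conj_inv_conj g _).symm
  have hLK : (L : Subgroup G) ≤ conj (g * σ) K := inf_le_right
  -- The Hecke correspondence is moved from the level `K` to the level `g K g⁻¹`.
  have hmove : ∀ z : MG.obj (ΥG.conjLevel g K),
      MG.hecke K σ⁻¹ K (MG.push g (L := ΥG.conjLevel g K) (K := K) le_rfl z) =
        MG.push (g * σ) hLK (MG.pull 1 (le_conj_one hL) z) := by
    intro z
    have h1 : MG.push g (L := ΥG.conjLevel g K) (K := K) le_rfl z = MG.pull g⁻¹ eg.le z := by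
      rw [MG.pull_eq_push g⁻¹ eg]
      exact MG.push_congr (inv_inv g).symm _ _ _
    have h2 : (L' : Subgroup G) ≤ conj (σ⁻¹ * g⁻¹) (ΥG.conjLevel g K) := by
      rw [eL]; exact conj_mono _ hL
    rw [h1, RIC.hecke, LinearMap.comp_apply, MG.pull_pull (L' := L') _ _ rfl h2,
      ← MG.pull_pull (h := σ⁻¹ * g⁻¹) (g := 1) (L := L) eL.le (le_conj_one hL) (mul_one _).symm,
      MG.pull_eq_push _ eL, MG.push_push (K := K) _ _ _ hLK]
    simp
  rw [twist, LinearMap.comp_apply, hmove, hmack, map_sum]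
  refine Finset.sum_congr rfl fun j _ => ?_
  rw [MG.push_push (k := τ j * (g * σ)) _ _ rfl (by rw [conj_mul]; exact conj_mono _ hLK), push_map]
  have elev : pullLevel ι hΥ V (τ j) L = pullLevel ι hΥ V (γ j) K := by
    refine Subtype.ext ?_
    change (V : Subgroup H) ⊓ (conj (τ j) (conj g K ⊓ conj (g * σ) K)).comap ι =
      (V : Subgroup H) ⊓ (conj (γ j) (K : Subgroup G)).comap ι
    rw [conj_inf, conj_of_mem (hτ j), ← conj_mul, Subgroup.comap_inf, ← inf_assoc, inf_eq_left.2 hV,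
      hγτ, conj_mul _ (k' j), conj_of_mem (hk' j)]
  have hle1 : ((pullLevel ι hΥ V (τ j) L : ΥH) : Subgroup H) ≤
      conj 1 (pullLevel ι hΥ V (γ j) K) := by
    rw [elev, conj_one]
  rw [i.twist_push (V' := pullLevel ι hΥ V (γ j) K) (g' := γ j) _ inf_le_right (h := 1) hle1
    (inv_mem (hk' j)) (by rw [hγτ, map_one]; simp [mul_assoc])]
  congr 1
  exact MH.push_pull_of_eq elev inf_le_left inf_le_left _ x

/-- The action of a Hecke operator `f` on a twisted pushforward, as a sum over representatives of
the `V`-orbits of the cosets `γ K` with `f(g⁻¹ γ) ≠ 0`. -/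
theorem IsMackey.heckeCov_twist {hΥ : ∀ K ∈ ΥG, K.comap ι ∈ ΥH} (hi : i.IsMackey hΥ)
    {V : ΥH} {g : G} {K : ΥG} (hV : (V : Subgroup H) ≤ (conj g (K : Subgroup G)).comap ι)
    (x : MH.obj V) (f : G → R) (hfl : ∀ k ∈ (K : Subgroup G), ∀ a, f (k * a) = f a)
    (hfr : ∀ k ∈ (K : Subgroup G), ∀ a, f (a * k) = f a) {J : Type*} [Fintype J] (γ : J → G)
    (hγ : ∀ γ', f (g⁻¹ * γ') ≠ 0 → ∃! j, ∃ u ∈ (V : Subgroup H),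
      ∃ b ∈ (K : Subgroup G), γ' = ι u * γ j * b) :
    MG.heckeCov K f (i.twist V g K hV x) =
      ∑ j, f (g⁻¹ * γ j) • i.twist (pullLevel ι hΥ V (γ j) K) (γ j) K inf_le_right
        (MH.pull 1 (L := pullLevel ι hΥ V (γ j) K) (K := V) (le_conj_one inf_le_left) x) := by
  classical
  let p : J → DoubleCoset.Quotient ((K : Subgroup G) : Set G) ((K : Subgroup G) : Set G) :=
    fun j => DoubleCoset.mk K K (g⁻¹ * γ j)
  have hout : ∀ a : G, f (Quotient.out (DoubleCoset.mk (K : Subgroup G) K a)) = f a := by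
    intro a
    obtain ⟨k, k', hk, hk', e⟩ := DoubleCoset.mk_out_eq_mul (K : Subgroup G) K a
    have e' : (Quotient.out (DoubleCoset.mk (K : Subgroup G) K a) : G) = k * a * k' := e
    rw [e', hfr _ hk', hfl _ hk]
  have hconj : ∀ u ∈ (V : Subgroup H), g⁻¹ * ι u * g ∈ (K : Subgroup G) := fun u hu => hV hu
  -- The sum over `j` is grouped according to the double coset `K g⁻¹ γ j K`.
  obtain ⟨S, hS⟩ : ∃ S : Finset (DoubleCoset.Quotient ((K : Subgroup G) : Set G)
      ((K : Subgroup G) : Set G)), ∀ j, p j ∈ S :=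
    ⟨Finset.univ.image p, fun j => Finset.mem_image_of_mem p (Finset.mem_univ j)⟩
  have hp : ∀ q, f (Quotient.out q) ≠ 0 → q ∈ S := by
    intro q hq
    obtain ⟨j, ⟨u, hu, b, hb, e⟩, -⟩ := hγ (g * Quotient.out q) (by rwa [inv_mul_cancel_left])
    suffices h : p j = q from h ▸ hS j
    have hq' : DoubleCoset.mk (K : Subgroup G) K (Quotient.out q) = q := DoubleCoset.out_eq' _ _ q
    rw [← hq']
    refine (DoubleCoset.eq _ _ _ _).2 ⟨_, hconj u hu, b, hb, ?_⟩
    rw [← inv_mul_cancel_left g (Quotient.out q : G), e]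
    group
  rw [RIC.heckeCov, finsum_eq_sum_of_support_subset (s := S) _ (fun q hq =>
    hp q fun h0 => hq (by simp only [h0, zero_smul])), LinearMap.sum_apply,
    ← Finset.sum_fiberwise_of_maps_to (s := Finset.univ) (t := S) (g := p)
      fun j _ => hS j]
  refine Finset.sum_congr rfl fun q _ => ?_
  have hpf : ∀ j, p j = q → f (g⁻¹ * γ j) = f (Quotient.out q) := by
    rintro j rfl
    exact (hout _).symm
  rw [Finset.sum_congr rfl fun j hj => by rw [hpf j (Finset.mem_filter.1 hj).2],
    ← Finset.smul_sum, LinearMap.smul_apply]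
  by_cases h0 : f (Quotient.out q) = 0
  · rw [h0, zero_smul, zero_smul]
  congr 1
  set σ : G := Quotient.out q with hσ
  have hσq : DoubleCoset.mk (K : Subgroup G) K σ = q := DoubleCoset.out_eq' _ _ q
  have hmem : ∀ j : {j // p j = q}, ∃ k ∈ (K : Subgroup G), ∃ k' ∈ (K : Subgroup G),
      γ j = g * k * σ * k' := by
    rintro ⟨j, hj⟩
    obtain ⟨k, hk, k', hk', e⟩ := (DoubleCoset.eq _ _ _ _).1 (hσq.trans hj.symm)
    refine ⟨k, hk, k', hk', ?_⟩
    rw [mul_assoc g, mul_assoc g, ← e, mul_inv_cancel_left]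
  rw [hi.hecke_twist hV x σ (fun j : {j // p j = q} => γ j) hmem]
  · refine (Finset.sum_subtype (Finset.univ.filter fun j => p j = q) (fun j => ?_)
      (fun j => i.twist (pullLevel ι hΥ V (γ j) K) (γ j) K inf_le_right
        (MH.pull 1 (L := pullLevel ι hΥ V (γ j) K) (K := V) (le_conj_one inf_le_left) x))).symm
    rw [Finset.mem_filter, and_iff_right (Finset.mem_univ j)]
  · intro k hk k' hk'
    have hne : f (g⁻¹ * (g * k * σ * k')) ≠ 0 := by
      have : g⁻¹ * (g * k * σ * k') = k * σ * k' := by group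
      rw [this, hfr _ hk', hfl _ hk]
      exact h0
    obtain ⟨j, ⟨u, hu, b, hb, e⟩, huniq⟩ := hγ _ hne
    have hj : p j = q := by
      rw [← hσq]
      refine ((DoubleCoset.eq _ _ _ _).2 ⟨k⁻¹ * (g⁻¹ * ι u * g), mul_mem (inv_mem hk) (hconj u hu),
        b * k'⁻¹, mul_mem hb (inv_mem hk'), ?_⟩)
      have : σ = k⁻¹ * g⁻¹ * (g * k * σ * k') * k'⁻¹ := by group
      rw [this, e]
      group
    refine ⟨⟨j, hj⟩, ⟨u, hu, b, hb, e⟩, ?_⟩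
    rintro ⟨j', hj'⟩ h
    exact Subtype.ext (huniq j' h)

end Pushforward

/-! ### Multilinear substitution and operations on cells -/

section Substitution

variable {I : Type*} [DecidableEq I] {X : I → Type*} {M : Type*}

/-- Replace the components at the places in `S` of a family. -/
def overwrite (S : Finset I) (p : ∀ v ∈ S, X v) (c : ∀ v, X v) (v : I) : X v :=
  if h : v ∈ S then p v h else c v

theorem overwrite_of_mem {S : Finset I} (p : ∀ v ∈ S, X v) (c : ∀ v, X v) {v : I} (h : v ∈ S) :
    overwrite S p c v = p v h := dif_pos h

theorem overwrite_of_notMem {S : Finset I} (p : ∀ v ∈ S, X v) (c : ∀ v, X v) {v : I} (h : v ∉ S) :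
    overwrite S p c v = c v := dif_neg h

variable [AddCommMonoid M]

/-- The value at the family `c` of a function `F` of families, extended multilinearly, with the
component at each `v ∈ S` replaced by the formal sum of the `a v j`. -/
def substSum {A : I → Type*} [∀ v, Fintype (A v)] (S : Finset I) (a : ∀ v, A v → X v)
    (F : (∀ v, X v) → M) (c : ∀ v, X v) : M :=
  ∑ p ∈ S.pi fun v => (Finset.univ : Finset (A v)), F (overwrite S (fun v h => a v (p v h)) c)

variable {A B : I → Type*} [∀ v, Fintype (A v)] [∀ v, Fintype (B v)]

theorem substSum_empty (a : ∀ v, A v → X v) (F : (∀ v, X v) → M) (c : ∀ v, X v) :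
    substSum ∅ a F c = F c := by
  rw [substSum, Finset.pi_empty, Finset.sum_singleton]
  congr 1

theorem substSum_insert (a : ∀ v, A v → X v) (F : (∀ v, X v) → M) (c : ∀ v, X v) {S : Finset I}
    {v : I} (hv : v ∉ S) :
    substSum (insert v S) a F c = ∑ j, substSum S a F (Function.update c v (a v j)) := by
  classical
  have hdisj : ((Finset.univ : Finset (A v)) : Set (A v)).PairwiseDisjoint fun j =>
      (S.pi fun v => (Finset.univ : Finset (A v))).image (Finset.Pi.cons S v j) := by
    intro x _ y _ hxy
    simp only [Function.onFun, Finset.disjoint_iff_ne, Finset.mem_image]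
    rintro _ ⟨p₂, _, rfl⟩ _ ⟨p₃, _, rfl⟩ eq
    have := congr_fun (congr_fun eq v) (Finset.mem_insert_self v S)
    rw [Finset.Pi.cons_same, Finset.Pi.cons_same] at this
    exact hxy this
  rw [substSum, Finset.pi_insert hv, Finset.sum_biUnion hdisj]
  refine Finset.sum_congr rfl fun j _ => ?_
  rw [Finset.sum_image fun p₁ _ p₂ _ h => Finset.Pi.cons_injective hv h, substSum]
  refine Finset.sum_congr rfl fun p _ => congrArg F (funext fun w => ?_)
  rcases eq_or_ne w v with rfl | hw
  · rw [overwrite_of_mem _ _ (Finset.mem_insert_self w S), overwrite_of_notMem _ _ hv,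
      Finset.Pi.cons_same, Function.update_self]
  · by_cases hwS : w ∈ S
    · rw [overwrite_of_mem _ _ (Finset.mem_insert_of_mem hwS), overwrite_of_mem _ _ hwS,
        Finset.Pi.cons_ne hw.symm]
    · rw [overwrite_of_notMem _ _ (by simp [hw, hwS]), overwrite_of_notMem _ _ hwS,
        Function.update_of_ne hw]

theorem overwrite_update {S : Finset I} (p : ∀ v ∈ S, X v) (c : ∀ v, X v) {v : I} (hv : v ∉ S)
    (z : X v) : overwrite S p (Function.update c v z) = Function.update (overwrite S p c) v z := by
  funext w
  rcases eq_or_ne w v with rfl | hw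
  · rw [overwrite_of_notMem _ _ hv, Function.update_self, Function.update_self]
  · rw [Function.update_of_ne hw]
    simp only [overwrite, Function.update_of_ne hw]

theorem substSum_update (a : ∀ v, A v → X v) (F : (∀ v, X v) → M) (c : ∀ v, X v) {S : Finset I}
    {v : I} (hv : v ∉ S) (z : X v) :
    substSum S a F (Function.update c v z) =
      substSum S a (fun c' => F (Function.update c' v z)) c := by
  simp only [substSum, overwrite_update _ _ hv]

theorem substSum_union (a : ∀ v, A v → X v) (F : (∀ v, X v) → M) {S T : Finset I}
    (hST : Disjoint S T) (c : ∀ v, X v) :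
    substSum (S ∪ T) a F c = substSum S a (substSum T a F) c := by
  induction S using Finset.induction_on generalizing c with
  | empty => rw [Finset.empty_union, substSum_empty]
  | insert v S hv ih =>
    rw [Finset.disjoint_insert_left] at hST
    rw [Finset.insert_union, substSum_insert _ _ _ (by simp [hv, hST.1]), substSum_insert _ _ _ hv]
    exact Finset.sum_congr rfl fun j _ => ih hST.2 _

/-- If two formal sums agree at each single place of `S`, then they agree at all these places
together. -/
theorem substSum_congr (a : ∀ v, A v → X v) (b : ∀ v, B v → X v) (F : (∀ v, X v) → M)
    (S : Finset I) (h : ∀ v ∈ S, ∀ c : ∀ v, X v,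
      ∑ j, F (Function.update c v (a v j)) = ∑ j, F (Function.update c v (b v j)))
    (c : ∀ v, X v) : substSum S a F c = substSum S b F c := by
  induction S using Finset.induction_on generalizing c with
  | empty => rw [substSum_empty, substSum_empty]
  | insert v S hv ih =>
    rw [substSum_insert _ _ _ hv, substSum_insert _ _ _ hv]
    simp_rw [ih fun w hw => h w (Finset.mem_insert_of_mem hw)]
    simp_rw [substSum_update _ _ _ hv, substSum]
    rw [Finset.sum_comm, Finset.sum_comm (s := (Finset.univ : Finset (B v)))]
    exact Finset.sum_congr rfl fun p _ => h v (Finset.mem_insert_self v S) _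

theorem map_substSum {M' E : Type*} [AddCommMonoid M'] [FunLike E M M'] [AddMonoidHomClass E M M']
    (e : E) (a : ∀ v, A v → X v) (F : (∀ v, X v) → M) (S : Finset I) (c : ∀ v, X v) :
    e (substSum S a F c) = substSum S a (fun c' => e (F c')) c := map_sum e _ _

end Substitution

section CellOps

variable {O : Type*} [CommRing O] {H G : Type*} [Group H] [TopologicalSpace H] [Group G]
  {ΥH : LevelSystem H} {ι : H →* G} {N : RIC O ΥH} {K L : Subgroup G}

/-- The cell with class multiplied by `r`. -/
def Cell.scale (c : Cell ι N L) (r : O) : Cell ι N L := c.withX (r • c.x)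

theorem Cell.retract_scale (hW : ∀ g : G, (conj g K).comap ι ∈ ΥH) (c : Cell ι N K) (r : O)
    (α : G) : (c.scale r).retract hW α = r • c.retract hW α := by
  by_cases h : orbitRep ι K c.g = α
  · rw [Cell.retract, Cell.retract, dif_pos h, dif_pos (show orbitRep ι K (c.scale r).g = α from h)]
    exact map_smul _ _ _
  · rw [Cell.retract_of_ne hW _ h, Cell.retract_of_ne hW (c.scale r) h, smul_zero]

/-- The relation `(V, ι(h) g' k, x) ∼ (V', g', [h]_* x)` between cells. -/
def Cell.Moves (h : H) (k : G) (c c' : Cell ι N K) : Prop :=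
  k ∈ K ∧ c.g = ι h * c'.g * k ∧
    ∃ hle : (c.V : Subgroup H) ≤ conj h c'.V, c'.x = N.push h hle c.x

theorem Cell.moves_one (c : Cell ι N K) : c.Moves 1 1 c :=
  ⟨one_mem _, by simp, le_conj_one le_rfl, (N.push_one _ _).symm⟩

/-- `c'` is obtained from `c` by restriction to the stabiliser of the coset of `c'`. -/
def Cell.Restricts (c c' : Cell ι N K) : Prop :=
  (c'.V : Subgroup H) = (c.V : Subgroup H) ⊓ (conj c'.g K).comap ι ∧
    ∃ hle : (c'.V : Subgroup H) ≤ c.V, c'.x = N.pull 1 (le_conj_one hle) c.x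

theorem Cell.restricts_refl (c : Cell ι N K) : c.Restricts c :=
  ⟨(inf_eq_left.2 c.le).symm, le_rfl, (N.pull_one _ _).symm⟩

theorem IsInvariant.comp_mono {M : Type*} [AddCommGroup M] [Module O M] {F : Cell ι N K → M}
    (hF : IsInvariant F) (h : L ≤ K) : IsInvariant fun c : Cell ι N L => F (c.mono h) where
  add c x y := hF.add (c.mono h) x y
  smul c r x := hF.smul (c.mono h) r x
  push a k c c' hle hk hg hx := hF.push a k (c.mono h) (c'.mono h) hle (h hk) hg hx

theorem restrictCell_mono (e : K = L) (hW : ∀ g : G, (conj g K).comap ι ∈ ΥH)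
    (hW' : ∀ g : G, (conj g L).comap ι ∈ ΥH) {U : ΥH} (φ : N.obj U) (γ : G) :
    (restrictCell hW φ γ).mono e.le = restrictCell hW' φ γ := by
  subst e; rfl

theorem RIC.push_pull_comm (M : RIC O ΥH) {A A' B B' : ΥH} (eA : (A : Subgroup H) = A')
    (eB : (B : Subgroup H) = B') {h : H} (hAB : (A : Subgroup H) ≤ conj h B)
    (hAB' : (A' : Subgroup H) ≤ conj h B') (x : M.obj A') :
    M.push h hAB (M.pull 1 (le_conj_one eA.le) x) =
      M.pull 1 (le_conj_one eB.le) (M.push h hAB' x) := by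
  obtain rfl := Subtype.ext eA
  obtain rfl := Subtype.ext eB
  rw [M.pull_one, M.pull_one]

end CellOps

/-! ### Classes of families of cells -/

section UpdateFamily

variable {I : Type*} {M : I → Type*} {base : ∀ v, Set (M v)}

theorem updateFamily_same (x : Πʳ v, [M v, base v]) (v : I) (a : M v) :
    updateFamily x v a v = a := by
  classical
  exact (Function.update_self v a x.1)

theorem updateFamily_of_ne (x : Πʳ v, [M v, base v]) {v w : I} (a : M v) (h : w ≠ v) :
    updateFamily x v a w = x w := by
  classical
  exact (Function.update_of_ne h a x.1)

end UpdateFamily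

section HomLinear

variable {R : Type*} [CommRing R] {G : Type*} [Group G] [TopologicalSpace G]
  {Υ Υ' : LevelSystem G} {hΥ : ∀ K ∈ Υ, K ∈ Υ'} {N : RIC R Υ} {M : RIC R Υ'} (Ψ : RIC.Hom hΥ N M)

theorem RIC.Hom.app_add (K : Υ) (x y : N.obj K) :
    Ψ.app K (x + y) = Ψ.app K x + Ψ.app K y := map_add _ _ _

theorem RIC.Hom.app_smul (K : Υ) (r : R) (x : N.obj K) :
    Ψ.app K (r • x) = r • Ψ.app K x := map_smul _ _ _

end HomLinear

section Families

variable {I : Type*} {G H : I → Type*}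
  [∀ v, Group (G v)] [∀ v, TopologicalSpace (G v)] [∀ v, IsTopologicalGroup (G v)]
  [∀ v, Group (H v)] [∀ v, TopologicalSpace (H v)] {D : GluingData G H}
  {O : Type*} [CommRing O] {N : ∀ v, RIC O (D.levelsH v)}
  (φ : ∀ v, (N v).obj ⟨D.U v, D.U_mem v⟩) {ℓ : ∀ v, Subgroup (G v)}

/-- The cell is the base cell `(U_v, 1, φ_v)`, up to moving the point `1` within `K_v`. -/
def IsBaseCell (v : I) (z : Cell (D.ι v) (N v) (ℓ v)) : Prop :=
  z.g ∈ D.K v ∧ ∃ h : (z.V : Subgroup (H v)) = D.U v,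
    z.x = (N v).pull 1 (K := ⟨D.U v, D.U_mem v⟩) (le_conj_one h.le) (φ v)

/-- Almost all members of the family are base cells. -/
def IsAdmissible (c : ∀ v, Cell (D.ι v) (N v) (ℓ v)) : Prop :=
  ∀ᶠ v in cofinite, IsBaseCell φ v (c v)

variable {φ}

theorem IsAdmissible.congr {c c' : ∀ v, Cell (D.ι v) (N v) (ℓ v)} (hc : IsAdmissible φ c)
    (h : ∀ᶠ v in cofinite, c v = c' v) : IsAdmissible φ c' := by
  filter_upwards [hc, h] with v h1 h2
  rwa [← h2]

theorem isAdmissible_update [DecidableEq I] {c : ∀ v, Cell (D.ι v) (N v) (ℓ v)} {v : I}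
    {z : Cell (D.ι v) (N v) (ℓ v)} :
    IsAdmissible φ (Function.update c v z) ↔ IsAdmissible φ c := by
  have h : ∀ᶠ w in cofinite, Function.update c v z w = c w := by
    filter_upwards [(Set.finite_singleton v).compl_mem_cofinite] with w hw
    exact Function.update_of_ne hw _ _
  exact ⟨fun hc => hc.congr h, fun hc => hc.congr (h.mono fun _ => Eq.symm)⟩

namespace IsAdmissible

variable {c c' : ∀ v, Cell (D.ι v) (N v) (ℓ v)} (hc : IsAdmissible φ c) (hc' : IsAdmissible φ c')

/-- The level `∏ V_v` of a family of cells. -/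
def level : D.levelsHI :=
  ⟨prodSubgroup D.U fun v => (c v).V, fun v => (c v).V, fun v => (c v).V.2,
    hc.mono fun _ h => h.2.1, rfl⟩

/-- The point `(g_v)` of a family of cells. -/
def point : D.GG := ⟨fun v => (c v).g, hc.mono fun _ h => h.1⟩

theorem level_le :
    (hc.level : Subgroup D.HH) ≤ (conj hc.point (prodSubgroup D.K ℓ)).comap D.ιGlob :=
  fun _ hx v => (c v).le (hx v)

theorem comp_level (v : I) : comp (hc.level : Subgroup D.HH) v = (c v).V := comp_prodSubgroup _ _ v

/-- The classes `(x_v)` of a family of cells, transported along the equality of `V_v` with the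
component at `v` of `∏ V_v`. -/
def classes : Πʳ v,
    [(N v).obj ⟨comp (hc.level : Subgroup D.HH) v, LevelSystem.comp_mem hc.level.2 v⟩,
      RIC.basePoints N φ hc.level v] :=
  ⟨fun v => (N v).pull 1 (K := (c v).V) (le_conj_one (hc.comp_level v).le) (c v).x, by
    filter_upwards [hc] with v h
    obtain ⟨-, h1, h2⟩ := h
    refine ⟨(hc.comp_level v).trans h1, ?_⟩
    rw [h2, (N v).pull_pull _ _ (one_mul 1).symm]⟩

/-- The pure tensor `⊗ x_v` of a family of cells. -/
def tensor : (RIC.restrictedTensor N φ).obj hc.level := pureTensor O hc.classes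

theorem push_tensor {h : D.HH} {k : D.GG} (hm : ∀ v, (c v).Moves (h v) (k v) (c' v))
    (hle : (hc.level : Subgroup D.HH) ≤ conj h hc'.level) :
    (RIC.restrictedTensor N φ).push h hle hc.tensor = hc'.tensor := by
  refine (RestrictedTensor.map_pureTensor O _ _ _).trans (congrArg _ ?_)
  refine RestrictedProduct.ext _ _ fun v => ?_
  obtain ⟨-, -, hv, hx⟩ := hm v
  refine ((N v).push_pull_comm (hc.comp_level v) (hc'.comp_level v) _ hv _).trans ?_
  rw [← hx]
  rfl

theorem pull_tensor (hr : ∀ v, (c v).Restricts (c' v))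
    (hle : (hc'.level : Subgroup D.HH) ≤ conj 1 hc.level) :
    (RIC.restrictedTensor N φ).pull 1 hle hc.tensor = hc'.tensor := by
  refine (RestrictedTensor.map_pureTensor O _ _ _).trans (congrArg _ ?_)
  refine RestrictedProduct.ext _ _ fun v => ?_
  obtain ⟨-, hv, hx⟩ := hr v
  change (N v).pull 1 _ ((N v).pull 1 _ (c v).x) = (N v).pull 1 _ (c' v).x
  have e : (comp (hc'.level : Subgroup D.HH) v) ≤ conj 1 ((c v).V : Subgroup (H v)) := by
    rw [conj_one, hc'.comp_level]; exact hv
  rw [hx, (N v).pull_pull _ _ (one_mul 1).symm e, (N v).pull_pull _ _ (one_mul 1).symm e]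

end IsAdmissible

variable {ΥG : LevelSystem D.GG} {ΥH : LevelSystem D.HH} {MH : RIC O ΥH} {MG : RIC O ΥG}
  (i : Pushforward D.ιGlob MH MG) {hsub : ∀ A ∈ D.levelsHI, A ∈ ΥH}
  (Ψ : RIC.Hom hsub (RIC.restrictedTensor N φ) MH)

/-- The class in `M_G` of an admissible family of cells. -/
def IsAdmissible.toClass (hℓ : prodSubgroup D.K ℓ ∈ ΥG) {c : ∀ v, Cell (D.ι v) (N v) (ℓ v)}
    (hc : IsAdmissible φ c) : MG.obj ⟨prodSubgroup D.K ℓ, hℓ⟩ :=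
  i.twist ⟨hc.level, hsub _ hc.level.2⟩ hc.point ⟨prodSubgroup D.K ℓ, hℓ⟩ hc.level_le
    (Ψ.app _ hc.tensor)

open Classical in
/-- The class in `M_G` of a family of cells, set to be zero if the family is not admissible. -/
def famClass (hℓ : prodSubgroup D.K ℓ ∈ ΥG) (c : ∀ v, Cell (D.ι v) (N v) (ℓ v)) :
    MG.obj ⟨prodSubgroup D.K ℓ, hℓ⟩ :=
  if hc : IsAdmissible φ c then hc.toClass i Ψ hℓ else 0

theorem IsAdmissible.famClass_eq (hℓ : prodSubgroup D.K ℓ ∈ ΥG)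
    {c : ∀ v, Cell (D.ι v) (N v) (ℓ v)} (hc : IsAdmissible φ c) :
    famClass i Ψ hℓ c = hc.toClass i Ψ hℓ := dif_pos hc

theorem famClass_of_not (hℓ : prodSubgroup D.K ℓ ∈ ΥG)
    {c : ∀ v, Cell (D.ι v) (N v) (ℓ v)} (hc : ¬ IsAdmissible φ c) :
    famClass i Ψ hℓ c = 0 := dif_neg hc

/-- The class does not change if all members are moved simultaneously, by the components of elements
`h` and `k` of the restricted products. -/
theorem IsAdmissible.toClass_moves (hℓ : prodSubgroup D.K ℓ ∈ ΥG)
    {c c' : ∀ v, Cell (D.ι v) (N v) (ℓ v)} (hc : IsAdmissible φ c) (hc' : IsAdmissible φ c')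
    {h : D.HH} {k : D.GG} (hm : ∀ v, (c v).Moves (h v) (k v) (c' v)) :
    hc.toClass i Ψ hℓ = hc'.toClass i Ψ hℓ := by
  have hle : (hc.level : Subgroup D.HH) ≤ conj h hc'.level := fun x hx v => by
    obtain ⟨-, -, hv, -⟩ := hm v
    exact hv (hx v)
  have hk : k ∈ prodSubgroup D.K ℓ := fun v => (hm v).1
  have hg : hc.point = D.ιGlob h * hc'.point * k :=
    RestrictedProduct.ext _ _ fun v => (hm v).2.1
  rw [toClass, toClass, ← hc.push_tensor hc' hm hle, Ψ.app_push]
  exact i.twist_push _ _ _ hk hg _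

/-- Changing the class of one member changes one factor of the pure tensor. -/
theorem famClass_update_withX [DecidableEq I] (hℓ : prodSubgroup D.K ℓ ∈ ΥG)
    {c : ∀ v, Cell (D.ι v) (N v) (ℓ v)} (hc : IsAdmissible φ c) (v : I) (y : (N v).obj (c v).V) :
    famClass i Ψ hℓ (Function.update c v ((c v).withX y)) =
      i.twist ⟨hc.level, hsub _ hc.level.2⟩ hc.point ⟨prodSubgroup D.K ℓ, hℓ⟩ hc.level_le
        (Ψ.app _ (pureTensor O (updateFamily hc.classes v
          ((N v).pull 1 (K := (c v).V) (le_conj_one (hc.comp_level v).le) y)))) := by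
  have e : Function.update c v ((c v).withX y) =
      fun w => (c w).withX (Function.update (fun w => (c w).x) v y w) := by
    funext w
    rcases eq_or_ne w v with rfl | hw
    · rw [Function.update_self, Function.update_self]
    · rw [Function.update_of_ne hw, Function.update_of_ne hw]
      rfl
  have ha : IsAdmissible φ fun w => (c w).withX (Function.update (fun w => (c w).x) v y w) := by
    rw [← e]; exact isAdmissible_update.2 hc
  rw [e, ha.famClass_eq]
  have e2 : ha.classes = updateFamily hc.classes v
      ((N v).pull 1 (K := (c v).V) (le_conj_one (hc.comp_level v).le) y) := by
    refine RestrictedProduct.ext _ _ fun w => ?_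
    rcases eq_or_ne w v with rfl | hw
    · refine Eq.trans ?_ (updateFamily_same hc.classes w _).symm
      change (N w).pull 1 _ (Function.update (fun w => (c w).x) w y w) = _
      rw [Function.update_self]
      rfl
    · refine Eq.trans ?_ (updateFamily_of_ne hc.classes _ hw).symm
      change (N w).pull 1 _ (Function.update (fun w => (c w).x) v y w) = _
      rw [Function.update_of_ne hw]
      rfl
  exact congrArg (fun z => i.twist ⟨hc.level, hsub _ hc.level.2⟩ hc.point ⟨prodSubgroup D.K ℓ, hℓ⟩
    hc.level_le (Ψ.app _ (pureTensor O z))) e2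

/-- The class of a family is an invariant functional of each of its members. -/
theorem isInvariant_famClass [DecidableEq I] (hℓ : prodSubgroup D.K ℓ ∈ ΥG)
    (c : ∀ v, Cell (D.ι v) (N v) (ℓ v)) (v : I) :
    IsInvariant fun z => famClass i Ψ hℓ (Function.update c v z) := by
  -- Any cell at `v` may be assumed to be the member at `v` of the family.
  have hgen : ∀ z : Cell (D.ι v) (N v) (ℓ v), ∃ c₀ : ∀ v, Cell (D.ι v) (N v) (ℓ v), c₀ v = z ∧
      (IsAdmissible φ c₀ ↔ IsAdmissible φ c) ∧
      ∀ z', Function.update c v z' = Function.update c₀ v z' := fun z =>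
    ⟨Function.update c v z, Function.update_self .., isAdmissible_update,
      fun z' => (Function.update_idem ..).symm⟩
  refine ⟨fun z x y => ?_, fun z r x => ?_, fun h k z z' hle hk hg hx => ?_⟩
  · obtain ⟨c₀, rfl, hadm, hup⟩ := hgen z
    simp only [hup]
    by_cases hc : IsAdmissible φ c₀
    · simp only [famClass_update_withX i Ψ hℓ hc, map_add, RestrictedTensor.pureTensor_add]
      exact (congrArg _ (Ψ.app_add _ _ _)).trans (map_add _ _ _)
    · have hn : ∀ z, ¬ IsAdmissible φ (Function.update c₀ v z) := fun z h =>
        hc (isAdmissible_update.1 h)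
      simp only [famClass_of_not i Ψ hℓ (hn _), add_zero]
  · obtain ⟨c₀, rfl, hadm, hup⟩ := hgen z
    simp only [hup]
    by_cases hc : IsAdmissible φ c₀
    · simp only [famClass_update_withX i Ψ hℓ hc, map_smul, RestrictedTensor.pureTensor_smul]
      exact (congrArg _ (Ψ.app_smul _ _ _)).trans (map_smul _ _ _)
    · have hn : ∀ z, ¬ IsAdmissible φ (Function.update c₀ v z) := fun z h =>
        hc (isAdmissible_update.1 h)
      simp only [famClass_of_not i Ψ hℓ (hn _), smul_zero]
  · by_cases hc : IsAdmissible φ c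
    · have h1 : IsAdmissible φ (Function.update c v z) := isAdmissible_update.2 hc
      have h2 : IsAdmissible φ (Function.update c v z') := isAdmissible_update.2 hc
      rw [h1.famClass_eq, h2.famClass_eq]
      refine h1.toClass_moves i Ψ hℓ h2 (h := RestrictedProduct.mulSingle D.U v h)
        (k := RestrictedProduct.mulSingle D.K v k) fun w => ?_
      rcases eq_or_ne w v with rfl | hw
      · rw [Function.update_self, Function.update_self, RestrictedProduct.mulSingle_eq_same,
          RestrictedProduct.mulSingle_eq_same]
        exact ⟨hk, hg, hle, hx⟩
      · rw [Function.update_of_ne hw, Function.update_of_ne hw,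
          RestrictedProduct.mulSingle_eq_of_ne _ _ hw, RestrictedProduct.mulSingle_eq_of_ne _ _ hw]
        exact Cell.moves_one _
    · have hn : ∀ z, ¬ IsAdmissible φ (Function.update c v z) := fun z h =>
        hc (isAdmissible_update.1 h)
      rw [famClass_of_not i Ψ hℓ (hn _), famClass_of_not i Ψ hℓ (hn _)]

/-- The terms of the Mackey formula for the class of a family are classes of families of restricted
cells. -/
theorem IsAdmissible.twist_restrict {hΥ : ∀ A ∈ ΥG, A.comap D.ιGlob ∈ ΥH}
    (hℓ : prodSubgroup D.K ℓ ∈ ΥG)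
    {c c' : ∀ v, Cell (D.ι v) (N v) (ℓ v)} (hc : IsAdmissible φ c) (hc' : IsAdmissible φ c')
    (hr : ∀ v, (c v).Restricts (c' v)) :
    i.twist (pullLevel D.ιGlob hΥ ⟨hc.level, hsub _ hc.level.2⟩ hc'.point
        ⟨prodSubgroup D.K ℓ, hℓ⟩) hc'.point ⟨prodSubgroup D.K ℓ, hℓ⟩ inf_le_right
      (MH.pull 1 (L := pullLevel D.ιGlob hΥ ⟨hc.level, hsub _ hc.level.2⟩ hc'.point
        ⟨prodSubgroup D.K ℓ, hℓ⟩) (K := ⟨hc.level, hsub _ hc.level.2⟩) (le_conj_one inf_le_left)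
        (Ψ.app _ hc.tensor)) = hc'.toClass i Ψ hℓ := by
  have hle : (hc'.level : Subgroup D.HH) ≤ hc.level := fun x hx v => by
    obtain ⟨-, hv, -⟩ := hr v
    exact hv (hx v)
  have e : pullLevel D.ιGlob hΥ ⟨hc.level, hsub _ hc.level.2⟩ hc'.point
      ⟨prodSubgroup D.K ℓ, hℓ⟩ = ⟨hc'.level, hsub _ hc'.level.2⟩ := by
    refine Subtype.ext (Subgroup.ext fun x => ?_)
    have h1 : ∀ v, x v ∈ ((c' v).V : Subgroup (H v)) ↔ x v ∈ ((c v).V : Subgroup (H v)) ∧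
        x v ∈ (conj (c' v).g (ℓ v)).comap (D.ι v) := fun v => by
      rw [(hr v).1]; exact Iff.rfl
    exact (forall_and.symm.trans (forall_congr' fun v => (h1 v).symm))
  rw [toClass, ← hc.pull_tensor hc' hr (le_conj_one hle), Ψ.app_pull]
  exact i.twist_pull_congr e inf_le_right _ inf_le_left hle _

theorem push_famClass {ℓ' : ∀ v, Subgroup (G v)} (hℓ : prodSubgroup D.K ℓ ∈ ΥG)
    (hℓ' : prodSubgroup D.K ℓ' ∈ ΥG) (hle : ∀ v, ℓ v ≤ ℓ' v)
    (hle' : prodSubgroup D.K ℓ ≤ prodSubgroup D.K ℓ') (c : ∀ v, Cell (D.ι v) (N v) (ℓ v)) :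
    MG.push 1 (L := ⟨_, hℓ⟩) (K := ⟨_, hℓ'⟩) (le_conj_one hle') (famClass i Ψ hℓ c) =
      famClass i Ψ hℓ' fun v => (c v).mono (hle v) := by
  by_cases hc : IsAdmissible φ c
  · have hc' : IsAdmissible φ fun v => (c v).mono (hle v) := hc
    rw [hc.famClass_eq, hc'.famClass_eq]
    exact i.push_twist _ hle' _
  · have hc' : ¬ IsAdmissible φ fun v => (c v).mono (hle v) := hc
    rw [famClass_of_not i Ψ hℓ hc, famClass_of_not i Ψ hℓ' hc', map_zero]

/-- Scaling the members of a family at the places in `S`. -/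
theorem famClass_scale [DecidableEq I] (hℓ : prodSubgroup D.K ℓ ∈ ΥG)
    (c : ∀ v, Cell (D.ι v) (N v) (ℓ v)) (r : I → O) (S : Finset I) :
    famClass i Ψ hℓ (fun v => if v ∈ S then (c v).scale (r v) else c v) =
      (∏ v ∈ S, r v) • famClass i Ψ hℓ c := by
  induction S using Finset.induction_on with
  | empty => simp
  | insert v S hv ih =>
    set c' : ∀ v, Cell (D.ι v) (N v) (ℓ v) := fun v => if v ∈ S then (c v).scale (r v) else c v
    have e : (fun w => if w ∈ insert v S then (c w).scale (r w) else c w) =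
        Function.update c' v ((c v).scale (r v)) := by
      funext w
      rcases eq_or_ne w v with rfl | hw
      · rw [Function.update_self, if_pos (Finset.mem_insert_self _ _)]
      · rw [Function.update_of_ne hw]
        simp only [c', Finset.mem_insert, hw, false_or]
    have e' : Function.update c' v (c v) = c' := by
      conv_rhs => rw [← Function.update_eq_self v c']
      simp only [c', if_neg hv]
    rw [e, Finset.prod_insert hv, mul_smul, ← ih, ← e']
    simp only [Function.update_idem]
    exact (isInvariant_famClass i Ψ hℓ c' v).smul (c v) (r v) (c v).x

end Families

/-! ### Hecke operators on families of cells -/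

section RestrictCell

variable {O : Type*} [CommRing O] {H G : Type*} [Group H] [TopologicalSpace H] [Group G]
  {ΥH : LevelSystem H} {ι : H →* G} {N : RIC O ΥH} {K : Subgroup G}

theorem restrictCell_restricts (hW : ∀ g : G, (conj g K).comap ι ∈ ΥH) {U : ΥH}
    (hU : (U : Subgroup H) ≤ K.comap ι) (φ : N.obj U) (γ : G) :
    (restrictCell hW φ 1).Restricts (restrictCell hW φ γ) := by
  have h1 : (U : Subgroup H) ≤ (conj 1 K).comap ι := by rwa [conj_one]
  have hle : (U : Subgroup H) ⊓ (conj γ K).comap ι ≤ (U : Subgroup H) ⊓ (conj 1 K).comap ι :=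
    le_inf inf_le_left (inf_le_left.trans h1)
  refine ⟨?_, hle, ?_⟩
  · change (U : Subgroup H) ⊓ (conj γ K).comap ι =
      ((U : Subgroup H) ⊓ (conj 1 K).comap ι) ⊓ (conj γ K).comap ι
    rw [inf_eq_left.2 h1]
  · exact (N.pull_pull _ _ (one_mul 1).symm _ _).symm

end RestrictCell

namespace GluingData

variable {I : Type*} {G H : I → Type*}
  [∀ v, Group (G v)] [∀ v, TopologicalSpace (G v)]
  [∀ v, Group (H v)] [∀ v, TopologicalSpace (H v)] (D : GluingData G H)

theorem level_of_mem {ν : Finset I} {v : I} (h : v ∈ ν) : D.level ν v = D.L v := if_pos h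

theorem level_of_notMem {ν : Finset I} {v : I} (h : v ∉ ν) : D.level ν v = D.K v := if_neg h

theorem L_le_level (ν : Finset I) {v : I} (hv : v ∈ D.I') : D.L v ≤ D.level ν v := by
  by_cases h : v ∈ ν
  · rw [D.level_of_mem h]
  · rw [D.level_of_notMem h]; exact D.L_le v hv

theorem level_le_level {ν μ : Finset I} (h : ν ⊆ μ) (hμ : (μ : Set I) ⊆ D.I') (v : I) :
    D.level μ v ≤ D.level ν v := by
  by_cases hv : v ∈ μ
  · rw [D.level_of_mem hv]; exact D.L_le_level ν (hμ hv)
  · rw [D.level_of_notMem hv, D.level_of_notMem fun h' => hv (h h')]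

theorem tensorHecke_mul_left {R : Type*} [CommRing R] (𝔥 : ∀ v, HeckeElement R (D.K v))
    {ν lam : Finset I} (hd : ∀ v ∈ lam, v ∉ ν) {k : D.GG} (hk : k ∈ D.Kν ν) (a : D.GG) :
    D.tensorHecke 𝔥 ν lam (k * a) = D.tensorHecke 𝔥 ν lam a := by
  classical
  refine if_congr (forall₂_congr fun v _ => (D.level ν v).mul_mem_cancel_left (hk v))
    (Finset.prod_congr rfl fun v hv => (𝔥 v).left_inv _ ?_ _) rfl
  rw [← D.level_of_notMem (hd v hv)]
  exact hk v

theorem tensorHecke_mul_right {R : Type*} [CommRing R] (𝔥 : ∀ v, HeckeElement R (D.K v))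
    {ν lam : Finset I} (hd : ∀ v ∈ lam, v ∉ ν) {k : D.GG} (hk : k ∈ D.Kν ν) (a : D.GG) :
    D.tensorHecke 𝔥 ν lam (a * k) = D.tensorHecke 𝔥 ν lam a := by
  classical
  refine if_congr (forall₂_congr fun v _ => (D.level ν v).mul_mem_cancel_right (hk v))
    (Finset.prod_congr rfl fun v hv => (𝔥 v).right_inv _ ?_ _) rfl
  rw [← D.level_of_notMem (hd v hv)]
  exact hk v

variable [∀ v, IsTopologicalGroup (G v)]

theorem comap_conj_K_mem (v : I) (g : G v) : (conj g (D.K v)).comap (D.ι v) ∈ D.levelsH v :=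
  ⟨_, LevelSystem.Gen.conj g (Or.inl rfl), rfl⟩

theorem comap_conj_level_mem {ν : Finset I} (hν : (ν : Set I) ⊆ D.I') (v : I) (g : G v) :
    (conj g (D.level ν v)).comap (D.ι v) ∈ D.levelsH v := by
  refine ⟨_, LevelSystem.Gen.conj g ?_, rfl⟩
  by_cases h : v ∈ ν
  · exact Or.inr ⟨hν h, D.level_of_mem h⟩
  · exact Or.inl (D.level_of_notMem h)

end GluingData

section Gluing

variable {I : Type*} {G H : I → Type*}
  [∀ v, Group (G v)] [∀ v, TopologicalSpace (G v)] [∀ v, IsTopologicalGroup (G v)]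
  [∀ v, Group (H v)] [∀ v, TopologicalSpace (H v)] {D : GluingData G H}
  {O : Type*} [CommRing O] {N : ∀ v, RIC O (D.levelsH v)}
  (φ : ∀ v, (N v).obj ⟨D.U v, D.U_mem v⟩)

/-- The family of the cells attached to the `φ_v` at the trivial cosets, at level `K[ν]`. -/
def baseFamily {ν : Finset I} (hν : (ν : Set I) ⊆ D.I') (v : I) :
    Cell (D.ι v) (N v) (D.level ν v) :=
  restrictCell (D.comap_conj_level_mem hν v) (φ v) 1

/-- The cells which make up the Hecke operator `𝔥_v` applied to `φ_v`. -/
def heckeCell {ν : Finset I} (hν : (ν : Set I) ⊆ D.I') (𝔥 : ∀ v, HeckeElement O (D.K v)) (v : I)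
    (t : HeckeOrbit (D.ι v) (D.U v) (D.K v) (𝔥 v).toFun) : Cell (D.ι v) (N v) (D.level ν v) :=
  (restrictCell (D.comap_conj_level_mem hν v) (φ v) t.1.rep).scale ((𝔥 v).toFun t.1.rep)

theorem isAdmissible_baseFamily {ν : Finset I} (hν : (ν : Set I) ⊆ D.I') :
    IsAdmissible φ (baseFamily φ hν) := by
  filter_upwards [ν.finite_toSet.compl_mem_cofinite] with v hv
  refine ⟨one_mem _, ?_, rfl⟩
  change D.U v ⊓ (conj 1 (D.level ν v)).comap (D.ι v) = D.U v
  rw [conj_one, D.level_of_notMem hv, inf_idem]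

variable {φ} [DecidableEq I]

theorem isAdmissible_overwrite {ℓ : ∀ v, Subgroup (G v)} {c : ∀ v, Cell (D.ι v) (N v) (ℓ v)}
    (hc : IsAdmissible φ c) (S : Finset I) (p : ∀ v ∈ S, Cell (D.ι v) (N v) (ℓ v)) :
    IsAdmissible φ (overwrite S p c) :=
  hc.congr <| by
    filter_upwards [S.finite_toSet.compl_mem_cofinite] with v hv
    exact (overwrite_of_notMem p c hv).symm

variable {ΥG : LevelSystem D.GG} {ΥH : LevelSystem D.HH} {MH : RIC O ΥH} {MG : RIC O ΥG}
  {i : Pushforward D.ιGlob MH MG} {hsub : ∀ A ∈ D.levelsHI, A ∈ ΥH}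
  (Ψ : RIC.Hom hsub (RIC.restrictedTensor N φ) MH)

/-- The Hecke operator at the places in `lam` acts on the class of a family, which is the base
family at these places, by replacing the base cells by those of the local Hecke operators. -/
theorem IsAdmissible.heckeCov_famClass {hΥ : ∀ A ∈ ΥG, A.comap D.ιGlob ∈ ΥH} (hi : i.IsMackey hΥ)
    (𝔥 : ∀ v, HeckeElement O (D.K v))
    [∀ v, Fintype (HeckeOrbit (D.ι v) (D.U v) (D.K v) (𝔥 v).toFun)]
    {ν lam : Finset I} (hν : (ν : Set I) ⊆ D.I') (hd : ∀ v ∈ lam, v ∉ ν)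
    (hℓ : prodSubgroup D.K (D.level ν) ∈ ΥG) {c : ∀ v, Cell (D.ι v) (N v) (D.level ν v)}
    (hc : IsAdmissible φ c) (hb : ∀ v ∈ lam, c v = baseFamily φ hν v) :
    MG.heckeCov ⟨prodSubgroup D.K (D.level ν), hℓ⟩ (D.tensorHecke 𝔥 ν lam) (famClass i Ψ hℓ c) =
      substSum lam (heckeCell φ hν 𝔥) (famClass i Ψ hℓ) c := by
  have hKl : ∀ v ∈ lam, D.level ν v = D.K v := fun v hv => D.level_of_notMem (hd v hv)
  have hg1 : ∀ v ∈ lam, (c v).g = 1 := fun v hv => by rw [hb v hv]; rfl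
  have hVU : ∀ v ∈ lam, ((c v).V : Subgroup (H v)) = D.U v := fun v hv => by
    rw [hb v hv]
    change D.U v ⊓ (conj 1 (D.level ν v)).comap (D.ι v) = D.U v
    rw [conj_one, hKl v hv, inf_idem]
  -- The `V`-orbits of the cosets in the support are parametrised by the choices, for all `v ∈ lam`,
  -- of an element of `U_v \ G_v / K_v` at which `𝔥_v` does not vanish.
  let J := ↥(lam.pi fun v =>
    (Finset.univ : Finset (HeckeOrbit (D.ι v) (D.U v) (D.K v) (𝔥 v).toFun)))
  let d : J → ∀ v, Cell (D.ι v) (N v) (D.level ν v) := fun p =>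
    overwrite lam
      (fun v h => restrictCell (D.comap_conj_level_mem hν v) (φ v) (p.1 v h).1.rep) c
  have hdm : ∀ (p : J) (v) (h : v ∈ lam),
      d p v = restrictCell (D.comap_conj_level_mem hν v) (φ v) (p.1 v h).1.rep :=
    fun p v h => overwrite_of_mem _ _ h
  have hdn : ∀ (p : J) (v), v ∉ lam → d p v = c v := fun p v h => overwrite_of_notMem _ _ h
  have hda : ∀ p, IsAdmissible φ (d p) := fun p => isAdmissible_overwrite hc lam _
  have hpm : ∀ (p : J) (v) (h : v ∈ lam), (hda p).point v = (p.1 v h).1.rep := fun p v h => by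
    change (d p v).g = _
    rw [hdm p v h]; rfl
  have hpn : ∀ (p : J) (v), v ∉ lam → (hda p).point v = (c v).g := fun p v h => by
    change (d p v).g = _
    rw [hdn p v h]
  rw [hc.famClass_eq, IsAdmissible.toClass, hi.heckeCov_twist _ _ _
    (fun k hk => D.tensorHecke_mul_left 𝔥 hd hk) (fun k hk => D.tensorHecke_mul_right 𝔥 hd hk)
    (J := J) (fun p => (hda p).point)]
  · refine Eq.trans ?_ (Finset.sum_coe_sort _ _)
    refine Finset.sum_congr rfl fun p _ => ?_
    rw [hc.twist_restrict i Ψ hℓ (hda p), ← (hda p).famClass_eq]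
    · have e : D.tensorHecke 𝔥 ν lam (hc.point⁻¹ * (hda p).point) =
          ∏ v ∈ lam, (𝔥 v).toFun (d p v).g := by
        refine (if_pos fun v hv => ?_).trans (Finset.prod_congr rfl fun v hv => ?_)
        · change ((c v).g)⁻¹ * (hda p).point v ∈ _
          rw [hpn p v hv, inv_mul_cancel]
          exact one_mem _
        · change (𝔥 v).toFun (((c v).g)⁻¹ * (d p v).g) = _
          rw [hg1 v hv, inv_one, one_mul]
      rw [e, ← famClass_scale i Ψ hℓ (d p) (fun v => (𝔥 v).toFun (d p v).g)]
      refine congrArg _ (funext fun v => ?_)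
      by_cases hv : v ∈ lam
      · rw [if_pos hv, overwrite_of_mem _ _ hv, hdm p v hv]
        rfl
      · rw [if_neg hv, overwrite_of_notMem _ _ hv, hdn p v hv]
    · intro v
      by_cases hv : v ∈ lam
      · rw [hdm p v hv, hb v hv]
        refine restrictCell_restricts _ ?_ _ _
        rw [hKl v hv]
      · rw [hdn p v hv]
        exact Cell.restricts_refl _
  · intro γ' hγ'
    have hcond : ∀ v ∉ lam, ((c v).g)⁻¹ * γ' v ∈ D.level ν v := by
      by_contra h
      exact hγ' (if_neg h)
    have hprod : ∏ v ∈ lam, (𝔥 v).toFun ((c v).g⁻¹ * γ' v) ≠ 0 := by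
      intro h
      exact hγ' ((if_pos hcond).trans h)
    have hne : ∀ v ∈ lam, (𝔥 v).toFun (γ' v) ≠ 0 := fun v hv h =>
      hprod (Finset.prod_eq_zero hv (by rw [hg1 v hv, inv_one, one_mul, h]))
    choose u hu k hk huk using fun v => exists_rep_toDoubleCoset (D.ι v) (D.U v) (D.K v) (γ' v)
    let p : J := ⟨fun v hv => ⟨DoubleCoset.mk ((D.U v).map (D.ι v)) (D.K v) (γ' v), by
      rw [(𝔥 v).apply_rep le_rfl]; exact hne v hv⟩, Finset.mem_pi.2 fun _ _ => Finset.mem_univ _⟩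
    -- Off `lam` the coset of the family is unchanged up to `K[ν]`, so that `1` can be used there.
    let w : D.HH := ⟨fun v => if v ∈ lam then u v else 1, Eventually.of_forall fun v => by
      dsimp only
      split_ifs
      exacts [hu v, one_mem _]⟩
    refine ⟨p, ⟨w, fun v => ?_, (hda p).point⁻¹ * (D.ιGlob w)⁻¹ * γ', fun v => ?_, ?_⟩, ?_⟩
    · change (if v ∈ lam then u v else 1) ∈ ((c v).V : Subgroup (H v))
      split_ifs with hv
      · rw [hVU v hv]; exact hu v
      · exact one_mem _
    · change ((hda p).point v)⁻¹ * (D.ι v (if v ∈ lam then u v else 1))⁻¹ * γ' v ∈ D.level ν v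
      by_cases hv : v ∈ lam
      · rw [if_pos hv, hpm p v hv, hKl v hv, huk v]
        convert hk v using 1
        simp only [p]
        group
      · rw [if_neg hv, hpn p v hv, map_one, inv_one, mul_one]
        exact hcond v hv
    · group
    · rintro p' ⟨u', hu', b', hb', e⟩
      refine Subtype.ext (funext fun v => funext fun hv => Subtype.ext ?_)
      refine (mk_rep _).symm.trans ((DoubleCoset.eq _ _ _ _).2
        ⟨D.ι v (u' v), ⟨u' v, ?_, rfl⟩, b' v, ?_, ?_⟩)
      · have : u' v ∈ ((c v).V : Subgroup (H v)) := hu' v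
        rwa [hVU v hv] at this
      · have : b' v ∈ D.level ν v := hb' v
        rwa [hKl v hv] at this
      · rw [← hpm p' v hv]
        exact congrArg (fun z : D.GG => z v) e

end Gluing

/-! ### The glued classes -/

section Glued

variable {I : Type*} [DecidableEq I] {G H : I → Type*}
  [∀ v, Group (G v)] [∀ v, TopologicalSpace (G v)] [∀ v, IsTopologicalGroup (G v)]
  [∀ v, Group (H v)] [∀ v, TopologicalSpace (H v)] {D : GluingData G H}
  {O : Type*} [CommRing O] {N : ∀ v, RIC O (D.levelsH v)}
  {φ : ∀ v, (N v).obj ⟨D.U v, D.U_mem v⟩}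
  {ΥG : LevelSystem D.GG} {ΥH : LevelSystem D.HH} {MH : RIC O ΥH} {MG : RIC O ΥG}
  (i : Pushforward D.ιGlob MH MG) {hsub : ∀ A ∈ D.levelsHI, A ∈ ΥH}
  (Ψ : RIC.Hom hsub (RIC.restrictedTensor N φ) MH)
  {A : I → Type*} [∀ v, Fintype (A v)] (hA : ∀ v, A v → v ∈ D.I')
  (a : ∀ v, A v → Cell (D.ι v) (N v) (D.L v))

/-- The given cells of level `L_v`, seen at the component of `K[ν]` at `v`. -/
def zetaCell (ν : Finset I) (v : I) (j : A v) : Cell (D.ι v) (N v) (D.level ν v) :=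
  (a v j).mono (D.L_le_level ν (hA v j))

/-- The class of level `K[ν]` glued from the local cells of level `L_v` at the places `v ∈ ν`, and
from the base cells at the other places. -/
def gluedClass {ν : Finset I} (hν : (ν : Set I) ⊆ D.I')
    (hℓ : prodSubgroup D.K (D.level ν) ∈ ΥG) :
    MG.obj ⟨prodSubgroup D.K (D.level ν), hℓ⟩ :=
  substSum ν (zetaCell hA a ν) (famClass i Ψ hℓ) (baseFamily φ hν)

variable {i}

theorem gluedClass_empty (hν : ((∅ : Finset I) : Set I) ⊆ D.I')
    (hℓ : prodSubgroup D.K (D.level ∅) ∈ ΥG)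
    (hU : prodSubgroup D.U D.U ∈ ΥH)
    (hUle : prodSubgroup D.U D.U ≤ (prodSubgroup D.K (D.level ∅)).comap D.ιGlob) :
    gluedClass i Ψ hA a hν hℓ = i.map (U := ⟨_, hU⟩) (K := ⟨_, hℓ⟩) hUle
      (Ψ.app _ (RIC.baseTensor N φ)) := by
  have hb := isAdmissible_baseFamily φ hν
  have hV : ∀ v, ((baseFamily φ hν v).V : Subgroup (H v)) = D.U v := fun v => by
    change D.U v ⊓ (conj 1 (D.level ∅ v)).comap (D.ι v) = D.U v
    rw [conj_one, D.level_of_notMem (Finset.notMem_empty v), inf_idem]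
  have hlev : (hb.level : Subgroup D.HH) = prodSubgroup D.U D.U :=
    congrArg (prodSubgroup D.U) (funext hV)
  have ht : (RIC.restrictedTensor N φ).push 1 (K := ⟨prodSubgroup D.U D.U, D.U, D.U_mem,
      Eventually.of_forall fun _ => rfl, rfl⟩) (le_conj_one hlev.le) hb.tensor =
      RIC.baseTensor N φ := by
    refine (RestrictedTensor.map_pureTensor O _ _ _).trans (congrArg _ ?_)
    refine RestrictedProduct.ext _ _ fun v => ?_
    have e := (hb.comp_level v).trans (hV v)
    refine Eq.trans (congrArg _ ?_)
      ((N v).push_base (U := ⟨D.U v, D.U_mem v⟩) e (comp_prodSubgroup D.U D.U v)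
        (one_mem _) _ (φ v))
    exact (N v).pull_pull _ _ (one_mul 1).symm _ _
  rw [gluedClass, substSum_empty, hb.famClass_eq, IsAdmissible.toClass,
    i.twist_push (V' := ⟨_, hU⟩) (g' := 1) _ (by rw [conj_one]; exact hUle) (h := 1)
      (le_conj_one hlev.le) (one_mem _) (by rw [map_one, one_mul, one_mul]; rfl),
    ← i.push_map (le_conj_one le_rfl) hUle, MG.push_one]
  exact congrArg _ ((Ψ.app_push 1 (le_conj_one hlev.le) hb.tensor).symm.trans (congrArg _ ht))

/-- At a place `v ∉ ν`, replacing the base cell by the cells obtained from the zeta element amounts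
to applying the Hecke operator. -/
theorem sum_famClass_zetaCell (𝔥 : ∀ v, HeckeElement O (D.K v))
    [∀ v, Fintype (HeckeOrbit (D.ι v) (D.U v) (D.K v) (𝔥 v).toFun)]
    {ν : Finset I} (hν : (ν : Set I) ⊆ D.I') (hℓ : prodSubgroup D.K (D.level ν) ∈ ΥG) {v : I}
    (hv : v ∈ D.I') (hvν : v ∉ ν)
    (ha : ∀ α, ∑ j, ((a v j).mono (D.L_le v hv)).retract (D.comap_conj_K_mem v) α =
      ∑ t : HeckeOrbit (D.ι v) (D.U v) (D.K v) (𝔥 v).toFun, (𝔥 v).toFun t.1.rep •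
        (restrictCell (D.comap_conj_K_mem v) (φ v) t.1.rep).retract (D.comap_conj_K_mem v) α)
    (c : ∀ v, Cell (D.ι v) (N v) (D.level ν v)) :
    ∑ t, famClass i Ψ hℓ (Function.update c v (heckeCell φ hν 𝔥 v t)) =
      ∑ j, famClass i Ψ hℓ (Function.update c v (zetaCell hA a ν v j)) := by
  have e : D.K v = D.level ν v := (D.level_of_notMem hvν).symm
  have hF := (isInvariant_famClass i Ψ hℓ c v).comp_mono e.le
  have h := hF.sum_eq_sum (D.comap_conj_K_mem v)
    (fun t : HeckeOrbit (D.ι v) (D.U v) (D.K v) (𝔥 v).toFun =>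
      (restrictCell (D.comap_conj_K_mem v) (φ v) t.1.rep).scale ((𝔥 v).toFun t.1.rep))
    (fun j => (a v j).mono (D.L_le v hv)) fun α => by
      simp_rw [Cell.retract_scale]
      exact (ha α).symm
  refine Eq.trans (Finset.sum_congr rfl fun t _ => ?_) h
  rw [heckeCell, ← restrictCell_mono e (D.comap_conj_K_mem v)]
  rfl

/-- The Hecke operator at the places of `μ \ ν` inserts the cells of the zeta elements there. -/
theorem heckeCov_gluedClass {hΥ : ∀ A ∈ ΥG, A.comap D.ιGlob ∈ ΥH} (hi : i.IsMackey hΥ)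
    (𝔥 : ∀ v, HeckeElement O (D.K v))
    [∀ v, Fintype (HeckeOrbit (D.ι v) (D.U v) (D.K v) (𝔥 v).toFun)]
    (ha : ∀ v, ∀ hv : v ∈ D.I', ∀ α,
      ∑ j, ((a v j).mono (D.L_le v hv)).retract (D.comap_conj_K_mem v) α =
      ∑ t : HeckeOrbit (D.ι v) (D.U v) (D.K v) (𝔥 v).toFun, (𝔥 v).toFun t.1.rep •
        (restrictCell (D.comap_conj_K_mem v) (φ v) t.1.rep).retract (D.comap_conj_K_mem v) α)
    {ν μ : Finset I} (hν : (ν : Set I) ⊆ D.I') (hμ : (μ : Set I) ⊆ D.I') (h : ν ⊆ μ)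
    (hℓ : prodSubgroup D.K (D.level ν) ∈ ΥG) :
    MG.heckeCov ⟨prodSubgroup D.K (D.level ν), hℓ⟩ (D.tensorHecke 𝔥 ν (μ \ ν))
      (gluedClass i Ψ hA a hν hℓ) =
      substSum μ (zetaCell hA a ν) (famClass i Ψ hℓ) (baseFamily φ hν) := by
  have hd : ∀ v ∈ μ \ ν, v ∉ ν := fun v hv => (Finset.mem_sdiff.1 hv).2
  rw [gluedClass, map_substSum]
  conv_rhs => rw [← Finset.union_sdiff_of_subset h, substSum_union _ _ Finset.disjoint_sdiff]
  refine Finset.sum_congr rfl fun p _ => ?_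
  have hc := isAdmissible_overwrite (isAdmissible_baseFamily φ hν) ν
    fun v hv => zetaCell hA a ν v (p v hv)
  refine (hc.heckeCov_famClass Ψ hi 𝔥 hν hd hℓ fun v hv =>
    overwrite_of_notMem _ _ (hd v hv)).trans ?_
  exact substSum_congr _ _ _ _ (fun v hv c =>
    have hv' := hμ (Finset.mem_sdiff.1 hv).1
    sum_famClass_zetaCell Ψ hA a 𝔥 hν hℓ hv' (hd v hv) (ha v hv') c) _

theorem push_gluedClass {ν μ : Finset I} (hν : (ν : Set I) ⊆ D.I') (hμ : (μ : Set I) ⊆ D.I')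
    (h : ν ⊆ μ) (hℓ : prodSubgroup D.K (D.level ν) ∈ ΥG)
    (hℓ' : prodSubgroup D.K (D.level μ) ∈ ΥG)
    (hle : prodSubgroup D.K (D.level μ) ≤ prodSubgroup D.K (D.level ν)) :
    MG.push 1 (L := ⟨_, hℓ'⟩) (K := ⟨_, hℓ⟩) (le_conj_one hle) (gluedClass i Ψ hA a hμ hℓ') =
      substSum μ (zetaCell hA a ν) (famClass i Ψ hℓ) (baseFamily φ hν) := by
  rw [gluedClass, map_substSum]
  refine Finset.sum_congr rfl fun p _ => ?_
  refine (push_famClass i Ψ hℓ' hℓ (D.level_le_level h hμ) hle _).trans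
    (congrArg _ (funext fun v => ?_))
  by_cases hv : v ∈ μ
  · rw [overwrite_of_mem _ _ hv, overwrite_of_mem _ _ hv]
    rfl
  · rw [overwrite_of_notMem _ _ hv, overwrite_of_notMem _ _ hv]
    refine restrictCell_mono ?_ (D.comap_conj_level_mem hμ v) (D.comap_conj_level_mem hν v) _ _
    rw [D.level_of_notMem hv, D.level_of_notMem fun h' => hv (h h')]

end Glued

end

end ZetaGluing

theorem theorem3p16 {I : Type*} [DecidableEq I] {G H : I → Type*}
    [∀ v, Group (G v)] [∀ v, TopologicalSpace (G v)] [∀ v, LocallyProfinite (G v)]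
    [∀ v, Group (H v)] [∀ v, TopologicalSpace (H v)] [∀ v, LocallyProfinite (H v)]
    (hG : ∀ v, IsUnimodular (G v)) (hH : ∀ v, IsUnimodular (H v))
    (D : GluingData G H)
    {O : Type*} [CommRing O] [IsDomain O] {Φ : Type*} [Field Φ] [Algebra O Φ] [IsFractionRing O Φ]
    [CharZero Φ]
    (ΥG : LevelSystem D.GG) (hK : prodSubgroup D.K D.K ∈ ΥG) (hL : ∀ v ∈ D.I', D.Kν {v} ∈ ΥG)
    (ΥH : LevelSystem D.HH) (hΥ : ∀ A ∈ ΥG, A.comap D.ιGlob ∈ ΥH)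
    (MH : RIC O ΥH) (hMH : MH.IsCoMack) (MG : RIC O ΥG) (hMG : MG.IsCoMack)
    (i : Pushforward D.ιGlob MH MG) (hi : i.IsMackey hΥ)
    (xU : MH.obj ⟨prodSubgroup D.U D.U, D.prodU_mem ΥG hK ΥH hΥ⟩)
    (𝔥 : ∀ v, HeckeElement O (D.K v))
    (N : ∀ v, RIC O (D.levelsH v)) (hN : ∀ v, (N v).IsCoMack) (hNt : ∀ v, (N v).IsTorsionFree)
    (φ : ∀ v, (N v).obj ⟨D.U v, D.U_mem v⟩)
    (Ψ : RIC.Hom (D.levelsHI_subset ΥG hK hL ΥH hΥ) (RIC.restrictedTensor N φ) MH)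
    (hΨ : Ψ.app _ (RIC.baseTensor N φ) = xU)
    (hζ : ∀ v ∈ D.I', ∃ ζ : G v → ((N v).baseChange Φ).Completion,
      IsZetaElement (D.ι v) (N v) Φ ⟨D.U v, D.U_mem v⟩ (φ v) (𝔥 v) (D.L v) ζ) :
    ∃ y : ∀ ν : Finset I, (hν : (ν : Set I) ⊆ D.I') → MG.obj ⟨D.Kν ν, D.Kν_mem ΥG hK hL ν hν⟩,
      y ∅ (by simp) = i.map D.U_le xU ∧
      ∀ (ν μ : Finset I) (hν : (ν : Set I) ⊆ D.I') (hμ : (μ : Set I) ⊆ D.I') (h : ν ⊆ μ),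
        MG.heckeCov ⟨D.Kν ν, D.Kν_mem ΥG hK hL ν hν⟩ (D.tensorHecke 𝔥 ν (μ \ ν)) (y ν hν) =
          MG.push 1 (le_conj_one (D.Kν_mono h hμ)) (y μ hμ) := by
  have hfin : ∀ v, Finite (HeckeOrbit (D.ι v) (D.U v) (D.K v) (𝔥 v).toFun) := fun v =>
    (𝔥 v).finite_heckeOrbit (D.K_isOpen v) _
  let _ : ∀ v, Fintype (HeckeOrbit (D.ι v) (D.U v) (D.K v) (𝔥 v).toFun) := fun v =>
    Fintype.ofFinite _
  have hloc : ∀ v, ∃ (n : ℕ) (a : Fin n → Cell (D.ι v) (N v) (D.L v)), (Fin n → v ∈ D.I') ∧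
      ∀ hv : v ∈ D.I', ∀ α,
      ∑ j, ((a j).mono (D.L_le v hv)).retract (D.comap_conj_K_mem v) α =
      ∑ t : HeckeOrbit (D.ι v) (D.U v) (D.K v) (𝔥 v).toFun, (𝔥 v).toFun t.1.rep •
        (restrictCell (D.comap_conj_K_mem v) (φ v) t.1.rep).retract (D.comap_conj_K_mem v) α := by
    intro v
    by_cases hv : v ∈ D.I'
    · obtain ⟨ζ, hz⟩ := hζ v hv
      obtain ⟨n, a, ha⟩ := hz.exists_cells (D.comap_conj_K_mem v) (hH v) (hN v).1 (hNt v)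
        (D.K_isOpen v) (D.L_le v hv) (𝔥 v) le_rfl (φ v)
      exact ⟨n, a, fun _ => hv, fun _ => ha⟩
    -- Outside `I'` there is no inclusion `L_v ⊆ K_v`, and no cell is needed.
    · exact ⟨0, Fin.elim0, fun j => j.elim0, fun h => absurd h hv⟩
  choose n a hA ha using hloc
  refine ⟨fun ν hν => gluedClass i Ψ hA a hν (D.Kν_mem ΥG hK hL ν hν), ?_, ?_⟩
  · rw [← hΨ]
    exact gluedClass_empty Ψ hA a _ _ _ _
  · intro ν μ hν hμ h
    exact (heckeCov_gluedClass Ψ hA a hi 𝔥 ha hν hμ h _).trans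
      (push_gluedClass Ψ hA a hν hμ h _ _ (D.Kν_mono h hμ)).symm
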